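/- The (infinite) grid is the graph on $\mathbb{Z}^2$ in which two points are joined by an edge if they are at distance one on a common row or a common column. A bend of a path in the grid is an inner point of the path at which it turns from horizontal to vertical or conversely. A $B_2$-EPG representation of a graph $G$ assigns to every vertex $v$ a path $P_v$ of the grid with at most two bends, such that two distinct vertices $u,v$ are adjacent in $G$ if and only if $P_u$ and $P_v$ have at least one grid edge in common. A $B_2$-EPG graph is a finite graph with such a representation. Theorem. There is a polynomial-time algorithm that, given a $B_2$-EPG graph $G$ with a $B_2$-EPG representation, computes a maximum clique of $G$ (that is, a clique with the largest possible number of vertices). Here the representation is given by the number $n$ of vertices and, for every vertex $v$, the coordinates of the end points and of the bends of $P_v$, in their order along the path. The running time is measured on a random access machine with integer registers and arrays, whose unit-cost operations are assignments of constants, copying, addition, subtraction, comparison, and reading or writing an array cell at a computed index; it is bounded by a polynomial in $n$ (independently of the size of the coordinates). The output is the indicator function of the clique on the set of vertices. -/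

import Mathlib

/-! ### Edge-intersection graphs of paths on a grid -/

/-- The orthogonal grid: the points are the pairs (column, row) of integers, and two points are
joined by a grid edge if they are at distance one on a common column or on a common row. -/
def gridGraph : SimpleGraph (ℤ × ℤ) where
  Adj p q := (p.1 = q.1 ∧ |p.2 - q.2| = 1) ∨ (p.2 = q.2 ∧ |p.1 - q.1| = 1)
  symm := ⟨fun p q h => by
    rcases h with ⟨h, h'⟩ | ⟨h, h'⟩
    · exact Or.inl ⟨h.symm, by rw [abs_sub_comm]; exact h'⟩
    · exact Or.inr ⟨h.symm, by rw [abs_sub_comm]; exact h'⟩⟩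
  loopless := ⟨fun p h => by simp at h⟩

/-- The bends, in order, of a path given by the list of the grid points that it visits: the inner
points `q` at which the path turns, that is, at which the previous point, `q` and the next point
are neither on a common column nor on a common row. -/
def bendPoints : List (ℤ × ℤ) → List (ℤ × ℤ)
  | p :: q :: r :: l =>
      if (p.1 = q.1 ∧ q.1 = r.1) ∨ (p.2 = q.2 ∧ q.2 = r.2) then bendPoints (q :: r :: l)
      else q :: bendPoints (q :: r :: l)
  | _ => []

/-- A representation of `G` as a `B_k`-EPG graph: every vertex is assigned a (simple) path of the
grid with at most `k` bends, and two distinct vertices are adjacent if and only if their paths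
have a grid edge in common. -/
structure EPGRep (k : ℕ) {V : Type*} (G : SimpleGraph V) where
  source : V → ℤ × ℤ
  target : V → ℤ × ℤ
  path : ∀ v, gridGraph.Path (source v) (target v)
  bends_le : ∀ v, (bendPoints (path v).1.support).length ≤ k
  adj_iff : ∀ u v, G.Adj u v ↔ u ≠ v ∧ ∃ e, e ∈ (path u).1.edges ∧ e ∈ (path v).1.edges

/-- The corners of the path of `v`: its source, its bends in order, and then its target
(for all further indices). -/
def EPGRep.corner {k : ℕ} {V : Type*} {G : SimpleGraph V} (R : EPGRep k G) (v : V) (j : ℕ) :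
    ℤ × ℤ :=
  (R.source v :: bendPoints (R.path v).1.support).getD j (R.target v)

/-! ### Random access machines

A random access machine with integer registers and integer arrays. A program is a fixed finite
text, so it uses only finitely many registers and arrays. Every instruction and every test costs
one step. The arithmetic is restricted to addition and subtraction, so that one step lengthens
the numbers in the memory by at most one bit. -/
namespace RAM

/-- A configuration of the memory: the contents of the registers, and the contents of the cells
of the arrays. -/
@[ext] structure State where
  reg : ℕ → ℤ
  arr : ℕ → ℤ → ℤ

/-- The instructions. -/
inductive Instr where
  /-- `x := c` -/
  | const (x : ℕ) (c : ℤ)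
  /-- `x := y` -/
  | copy (x y : ℕ)
  /-- `x := y + z` -/
  | add (x y z : ℕ)
  /-- `x := y - z` -/
  | sub (x y z : ℕ)
  /-- `x := a[i]`, where `i` is a register -/
  | load (x a i : ℕ)
  /-- `a[i] := x`, where `i` is a register -/
  | store (a i x : ℕ)

/-- The effect of an instruction on the memory. -/
def Instr.apply : Instr → State → State
  | const x c, s => { s with reg := Function.update s.reg x c }
  | copy x y, s => { s with reg := Function.update s.reg x (s.reg y) }
  | add x y z, s => { s with reg := Function.update s.reg x (s.reg y + s.reg z) }
  | sub x y z, s => { s with reg := Function.update s.reg x (s.reg y - s.reg z) }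
  | load x a i, s => { s with reg := Function.update s.reg x (s.arr a (s.reg i)) }
  | store a i x, s =>
      { s with arr := Function.update s.arr a (Function.update (s.arr a) (s.reg i) (s.reg x)) }

/-- The programs. The tests compare two registers. -/
inductive Prog where
  | instr (c : Instr)
  | seq (P Q : Prog)
  /-- if `x < y` then `P` else `Q` -/
  | branch (x y : ℕ) (P Q : Prog)
  /-- while `x < y` do `P` -/
  | loop (x y : ℕ) (P : Prog)

/-- `Exec P s t s'`: started in the memory `s`, the program `P` halts after exactly `t` steps, in
the memory `s'`. -/
inductive Exec : Prog → State → ℕ → State → Prop where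
  | instr (c : Instr) (s : State) : Exec (.instr c) s 1 (c.apply s)
  | seq {P Q : Prog} {s s' s'' : State} {t t' : ℕ} :
      Exec P s t s' → Exec Q s' t' s'' → Exec (.seq P Q) s (t + t') s''
  | branch_true {x y : ℕ} {P Q : Prog} {s s' : State} {t : ℕ} :
      s.reg x < s.reg y → Exec P s t s' → Exec (.branch x y P Q) s (t + 1) s'
  | branch_false {x y : ℕ} {P Q : Prog} {s s' : State} {t : ℕ} :
      ¬ s.reg x < s.reg y → Exec Q s t s' → Exec (.branch x y P Q) s (t + 1) s'
  | loop_true {x y : ℕ} {P : Prog} {s s' s'' : State} {t t' : ℕ} :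
      s.reg x < s.reg y → Exec P s t s' → Exec (.loop x y P) s' t' s'' →
        Exec (.loop x y P) s (t + t' + 1) s''
  | loop_false {x y : ℕ} {P : Prog} {s : State} :
      ¬ s.reg x < s.reg y → Exec (.loop x y P) s 1 s

/-- The machine is deterministic: the number of steps and the final memory are determined by the
program and the initial memory. -/
theorem Exec.deterministic {P : Prog} {s s₁ s₂ : State} {t₁ t₂ : ℕ}
    (h₁ : Exec P s t₁ s₁) (h₂ : Exec P s t₂ s₂) : t₁ = t₂ ∧ s₁ = s₂ := by
  induction h₁ generalizing t₂ s₂ with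
  | instr c s => cases h₂; exact ⟨rfl, rfl⟩
  | seq _ _ ih ih' =>
    cases h₂ with
    | seq k k' =>
      obtain ⟨rfl, rfl⟩ := ih k
      obtain ⟨rfl, rfl⟩ := ih' k'
      exact ⟨rfl, rfl⟩
  | branch_true h _ ih =>
    cases h₂ with
    | branch_true _ k => obtain ⟨rfl, rfl⟩ := ih k; exact ⟨rfl, rfl⟩
    | branch_false g _ => exact absurd h g
  | branch_false h _ ih =>
    cases h₂ with
    | branch_true g _ => exact absurd g h
    | branch_false _ k => obtain ⟨rfl, rfl⟩ := ih k; exact ⟨rfl, rfl⟩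
  | loop_true h _ _ ih ih' =>
    cases h₂ with
    | loop_true _ k k' =>
      obtain ⟨rfl, rfl⟩ := ih k
      obtain ⟨rfl, rfl⟩ := ih' k'
      exact ⟨rfl, rfl⟩
    | loop_false g => exact absurd h g
  | loop_false h =>
    cases h₂ with
    | loop_true g _ _ => exact absurd g h
    | loop_false _ => exact ⟨rfl, rfl⟩

end RAM

/-- The input for a `B_2`-EPG graph on the vertices `0, …, n - 1` with its representation:
register 0 holds `n`, and, for `j ≤ 3`, cell `i` of array `2 * j` (of array `2 * j + 1`) holds the
column (the row) of the `j`-th of the four corners of the path of vertex `i`.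
Everything else is 0. -/
def EPGRep.input {n : ℕ} {G : SimpleGraph (Fin n)} (R : EPGRep 2 G) : RAM.State where
  reg x := if x = 0 then (n : ℤ) else 0
  arr a i :=
    if h : a < 8 ∧ 0 ≤ i ∧ i < (n : ℤ) then
      if a % 2 = 0 then (R.corner ⟨i.toNat, by omega⟩ (a / 2)).1
      else (R.corner ⟨i.toNat, by omega⟩ (a / 2)).2
    else 0

/-! A bounded amount of information about a clique `C` reduces the problem to co-bipartite graphs.
By `exists_pattern_cover` there is a constant `m` such that, for some `m` vertices, the order types
over them (how the coordinates of a path compare with each other and with those of the `m` paths)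
contain two sets `S` and `T` that together cover `C`, while any two paths with types in the same set
share an edge.

The family is built by adding members of `C` with extreme coordinates for every order type. Suppose
that all representatives of the type of `x` meet `y` on one fixed line or across it. If two paths of
the refined types of `x` and `y` were apart on that line, an extreme representative `x'` would be
apart from `y` as well; so `x'` and `y` meet across it, at a common bend, and the order types force
this bend on the given pair (`Extremal.share`). A path has eight coordinates, so among nine such
extensions one captures no new coordinate of `y`. At that step all lines on which `y` meets the
family are already known, and the only pairs left are those using the same two parallel lines
(`Extremal.share_or_parallel`). These are split by a pivot on the first line: the paths through the
edge left of the pivot have it in common, and the others meet near the second line by a Helly type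
argument for intervals (`overlapNear_of_not_containsPivot`). This split yields `S` and `T`.

The algorithm tries all `m`-tuples of vertices and all pairs of sets of order types, which is
polynomial as `m` is constant. For a correct guess, the pairs between the two sides that share no
edge form a bipartite graph whose independent sets are the cliques. An auction finds a matching in
it, and cutting the prices at a suitable level gives a maximum independent set, as in König's
theorem (`AuctionInv.exists_level`). Every candidate is checked to be a clique before it is kept, so
wrong guesses do no harm. -/

/-! ### Rectilinear paths with three segments -/

/-- The four corners of a path: `p j false` is the column and `p j true` the row of corner `j`. -/
abbrev Corners := Fin 4 → Bool → ℤ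

namespace Corners

/-- Up to the orientation, the path consists of a segment along `o`, one across, and one along. -/
def Shape (o : Bool) (p : Corners) : Prop :=
  p 0 (!o) = p 1 (!o) ∧ p 1 o = p 2 o ∧ p 2 (!o) = p 3 (!o) ∧ (p 1 (!o) = p 2 (!o) → p 2 o = p 3 o)

/-- The corners of a path with at most two bends. -/
def Valid (p : Corners) : Prop := ∃ o, Shape o p

/-- `i` and `j` are consecutive corners, joined by a nondegenerate segment along `o`. -/
def Seg (p : Corners) (o : Bool) (i j : Fin 4) : Prop :=
  (i.val + 1 = j.val ∨ j.val + 1 = i.val) ∧ p i (!o) = p j (!o) ∧ p i o < p j o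

/-- The paths overlap on the line along `o` at `a`. -/
def Overlap (p q : Corners) (o : Bool) (a : ℤ) : Prop :=
  ∃ i j k l, Seg p o i j ∧ Seg q o k l ∧ p i (!o) = a ∧ q k (!o) = a ∧ p i o < q l o ∧ q k o < p j o

/-- The paths have an edge in common. -/
def Share (p q : Corners) : Prop := ∃ o a, Overlap p q o a

/-- The paths overlap on the line along `o` at `a` or on a line across. -/
def OverlapNear (p q : Corners) (o : Bool) (a : ℤ) : Prop :=
  Overlap p q o a ∨ ∃ b, Overlap p q (!o) b

theorem Overlap.symm {p q : Corners} {o : Bool} {a : ℤ} (h : Overlap p q o a) :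
    Overlap q p o a := by
  obtain ⟨i, j, k, l, h1, h2, h3, h4, h5, h6⟩ := h
  exact ⟨k, l, i, j, h2, h1, h4, h3, h6, h5⟩

theorem Share.symm {p q : Corners} (h : Share p q) : Share q p := by
  obtain ⟨o, a, h⟩ := h
  exact ⟨o, a, h.symm⟩

theorem Seg.cases {p : Corners} {o : Bool} {i j : Fin 4} (h : Seg p o i j) :
    ((i = 0 ∧ j = 1) ∨ (i = 1 ∧ j = 0) ∨ (i = 1 ∧ j = 2) ∨ (i = 2 ∧ j = 1) ∨ (i = 2 ∧ j = 3) ∨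
      (i = 3 ∧ j = 2)) := by
  have := h.1
  omega

/-- Allows a case analysis relative to a given direction, whatever the orientation of the path. -/
theorem Valid.shape {p : Corners} (h : Valid p) (o : Bool) :
    (p 0 (!o) = p 1 (!o) ∧ p 1 o = p 2 o ∧ p 2 (!o) = p 3 (!o) ∧
      (p 1 (!o) = p 2 (!o) → p 2 o = p 3 o)) ∨
    (p 0 o = p 1 o ∧ p 1 (!o) = p 2 (!o) ∧ p 2 o = p 3 o ∧
      (p 1 o = p 2 o → p 2 (!o) = p 3 (!o))) := by
  obtain ⟨o', h⟩ := h
  by_cases e : o' = o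
  · subst e; exact Or.inl h
  · have : o' = !o := by cases o <;> cases o' <;> simp_all
    subst this
    right
    simpa [Shape] using h

/-- The outer segments could lie on one line only if the middle one were degenerate, and then the
last clause of `Shape` makes the third one degenerate too. So a line carries at most one segment of
a path. -/
theorem Valid.unique {p : Corners} (h : Valid p) {o : Bool} {i j k l : Fin 4} (h1 : Seg p o i j)
    (h2 : Seg p o k l) (e : p i (!o) = p k (!o)) : i = k ∧ j = l := by
  have c1 := h1.cases
  have c2 := h2.cases
  have e1 := h1.2
  have e2 := h2.2
  rcases h.shape o with s | s <;>
  rcases c1 with ⟨rfl, rfl⟩ | ⟨rfl, rfl⟩ | ⟨rfl, rfl⟩ | ⟨rfl, rfl⟩ | ⟨rfl, rfl⟩ | ⟨rfl, rfl⟩ <;>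
  rcases c2 with ⟨rfl, rfl⟩ | ⟨rfl, rfl⟩ | ⟨rfl, rfl⟩ | ⟨rfl, rfl⟩ | ⟨rfl, rfl⟩ | ⟨rfl, rfl⟩ <;>
  first
  | exact ⟨rfl, rfl⟩
  | (exfalso; omega)

/-- Segments of different directions meet at a bend. -/
theorem Valid.bend {p : Corners} (h : Valid p) {o : Bool} {i j k l : Fin 4} (h1 : Seg p o i j)
    (h2 : Seg p (!o) k l) :
    (p k o = p i o ∨ p k o = p j o) ∧ (p k (!o) = p i (!o) ∨ p l (!o) = p i (!o)) := by
  have c1 := h1.cases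
  have c2 := h2.cases
  have e1 := h1.2
  have e2 := h2.2
  rw [Bool.not_not] at e2
  rcases h.shape o with s | s <;>
  rcases c1 with ⟨rfl, rfl⟩ | ⟨rfl, rfl⟩ | ⟨rfl, rfl⟩ | ⟨rfl, rfl⟩ | ⟨rfl, rfl⟩ | ⟨rfl, rfl⟩ <;>
  rcases c2 with ⟨rfl, rfl⟩ | ⟨rfl, rfl⟩ | ⟨rfl, rfl⟩ | ⟨rfl, rfl⟩ | ⟨rfl, rfl⟩ | ⟨rfl, rfl⟩ <;>
  omega

/-- Two parallel segments are joined by a segment across, and it is the only one. -/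
theorem Valid.parallel {p : Corners} (h : Valid p) {o : Bool} {i j k l : Fin 4}
    (h1 : Seg p o i j) (h2 : Seg p o k l) (e : p i (!o) < p k (!o)) :
    ∃ c, (∃ m m', Seg p (!o) m m' ∧ p m o = c ∧ p m (!o) = p i (!o) ∧ p m' (!o) = p k (!o)) ∧
      (p i o = c ∨ p j o = c) ∧ (p k o = c ∨ p l o = c) ∧
      ∀ m m', Seg p (!o) m m' → p m o = c := by
  have c1 := h1.cases
  have c2 := h2.cases
  have e1 := h1.2
  have e2 := h2.2
  rcases h.shape o with s | s
  -- The parallel segments are the first and the third, so the middle one joins them, at the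
  -- coordinate of corner 1.
  · refine ⟨p 1 o, ?_, ?_⟩
    · by_cases hlt : p 1 (!o) < p 2 (!o)
      · refine ⟨1, 2, ⟨by decide, by simpa using s.2.1, hlt⟩, rfl, ?_⟩
        rcases c1 with ⟨rfl, rfl⟩ | ⟨rfl, rfl⟩ | ⟨rfl, rfl⟩ | ⟨rfl, rfl⟩ | ⟨rfl, rfl⟩ | ⟨rfl, rfl⟩ <;>
        rcases c2 with ⟨rfl, rfl⟩ | ⟨rfl, rfl⟩ | ⟨rfl, rfl⟩ | ⟨rfl, rfl⟩ | ⟨rfl, rfl⟩ | ⟨rfl, rfl⟩ <;>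
        omega
      · refine ⟨2, 1, ⟨by decide, by simpa using s.2.1.symm, ?_⟩, s.2.1.symm, ?_⟩ <;>
        rcases c1 with ⟨rfl, rfl⟩ | ⟨rfl, rfl⟩ | ⟨rfl, rfl⟩ | ⟨rfl, rfl⟩ | ⟨rfl, rfl⟩ | ⟨rfl, rfl⟩ <;>
        rcases c2 with ⟨rfl, rfl⟩ | ⟨rfl, rfl⟩ | ⟨rfl, rfl⟩ | ⟨rfl, rfl⟩ | ⟨rfl, rfl⟩ | ⟨rfl, rfl⟩ <;>
        omega
    · refine ⟨?_, ?_, ?_⟩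
      · rcases c1 with ⟨rfl, rfl⟩ | ⟨rfl, rfl⟩ | ⟨rfl, rfl⟩ | ⟨rfl, rfl⟩ | ⟨rfl, rfl⟩ | ⟨rfl, rfl⟩ <;>
        omega
      · rcases c2 with ⟨rfl, rfl⟩ | ⟨rfl, rfl⟩ | ⟨rfl, rfl⟩ | ⟨rfl, rfl⟩ | ⟨rfl, rfl⟩ | ⟨rfl, rfl⟩ <;>
        omega
      · intro m m' hm
        have c3 := hm.cases
        have e3 := hm.2
        rw [Bool.not_not] at e3
        rcases c3 with ⟨rfl, rfl⟩ | ⟨rfl, rfl⟩ | ⟨rfl, rfl⟩ | ⟨rfl, rfl⟩ | ⟨rfl, rfl⟩ | ⟨rfl, rfl⟩ <;>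
        omega
  -- In the other orientation only the middle segment can be along `o`.
  · exfalso
    rcases c1 with ⟨rfl, rfl⟩ | ⟨rfl, rfl⟩ | ⟨rfl, rfl⟩ | ⟨rfl, rfl⟩ | ⟨rfl, rfl⟩ | ⟨rfl, rfl⟩ <;>
    rcases c2 with ⟨rfl, rfl⟩ | ⟨rfl, rfl⟩ | ⟨rfl, rfl⟩ | ⟨rfl, rfl⟩ | ⟨rfl, rfl⟩ | ⟨rfl, rfl⟩ <;>
    omega

end Corners

/-! ### Order types of paths over a family -/

section OrderType

variable {V : Type*} (z : V → Corners)

/-- `u` and `x` have the same order type over `K`: their coordinates compare in the same way with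
each other and with the coordinates of the elements of `K`. -/
def SameType (K : Set V) (u x : V) : Prop :=
  (∀ i o j o', cmp (z u i o) (z u j o') = cmp (z x i o) (z x j o')) ∧
    ∀ k ∈ K, ∀ i o j o', cmp (z u i o) (z k j o') = cmp (z x i o) (z k j o')

variable {z}

theorem SameType.symm {K : Set V} {u x : V} (h : SameType z K u x) : SameType z K x u :=
  ⟨fun i o j o' => (h.1 i o j o').symm, fun k hk i o j o' => (h.2 k hk i o j o').symm⟩

theorem SameType.trans {K : Set V} {u x y : V} (h : SameType z K u x) (h' : SameType z K x y) :
    SameType z K u y :=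
  ⟨fun i o j o' => (h.1 i o j o').trans (h'.1 i o j o'),
    fun k hk i o j o' => (h.2 k hk i o j o').trans (h'.2 k hk i o j o')⟩

theorem SameType.mono {K K' : Set V} {u x : V} (h : SameType z K' u x) (hK : K ⊆ K') :
    SameType z K u x :=
  ⟨h.1, fun k hk => h.2 k (hK hk)⟩

theorem SameType.lt_iff {K : Set V} {u x : V} (h : SameType z K u x) (i o j o') :
    z u i o < z u j o' ↔ z x i o < z x j o' := by
  rw [← cmp_eq_lt_iff, ← cmp_eq_lt_iff, h.1]

theorem SameType.eq_iff {K : Set V} {u x : V} (h : SameType z K u x) (i o j o') :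
    z u i o = z u j o' ↔ z x i o = z x j o' := by
  rw [← cmp_eq_eq_iff (z u i o), ← cmp_eq_eq_iff (z x i o), h.1]

theorem SameType.lt_iff_left {K : Set V} {u x k : V} (h : SameType z K u x) (hk : k ∈ K)
    (i o j o') : z u i o < z k j o' ↔ z x i o < z k j o' := by
  rw [← cmp_eq_lt_iff, ← cmp_eq_lt_iff, h.2 k hk]

theorem SameType.lt_iff_right {K : Set V} {u x k : V} (h : SameType z K u x) (hk : k ∈ K)
    (i o j o') : z k j o' < z u i o ↔ z k j o' < z x i o := by
  rw [← cmp_eq_gt_iff, ← cmp_eq_gt_iff, h.2 k hk]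

theorem SameType.eq_iff_left {K : Set V} {u x k : V} (h : SameType z K u x) (hk : k ∈ K)
    (i o j o') : z u i o = z k j o' ↔ z x i o = z k j o' := by
  rw [← cmp_eq_eq_iff (z u i o), ← cmp_eq_eq_iff (z x i o), h.2 k hk]

theorem SameType.seg {K : Set V} {u x : V} (h : SameType z K u x) {o : Bool} {i j : Fin 4}
    (hs : (z x).Seg o i j) : (z u).Seg o i j :=
  ⟨hs.1, (h.eq_iff _ _ _ _).2 hs.2.1, (h.lt_iff _ _ _ _).2 hs.2.2⟩

variable (z)

/-- The set of the coordinates of the elements of `K`. -/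
def coords (K : Set V) : Set ℤ := {a | ∃ k ∈ K, ∃ j o, z k j o = a}

variable {z}

theorem coords_mono {K K' : Set V} (h : K ⊆ K') : coords z K ⊆ coords z K' := by
  rintro a ⟨k, hk, j, o, e⟩
  exact ⟨k, h hk, j, o, e⟩

/-- Coordinates occurring in the family are fixed by the order type; this carries known lines and
pivots from one path to another. -/
theorem SameType.coord_eq {K : Set V} {u x : V} (h : SameType z K u x) {a : ℤ}
    (ha : a ∈ coords z K) {i o} (e : z x i o = a) : z u i o = a := by
  obtain ⟨k, hk, j, o', rfl⟩ := ha
  exact (h.eq_iff_left hk _ _ _ _).2 e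

theorem SameType.coord_lt_iff {K : Set V} {u x : V} (h : SameType z K u x) {a : ℤ}
    (ha : a ∈ coords z K) {i o} : z u i o < a ↔ z x i o < a := by
  obtain ⟨k, hk, j, o', rfl⟩ := ha
  exact h.lt_iff_left hk _ _ _ _

variable (z)

/-- `K'` extends `K`, and within `C` it contains elements with extreme coordinates of every
order type over `K`. -/
structure Extremal (C K K' : Set V) : Prop where
  subset : K ⊆ K'
  subset_clique : K' ⊆ C
  min : ∀ x ∈ C, ∀ i o, ∃ x' ∈ K', SameType z K x' x ∧ z x' i o ≤ z x i o
  max : ∀ x ∈ C, ∀ i o, ∃ x' ∈ K', SameType z K x' x ∧ z x i o ≤ z x' i o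

variable {z}

open Corners

/-- If all elements of `K'` of the order type of `x` overlap with `y` near a line, then so do all paths
of the order types of `x` and `y` with each other. -/
theorem Extremal.share {C K K' : Set V} (hK : Extremal z C K K') (hz : ∀ v, Valid (z v))
    {x y u v : V} (hx : x ∈ C) {o : Bool} {i j k l : Fin 4}
    (sx : Seg (z x) o i j) (sy : Seg (z y) o k l) {a : ℤ} (ha : a ∈ coords z K)
    (ex : z x i (!o) = a) (ey : z y k (!o) = a)
    (H : ∀ x' ∈ K', SameType z K x' x → OverlapNear (z x') (z y) o a)
    (hu : SameType z K' u x) (hv : SameType z K' v y) : Share (z u) (z v) := by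
  have su := hu.seg sx
  have sv := hv.seg sy
  have ha' := coords_mono hK.subset ha
  have eu := hu.coord_eq ha' ex
  have ev := hv.coord_eq ha' ey
  by_contra hns
  -- Without a common edge, the segments of `u` and `v` on the line at `a` are separated in one of
  -- two ways.
  have hdis : z u j o ≤ z v k o ∨ z v l o ≤ z u i o := by
    by_contra hc
    push Not at hc
    exact hns ⟨o, a, i, j, k, l, su, sv, eu, ev, hc.2, hc.1⟩
  -- the common end of the two paths on the line, the other ends, and the perpendicular segments
  have key : ∀ x' ∈ K', SameType z K x' x → ∀ f : Fin 4, ∀ g : Fin 4,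
      (f = i ∨ f = j) → (g = k ∨ g = l) →
      (∀ m m' n n', Seg (z x') (!o) m m' → Seg (z y) (!o) n n' → z x' m o = z y n o →
        z x' m o = z x' f o ∧ z y n o = z y g o) →
      ¬ Overlap (z x') (z y) o a → (z v g o = z x' f o → z u f o = z x' f o) → False := by
    intro x' hx' hsx' f g hf hg hb hno hue
    rcases H x' hx' hsx' with h | ⟨b, m, m', n, n', s1, s2, e1, e2, h1, h2⟩
    · exact hno h
    · rw [Bool.not_not] at e1 e2
      obtain ⟨b1, b2⟩ := hb m m' n n' s1 s2 (e1.trans e2.symm)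
      have s1' := ((hu.mono hK.subset).trans hsx'.symm).seg s1
      have s2' := hv.seg s2
      have sx' := hsx'.seg sx
      have ex' := hsx'.coord_eq ha ex
      have hbend1 := ((hz x').bend sx' s1).2
      have hbend2 := ((hz y).bend sy s2).2
      have hux' := (hu.mono hK.subset).trans hsx'.symm
      -- The bend of `y` is at a coordinate of `x' ∈ K'`, so the order type over `K'` forces it on
      -- `v`.
      have evg : z v g o = z x' f o := by
        refine hv.coord_eq ⟨x', hx', f, o, rfl⟩ ?_
        rw [← b1, ← b2, e1, e2]
      have euf := hue evg
      have um : z u m o = z u f o := (hux'.eq_iff _ _ _ _).2 b1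
      have vn : z v n o = z v g o := (hv.eq_iff _ _ _ _).2 b2
      have hum : z u m (!o) = z u i (!o) ↔ z x' m (!o) = z x' i (!o) := hux'.eq_iff _ _ _ _
      have hum' : z u m' (!o) = z u i (!o) ↔ z x' m' (!o) = z x' i (!o) := hux'.eq_iff _ _ _ _
      have hvn : z v n (!o) = z v k (!o) ↔ z y n (!o) = z y k (!o) := hv.eq_iff _ _ _ _
      have hvn' : z v n' (!o) = z v k (!o) ↔ z y n' (!o) = z y k (!o) := hv.eq_iff _ _ _ _
      have t1 := s1.2.2
      have t2 := s2.2.2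
      have t3 := s1'.2.2
      have t4 := s2'.2.2
      -- The segments across of `u` and `v` leave the common bend to the same side, because those of
      -- `x'` and `y`, which overlap, do.
      refine hns ⟨!o, z u m o, m, m', n, n', s1', s2', by simp, by simp; omega, ?_, ?_⟩ <;> omega
  have t1 := sx.2.2
  have t2 := sy.2.2
  rcases hdis with hd | hd
  -- Here `u` ends before `v` begins. An `x'` ending no later than `x` also ends no later than `u`,
  -- hence not after the beginning of `v`, nor of `y`.
  · obtain ⟨x', hx', hs, hle⟩ := hK.min x hx j o
    have hs' := hs.seg sx
    have h1 : z x' j o ≤ z u j o := by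
      by_contra hc
      exact absurd ((hu.lt_iff_left hx' j o j o).1 (not_le.1 hc)) (not_lt.2 hle)
    have h2 : z x' j o ≤ z y k o := by
      by_contra hc
      have := (hv.lt_iff_left hx' k o j o).2 (not_le.1 hc)
      omega
    have t3 := hs'.2.2
    have ex' := hs.coord_eq ha ex
    refine key x' hx' hs j k (Or.inr rfl) (Or.inl rfl) ?_ ?_ (fun e => by omega)
    · intro m m' n n' s1 s2 e
      have b1 := ((hz x').bend hs' s1).1
      have b2 := ((hz y).bend sy s2).1
      omega
    · rintro ⟨i1, j1, k1, l1, r1, r2, e1, e2, o1, o2⟩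
      obtain ⟨rfl, rfl⟩ := (hz x').unique hs' r1 (ex'.trans e1.symm)
      obtain ⟨rfl, rfl⟩ := (hz y).unique sy r2 (ey.trans e2.symm)
      omega
  · obtain ⟨x', hx', hs, hle⟩ := hK.max x hx i o
    have hs' := hs.seg sx
    have h1 : z u i o ≤ z x' i o := by
      by_contra hc
      exact absurd ((hu.lt_iff_right hx' i o i o).1 (not_le.1 hc)) (not_lt.2 hle)
    have h2 : z y l o ≤ z x' i o := by
      by_contra hc
      have := (hv.lt_iff_right hx' l o i o).2 (not_le.1 hc)
      omega
    have t3 := hs'.2.2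
    have ex' := hs.coord_eq ha ex
    refine key x' hx' hs i l (Or.inl rfl) (Or.inr rfl) ?_ ?_ (fun e => by omega)
    · intro m m' n n' s1 s2 e
      have b1 := ((hz x').bend hs' s1).1
      have b2 := ((hz y).bend sy s2).1
      omega
    · rintro ⟨i1, j1, k1, l1, r1, r2, e1, e2, o1, o2⟩
      obtain ⟨rfl, rfl⟩ := (hz x').unique hs' r1 (ex'.trans e1.symm)
      obtain ⟨rfl, rfl⟩ := (hz y).unique sy r2 (ey.trans e2.symm)
      omega

end OrderType

/-! ### Paths with two parallel segments -/

namespace Corners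

/-- The path has a segment on the line along `o` at `a`. -/
def Uses (p : Corners) (o : Bool) (a : ℤ) : Prop := ∃ i j, Seg p o i j ∧ p i (!o) = a

theorem Valid.two_lines {p : Corners} (h : Valid p) (o : Bool) :
    ∃ A B, ∀ a, Uses p o a → a = A ∨ a = B := by
  rcases h.shape o with s | s
  · refine ⟨p 0 (!o), p 3 (!o), ?_⟩
    rintro a ⟨i, j, h1, rfl⟩
    have e1 := h1.2
    rcases h1.cases with ⟨rfl, rfl⟩ | ⟨rfl, rfl⟩ | ⟨rfl, rfl⟩ | ⟨rfl, rfl⟩ | ⟨rfl, rfl⟩ | ⟨rfl, rfl⟩ <;>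
    omega
  · refine ⟨p 1 (!o), p 1 (!o), ?_⟩
    rintro a ⟨i, j, h1, rfl⟩
    have e1 := h1.2
    rcases h1.cases with ⟨rfl, rfl⟩ | ⟨rfl, rfl⟩ | ⟨rfl, rfl⟩ | ⟨rfl, rfl⟩ | ⟨rfl, rfl⟩ | ⟨rfl, rfl⟩ <;>
    omega

/-- The path consists of the segments `[l, r]` at `a` and `[l', r']` at `b`, both along `o`, and
a segment joining them across at `c`. -/
structure Double (p : Corners) (o : Bool) (a b l r l' r' c : ℤ) : Prop where
  fst : ∃ i j, Seg p o i j ∧ p i (!o) = a ∧ p i o = l ∧ p j o = r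
  snd : ∃ i j, Seg p o i j ∧ p i (!o) = b ∧ p i o = l' ∧ p j o = r'
  across : ∃ i j, Seg p (!o) i j ∧ p i o = c ∧ p i (!o) = a ∧ p j (!o) = b
  across_unique : ∀ i j, Seg p (!o) i j → p i o = c
  fst_end : l = c ∨ r = c
  snd_end : l' = c ∨ r' = c
  fst_lt : l < r
  snd_lt : l' < r'
  lines : ∀ e, Uses p o e → e = a ∨ e = b

theorem Valid.double {p : Corners} (h : Valid p) {o : Bool} {a b : ℤ} (hab : a < b)
    (ha : Uses p o a) (hb : Uses p o b) : ∃ l r l' r' c, Double p o a b l r l' r' c := by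
  obtain ⟨A, B, hAB⟩ := h.two_lines o
  have h1 := hAB a ha
  have h2 := hAB b hb
  obtain ⟨i, j, s1, rfl⟩ := ha
  obtain ⟨k, l, s2, rfl⟩ := hb
  obtain ⟨c, hc, he, he', hu⟩ := h.parallel s1 s2 hab
  refine ⟨p i o, p j o, p k o, p l o, c, ⟨i, j, s1, rfl, rfl, rfl⟩, ⟨k, l, s2, rfl, rfl, rfl⟩, hc,
    hu, he, he', s1.2.2, s2.2.2, fun e hue => ?_⟩
  have := hAB e hue
  omega

theorem Double.not_across {p : Corners} {o : Bool} {a b l r l' r' c : ℤ}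
    (h : Double p o a b l r l' r' c) {e f : ℤ} (he : Uses p (!o) e) (hf : Uses p (!o) f) :
    e = f := by
  obtain ⟨i, j, s, rfl⟩ := he
  obtain ⟨i', j', s', rfl⟩ := hf
  have := h.across_unique _ _ s
  have := h.across_unique _ _ s'
  rw [Bool.not_not]
  omega

/-- The two parallel lines of a path are determined by the path. -/
theorem Valid.parallel_unique {p : Corners} (h : Valid p) {o o' : Bool} {a b a' b' : ℤ}
    (hab : a < b) (hab' : a' < b') (ha : Uses p o a) (hb : Uses p o b) (ha' : Uses p o' a')
    (hb' : Uses p o' b') : o = o' ∧ a = a' ∧ b = b' := by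
  obtain ⟨l, r, l', r', c, hd⟩ := h.double hab ha hb
  by_cases e : o = o'
  · subst e
    have := hd.lines _ ha'
    have := hd.lines _ hb'
    refine ⟨rfl, ?_, ?_⟩ <;> omega
  · have : o' = !o := by cases o <;> cases o' <;> simp_all
    subst this
    exact absurd (hd.not_across ha' hb') hab'.ne

theorem Double.overlap_across {p q : Corners} {o : Bool} {a b l r l' r' c L R L' R' C : ℤ}
    (hp : Double p o a b l r l' r' c) (hq : Double q o a b L R L' R' C) {e : ℤ}
    (h : Overlap p q (!o) e) : c = C := by
  obtain ⟨i, j, i', j', s, s', e1, e2, -⟩ := h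
  have := hp.across_unique _ _ s
  have := hq.across_unique _ _ s'
  rw [Bool.not_not] at e1 e2
  omega

theorem Double.overlap_fst {p q : Corners} (vp : Valid p) (vq : Valid q)
    {o : Bool} {a b l r l' r' c L R L' R' C : ℤ}
    (hp : Double p o a b l r l' r' c) (hq : Double q o a b L R L' R' C) :
    Overlap p q o a ↔ l < R ∧ L < r := by
  obtain ⟨i, j, s, ea, rfl, rfl⟩ := hp.fst
  obtain ⟨i', j', s', ea', rfl, rfl⟩ := hq.fst
  constructor
  · rintro ⟨i1, j1, i2, j2, s1, s2, e1, e2, h1, h2⟩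
    obtain ⟨rfl, rfl⟩ := vp.unique s s1 (ea.trans e1.symm)
    obtain ⟨rfl, rfl⟩ := vq.unique s' s2 (ea'.trans e2.symm)
    exact ⟨h1, h2⟩
  · rintro ⟨h1, h2⟩
    exact ⟨i, j, i', j', s, s', ea, ea', h1, h2⟩

theorem Double.overlap_snd {p q : Corners} (vp : Valid p) (vq : Valid q)
    {o : Bool} {a b l r l' r' c L R L' R' C : ℤ}
    (hp : Double p o a b l r l' r' c) (hq : Double q o a b L R L' R' C) :
    Overlap p q o b ↔ l' < R' ∧ L' < r' := by
  obtain ⟨i, j, s, ea, rfl, rfl⟩ := hp.snd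
  obtain ⟨i', j', s', ea', rfl, rfl⟩ := hq.snd
  constructor
  · rintro ⟨i1, j1, i2, j2, s1, s2, e1, e2, h1, h2⟩
    obtain ⟨rfl, rfl⟩ := vp.unique s s1 (ea.trans e1.symm)
    obtain ⟨rfl, rfl⟩ := vq.unique s' s2 (ea'.trans e2.symm)
    exact ⟨h1, h2⟩
  · rintro ⟨h1, h2⟩
    exact ⟨i, j, i', j', s, s', ea, ea', h1, h2⟩

/-- The segments across both span the whole distance from `a` to `b`, so they overlap as soon as
they are on the same line. Meeting near the second line thus becomes a condition on intervals with a
marked end. -/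
theorem Double.overlapNear_iff {p q : Corners} (vp : Valid p) (vq : Valid q)
    {o : Bool} {a b l r l' r' c L R L' R' C : ℤ} (hab : a < b)
    (hp : Double p o a b l r l' r' c) (hq : Double q o a b L R L' R' C) :
    OverlapNear p q o b ↔ (l' < R' ∧ L' < r') ∨ c = C := by
  rw [OverlapNear, hp.overlap_snd vp vq hq]
  refine or_congr_right ⟨fun ⟨e, h⟩ => hp.overlap_across hq h, ?_⟩
  rintro rfl
  obtain ⟨i, j, s, e1, e2, e3⟩ := hp.across
  obtain ⟨i', j', s', e1', e2', e3'⟩ := hq.across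
  exact ⟨c, i, j, i', j', s, s', by simpa using e1, by simpa using e1', by omega, by omega⟩

theorem Double.share {p q : Corners} (vp : Valid p) (vq : Valid q)
    {o : Bool} {a b l r l' r' c L R L' R' C : ℤ}
    (hp : Double p o a b l r l' r' c) (hq : Double q o a b L R L' R' C) (h : Share p q) :
    (l < R ∧ L < r) ∨ (l' < R' ∧ L' < r') ∨ c = C := by
  obtain ⟨o', e, h⟩ := h
  by_cases ho : o' = o
  · subst ho
    have hu : Uses p o' e := by
      obtain ⟨i, j, i', j', s, s', e1, -⟩ := h
      exact ⟨i, j, s, e1⟩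
    rcases hp.lines e hu with rfl | rfl
    · exact Or.inl ((hp.overlap_fst vp vq hq).1 h)
    · exact Or.inr (Or.inl ((hp.overlap_snd vp vq hq).1 h))
  · have : o' = !o := by cases o <;> cases o' <;> simp_all
    subst this
    exact Or.inr (Or.inr (hp.overlap_across hq h))

end Corners

open Corners

/-! ### Reduction to pairs on the same two parallel lines -/

section Structure

variable {V : Type*} {z : V → Corners}

/-- If `K'` has no new coordinates of `y`, then the paths of the order types of `x` and of `y`
share an edge unless `x` and `y` use the same two parallel lines, at coordinates of `K`. -/
theorem Extremal.share_or_parallel {C K K' : Set V} (hK : Extremal z C K K')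
    (hz : ∀ v, Valid (z v)) (hC : ∀ x ∈ C, ∀ y ∈ C, Share (z x) (z y))
    {x y u v : V} (hx : x ∈ C) (hy : y ∈ C)
    (stable : ∀ i o, z y i o ∈ coords z K' → z y i o ∈ coords z K)
    (hu : SameType z K' u x) (hv : SameType z K' v y) :
    Share (z u) (z v) ∨ ∃ o a b, a < b ∧ a ∈ coords z K ∧ b ∈ coords z K ∧
      Uses (z x) o a ∧ Uses (z x) o b ∧ Uses (z y) o a ∧ Uses (z y) o b := by
  -- By stability, a line on which `y` meets an element of `K'` is at a coordinate of `K`; it is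
  -- therefore also used by `x`.
  have common : ∀ x' ∈ K', SameType z K x' x → ∀ o a, Overlap (z x') (z y) o a →
      a ∈ coords z K ∧ Uses (z x) o a ∧ Uses (z y) o a := by
    rintro x' hx' hs o a ⟨i, j, k, l, s1, s2, e1, e2, -⟩
    have hmem : a ∈ coords z K := by
      rw [← e2]
      refine stable _ _ ⟨x', hx', i, !o, e1.trans e2.symm⟩
    exact ⟨hmem, ⟨i, j, hs.symm.seg s1, hs.symm.coord_eq hmem e1⟩, ⟨k, l, s2, e2⟩⟩
  -- Any representative of the type of `x` serves to fix a first common line; the coordinate chosen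
  -- is immaterial.
  obtain ⟨x₀, hx₀, hs₀, -⟩ := hK.min x hx 0 true
  obtain ⟨o, a, ho⟩ := hC x₀ (hK.subset_clique hx₀) y hy
  obtain ⟨ha, ⟨i, j, sx, ex⟩, ⟨k, l, sy, ey⟩⟩ := common x₀ hx₀ hs₀ o a ho
  by_cases H : ∀ x' ∈ K', SameType z K x' x → OverlapNear (z x') (z y) o a
  · left
    exact hK.share hz hx sx sy ha ex ey H hu hv
  · right
    push Not at H
    obtain ⟨x', hx', hs, hn⟩ := H
    -- As `x'` and `y` meet neither on the first line nor across it, they meet on a second line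
    -- parallel to it.
    obtain ⟨o', b, hb⟩ := hC x' (hK.subset_clique hx') y hy
    have ho' : o' = o := by
      by_contra hne
      have : o' = !o := by cases o <;> cases o' <;> simp_all
      subst this
      exact hn (Or.inr ⟨b, hb⟩)
    subst ho'
    have hne : a ≠ b := by
      rintro rfl
      exact hn (Or.inl hb)
    obtain ⟨hb', hxb, hyb⟩ := common x' hx' hs _ _ hb
    rcases lt_or_gt_of_ne hne with hlt | hlt
    · exact ⟨o', a, b, hlt, ha, hb', ⟨i, j, sx, ex⟩, hxb, ⟨k, l, sy, ey⟩, hyb⟩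
    · exact ⟨o', b, a, hlt, hb', ha, hxb, ⟨i, j, sx, ex⟩, hyb, ⟨k, l, sy, ey⟩⟩

end Structure

open Corners

/-! ### Splitting the paths on two parallel lines by a pivot -/

section Pivot

variable {V : Type*} (z : V → Corners)

/-- The right ends, on the line at `a`, of the elements of `C` that do not overlap near the line at
`b` with some element ending earlier at `a`. -/
def pivotSet (C : Set V) (o : Bool) (a b : ℤ) : Set ℤ :=
  {p | ∃ x ∈ C, ∃ y ∈ C, ∃ i j k l, Seg (z x) o i j ∧ Seg (z y) o k l ∧ z x i (!o) = a ∧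
    z y k (!o) = a ∧ Uses (z x) o b ∧ Uses (z y) o b ∧ z x j o = p ∧ z y l o ≤ p ∧
    ¬ OverlapNear (z x) (z y) o b}

/-- On one of the two parallel lines that it uses, the path of `x` contains the edge to the left
of the pivot. -/
def ContainsPivot (C K : Set V) (x : V) : Prop :=
  ∃ o a b, a < b ∧ a ∈ coords z K ∧ b ∈ coords z K ∧ Uses (z x) o a ∧ Uses (z x) o b ∧
    ∃ p, IsLeast (pivotSet z C o a b) p ∧
      ∃ i j, Seg (z x) o i j ∧ z x i (!o) = a ∧ z x i o < p ∧ p ≤ z x j o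

/-- `K'` contains `K` and the elements of `C` at the pivots of the lines at the coordinates
of `K`. -/
structure Pivotal (C K K' : Set V) : Prop where
  subset : K ⊆ K'
  subset_clique : K' ⊆ C
  pivot : ∀ o a b p, a ∈ coords z K → b ∈ coords z K → IsLeast (pivotSet z C o a b) p →
    p ∈ coords z K'

variable {z}

theorem pivotSet_nonempty_least [Finite V] {C : Set V} {o : Bool} {a b : ℤ}
    (h : (pivotSet z C o a b).Nonempty) : ∃ p, IsLeast (pivotSet z C o a b) p := by
  have hf : (pivotSet z C o a b).Finite := by
    refine (Set.finite_range fun t : V × Fin 4 => z t.1 t.2 o).subset ?_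
    rintro p ⟨x, -, y, -, i, j, k, l, -, -, -, -, -, -, e, -⟩
    exact ⟨(x, j), e⟩
  obtain ⟨p, hp, hmin⟩ := hf.exists_minimal h
  exact ⟨p, hp, fun q hq => (le_total p q).elim id fun hle => hmin hq hle⟩

/-- Replaces corners by the ends of intervals, so that the arguments about the pivot become linear
arithmetic. -/
theorem mem_pivotSet {C : Set V} (hz : ∀ v, Valid (z v)) {o : Bool} {a b : ℤ} (hab : a < b)
    {p : ℤ} : p ∈ pivotSet z C o a b ↔ ∃ x ∈ C, ∃ y ∈ C, ∃ l r l' r' c L R L' R' C',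
      Double (z x) o a b l r l' r' c ∧ Double (z y) o a b L R L' R' C' ∧ r = p ∧ R ≤ p ∧
      ¬ ((l' < R' ∧ L' < r') ∨ c = C') := by
  constructor
  · rintro ⟨x, hx, y, hy, i, j, k, l, s, s', e, e', ux, uy, rfl, hle, hn⟩
    obtain ⟨l1, r1, l1', r1', c1, hd⟩ := (hz x).double hab ⟨i, j, s, e⟩ ux
    obtain ⟨l2, r2, l2', r2', c2, hd'⟩ := (hz y).double hab ⟨k, l, s', e'⟩ uy
    rw [hd.overlapNear_iff (hz x) (hz y) hab hd'] at hn
    refine ⟨x, hx, y, hy, _, _, _, _, _, _, _, _, _, _, hd, hd', ?_, ?_, hn⟩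
    · obtain ⟨i', j', t, f, -, rfl⟩ := hd.fst
      rw [((hz x).unique t s (f.trans e.symm)).2]
    · obtain ⟨i', j', t, f, -, rfl⟩ := hd'.fst
      rwa [((hz y).unique t s' (f.trans e'.symm)).2]
  · rintro ⟨x, hx, y, hy, l, r, l', r', c, L, R, L', R', C', hd, hd', rfl, hR, hn⟩
    rw [← hd.overlapNear_iff (hz x) (hz y) hab hd'] at hn
    obtain ⟨i, j, s, e, -, rfl⟩ := hd.fst
    obtain ⟨k, m, s', e', -, rfl⟩ := hd'.fst
    obtain ⟨i1, j1, t, f, -⟩ := hd.snd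
    obtain ⟨i2, j2, t', f', -⟩ := hd'.snd
    exact ⟨x, hx, y, hy, i, j, k, m, s, s', e, e', ⟨_, _, t, f⟩, ⟨_, _, t', f'⟩, rfl, hR, hn⟩

/-- Two intervals that overlap both of two disjoint intervals, or have a marked point in common
with one of them, overlap each other. -/
theorem interval_overlap_of_near {l r c L R C l₁ r₁ c₁ l₂ r₂ c₂ : ℤ}
    (hc : l ≤ c ∧ c ≤ r) (hC : L ≤ C ∧ C ≤ R) (hc₁ : l₁ ≤ c₁ ∧ c₁ ≤ r₁) (hc₂ : l₂ ≤ c₂ ∧ c₂ ≤ r₂)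
    (hd : r₁ ≤ l₂) (hn : ¬ ((c = c₁ ∨ C = c₁) ∧ (c = c₂ ∨ C = c₂)))
    (h₁ : (l < r₁ ∧ l₁ < r) ∨ c = c₁) (h₂ : (l < r₂ ∧ l₂ < r) ∨ c = c₂)
    (H₁ : (L < r₁ ∧ l₁ < R) ∨ C = c₁) (H₂ : (L < r₂ ∧ l₂ < R) ∨ C = c₂)
    (hno : ¬ ((l < R ∧ L < r) ∨ c = C)) : False := by
  -- An interval overlapping both disjoint intervals extends strictly beyond both ends of the gap
  -- between them, so two such intervals overlap. By `hn` at most one of the given intervals is met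
  -- through its mark, and by `hne` not by both of the others; the inequalities still suffice then.
  push Not at hno
  obtain ⟨hno, hne⟩ := hno
  rcases h₁ with h₁ | h₁
  · rcases h₂ with h₂ | h₂
    · rcases H₁ with H₁ | H₁
      · rcases H₂ with H₂ | H₂ <;> have := hno (by omega) <;> omega
      · have H₂ := H₂.resolve_right fun e => hn ⟨Or.inr H₁, Or.inr e⟩
        have := hno (by omega)
        omega
    · have H₁ := H₁.resolve_right fun e => hn ⟨Or.inr e, Or.inl h₂⟩
      have H₂ := H₂.resolve_right fun e => hne (h₂.trans e.symm)
      have := hno (by omega)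
      omega
  · have h₂ := h₂.resolve_right fun e => hn ⟨Or.inl h₁, Or.inl e⟩
    have H₁ := H₁.resolve_right fun e => hne (h₁.trans e.symm)
    have H₂ := H₂.resolve_right fun e => hn ⟨Or.inl h₁, Or.inr e⟩
    have := hno (by omega)
    omega

/-- Two elements of the clique that use the same parallel lines and do not contain the pivot of
the first line overlap near the second line. -/
theorem overlapNear_of_not_containsPivot [Finite V] {C K : Set V} (hz : ∀ v, Valid (z v))
    (hC : ∀ x ∈ C, ∀ y ∈ C, Share (z x) (z y)) {o : Bool} {a b : ℤ} (hab : a < b)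
    (ha : a ∈ coords z K) (hb : b ∈ coords z K) {x y : V} (hx : x ∈ C) (hy : y ∈ C)
    (xa : Uses (z x) o a) (xb : Uses (z x) o b) (ya : Uses (z y) o a) (yb : Uses (z y) o b)
    (nx : ¬ ContainsPivot z C K x) (ny : ¬ ContainsPivot z C K y) :
    OverlapNear (z x) (z y) o b := by
  have dich : ∀ w, Uses (z w) o a → Uses (z w) o b → ¬ ContainsPivot z C K w →
      ∀ p, IsLeast (pivotSet z C o a b) p → ∀ l r l' r' c, Double (z w) o a b l r l' r' c →
      r < p ∨ p ≤ l := by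
    intro w wa wb hn p hp l r l' r' c hd
    by_contra hc
    obtain ⟨i, j, s, e, rfl, rfl⟩ := hd.fst
    exact hn ⟨o, a, b, hab, ha, hb, wa, wb, p, hp, i, j, s, e, by omega, by omega⟩
  obtain ⟨l, r, l', r', c, dx⟩ := (hz x).double hab xa xb
  obtain ⟨L, R, L', R', c', dy⟩ := (hz y).double hab ya yb
  rw [dx.overlapNear_iff (hz x) (hz y) hab dy]
  by_cases hne : (pivotSet z C o a b).Nonempty
  swap
  · by_contra hn
    rcases le_total R r with h | h
    · exact hne ⟨r, (mem_pivotSet hz hab).2 ⟨x, hx, y, hy, _, _, _, _, _, _, _, _, _, _, dx, dy,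
        rfl, h, hn⟩⟩
    · exact hne ⟨R, (mem_pivotSet hz hab).2 ⟨y, hy, x, hx, _, _, _, _, _, _, _, _, _, _, dy, dx,
        rfl, h, by omega⟩⟩
  obtain ⟨p, hp⟩ := pivotSet_nonempty_least hne
  have hxp := dich x xa xb nx p hp _ _ _ _ _ dx
  have hyp := dich y ya yb ny p hp _ _ _ _ _ dy
  by_contra hn
  have sxy := dx.share (hz x) (hz y) dy (hC x hx y hy)
  -- If both ended before `p`, the larger of their right ends would be an element of the pivot set
  -- below its minimum.
  have hxy : r < p → R < p → False := by
    intro h1 h2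
    rcases le_total R r with h | h
    · exact absurd (hp.2 ((mem_pivotSet hz hab).2 ⟨x, hx, y, hy, _, _, _, _, _, _, _, _, _, _, dx,
        dy, rfl, h, hn⟩)) (not_le.2 h1)
    · exact absurd (hp.2 ((mem_pivotSet hz hab).2 ⟨y, hy, x, hx, _, _, _, _, _, _, _, _, _, _, dy,
        dx, rfl, h, by omega⟩)) (not_le.2 h2)
  obtain ⟨v, hv, w, hw, l1, r1, l1', r1', c1, l2, r2, l2', r2', c2, dv, dw, rfl, hle, hvw⟩ :=
    (mem_pivotSet hz hab).1 hp.1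
  have sxv := dx.share (hz x) (hz v) dv (hC x hx v hv)
  have sxw := dx.share (hz x) (hz w) dw (hC x hx w hw)
  have syv := dy.share (hz y) (hz v) dv (hC y hy v hv)
  have syw := dy.share (hz y) (hz w) dw (hC y hy w hw)
  replace sxy : l < R ∧ L < r := sxy.resolve_right hn
  -- On different sides of the pivot they would be disjoint on the first line. So both begin at the
  -- pivot or later, away from its witnesses `v` and `w`, which they must then meet near the second
  -- line.
  have hx' : r1 ≤ l ∧ r1 ≤ L := by
    rcases hxp with h1 | h1 <;> rcases hyp with h2 | h2
    · exact (hxy h1 h2).elim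
    · omega
    · omega
    · exact ⟨h1, h2⟩
  obtain ⟨hx', hy'⟩ := hx'
  replace sxv := sxv.resolve_left (by omega)
  replace sxw := sxw.resolve_left (by omega)
  replace syv := syv.resolve_left (by omega)
  replace syw := syw.resolve_left (by omega)
  have bounds : ∀ {l r c : ℤ}, l < r → (l = c ∨ r = c) → l ≤ c ∧ c ≤ r := by
    intro l r c h1 h2
    omega
  have b1 := bounds dx.fst_lt dx.fst_end
  have b2 := bounds dy.fst_lt dy.fst_end
  have b3 := bounds dv.fst_lt dv.fst_end
  have b4 := bounds dw.fst_lt dw.fst_end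
  -- The marks `c`, `c'` are at or after the pivot and `c1`, `c2` at or before it. Coincidences with
  -- both would put `c1` and `c2` at the pivot, but `v` and `w` have different marks.
  have hc : ¬ ((c = c1 ∨ c' = c1) ∧ (c = c2 ∨ c' = c2)) := by omega
  rcases (show r1' ≤ l2' ∨ r2' ≤ l1' by omega) with h | h
  · exact interval_overlap_of_near (bounds dx.snd_lt dx.snd_end)
      (bounds dy.snd_lt dy.snd_end) (bounds dv.snd_lt dv.snd_end) (bounds dw.snd_lt dw.snd_end)
      h hc sxv sxw syv syw hn
  · exact interval_overlap_of_near (bounds dx.snd_lt dx.snd_end)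
      (bounds dy.snd_lt dy.snd_end) (bounds dw.snd_lt dw.snd_end) (bounds dv.snd_lt dv.snd_end)
      h (fun h => hc ⟨h.2, h.1⟩) sxw sxv syw syv hn

/-- The order types over `K''` of the elements of `C` that contain the pivot, and of those that do
not, consist of paths that share an edge. -/
theorem share_of_containsPivot_iff [Finite V] {C K K' K'' : Set V} (hz : ∀ v, Valid (z v))
    (hC : ∀ x ∈ C, ∀ y ∈ C, Share (z x) (z y)) (hK : Pivotal z C K K') (hK' : Extremal z C K' K'')
    {x y u v : V} (hx : x ∈ C) (hy : y ∈ C) (hxy : ContainsPivot z C K x ↔ ContainsPivot z C K y)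
    (hu : SameType z K'' u x) (hv : SameType z K'' v y) {o : Bool} {a b : ℤ} (hab : a < b)
    (ha : a ∈ coords z K) (hb : b ∈ coords z K) 
    (xa : Uses (z x) o a) (xb : Uses (z x) o b) (ya : Uses (z y) o a) (yb : Uses (z y) o b) :
    Share (z u) (z v) := by
  by_cases h : ContainsPivot z C K x
  · have h' := hxy.1 h
    obtain ⟨o1, a1, b1, hab1, -, -, ua1, ub1, p, hp, i, j, s, e, h1, h2⟩ := h
    obtain ⟨rfl, rfl, rfl⟩ := (hz x).parallel_unique hab hab1 xa xb ua1 ub1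
    obtain ⟨o2, a2, b2, hab2, -, -, ua2, ub2, q, hq, k, l, s', e', h1', h2'⟩ := h'
    obtain ⟨rfl, rfl, rfl⟩ := (hz y).parallel_unique hab hab2 ya yb ua2 ub2
    obtain rfl := hp.unique hq
    -- The pivot is a coordinate of the family, so `u` and `v` also contain the edge to its left.
    have hp' := coords_mono hK'.subset (hK.pivot _ _ _ _ ha hb hp)
    have ha' := coords_mono hK'.subset (coords_mono hK.subset ha)
    refine ⟨o, a, i, j, k, l, hu.seg s, hv.seg s', hu.coord_eq ha' e, hv.coord_eq ha' e', ?_, ?_⟩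
    · exact ((hu.coord_lt_iff hp').2 h1).trans_le
        (not_lt.1 fun hc => absurd ((hv.coord_lt_iff hp').1 hc) (not_lt.2 h2'))
    · exact ((hv.coord_lt_iff hp').2 h1').trans_le
        (not_lt.1 fun hc => absurd ((hu.coord_lt_iff hp').1 hc) (not_lt.2 h2))
  · have ny := fun h' => h (hxy.2 h')
    obtain ⟨i, j, sx, ex⟩ := xb
    obtain ⟨k, l, sy, ey⟩ := yb
    refine hK'.share hz hx sx sy (coords_mono hK.subset hb) ex ey ?_ hu hv
    intro x' hx' hs
    have ha' := coords_mono hK.subset ha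
    have hb' := coords_mono hK.subset hb
    have uses' : ∀ e ∈ coords z K', (Uses (z x') o e ↔ Uses (z x) o e) := by
      intro e he
      constructor
      · rintro ⟨i, j, t, f⟩
        exact ⟨i, j, hs.symm.seg t, hs.symm.coord_eq he f⟩
      · rintro ⟨i, j, t, f⟩
        exact ⟨i, j, hs.seg t, hs.coord_eq he f⟩
    refine overlapNear_of_not_containsPivot hz hC hab ha hb (hK'.subset_clique hx') hy
      ((uses' a ha').2 xa) ((uses' b hb').2 ⟨i, j, sx, ex⟩) ya ⟨k, l, sy, ey⟩ ?_ ny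
    -- The lines and the pivot are at coordinates of `K'`, so with `x` no `x'` of its type over `K'`
    -- contains the pivot.
    rintro ⟨o1, a1, b1, hab1, ha1, hb1, ua1, ub1, p, hp, i, j, s, e, h1, h2⟩
    obtain ⟨rfl, rfl, rfl⟩ := (hz x').parallel_unique hab hab1 ((uses' a ha').2 xa)
      ((uses' b hb').2 ⟨_, _, sx, ex⟩) ua1 ub1
    have hp' := hK.pivot _ _ _ _ ha hb hp
    refine h ⟨o, a, b, hab, ha, hb, xa, ⟨_, _, sx, ex⟩, p, hp, i, j, hs.symm.seg s,
      hs.symm.coord_eq ha' e, (hs.coord_lt_iff hp').1 h1, ?_⟩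
    exact not_lt.1 fun hc => absurd ((hs.coord_lt_iff hp').2 hc) (not_lt.2 h2)

end Pivot

open Corners

/-! ### Covering a clique by two unions of order types over a bounded family -/

section Bounded

/-- The order types over families of `m` paths. -/
abbrev Pattern (m : ℕ) : Type :=
  (Fin 4 → Bool → Fin 4 → Bool → Ordering) × (Fin m → Fin 4 → Bool → Fin 4 → Bool → Ordering)

instance : Finite Ordering :=
  Finite.of_surjective (fun b : Option Bool => match b with
    | none => Ordering.eq
    | some true => Ordering.lt
    | some false => Ordering.gt) (by
      rintro (_ | _ | _)
      exacts [⟨some true, rfl⟩, ⟨none, rfl⟩, ⟨some false, rfl⟩])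

variable {V : Type*} (z : V → Corners)

/-- The order type of `v` over the family `f`. -/
def pattern {m : ℕ} (f : Fin m → V) (v : V) : Pattern m :=
  (fun i o j o' => cmp (z v i o) (z v j o'), fun k i o j o' => cmp (z v i o) (z (f k) j o'))

variable {z}

theorem pattern_eq_iff {m : ℕ} {f : Fin m → V} {u v : V} :
    pattern z f u = pattern z f v ↔ SameType z (Set.range f) u v := by
  simp only [pattern, Prod.mk.injEq, funext_iff, SameType, Set.forall_mem_range]

theorem exists_fin_range (ι : Type*) [Finite ι] (g : ι → V) :
    ∃ f : Fin (Nat.card ι) → V, Set.range f = Set.range g :=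
  ⟨g ∘ (Finite.equivFin ι).symm, (Finite.equivFin ι).symm.surjective.range_comp g⟩

/-- One new element for each order type, each of the eight coordinates and each of maximum and
minimum suffices; their number depends only on `m`. -/
theorem exists_extremal (m : ℕ) : ∃ m', ∀ {V : Type} [Finite V] (z : V → Corners) (C : Set V)
    (f : Fin m → V), C.Nonempty → Set.range f ⊆ C →
      ∃ f' : Fin m' → V, Extremal z C (Set.range f) (Set.range f') := by
  refine ⟨Nat.card (Fin m ⊕ (Pattern m × Fin 4 × Bool × Bool)), ?_⟩
  intro V _ z C f ⟨x₀, hx₀⟩ hf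
  have hmin : ∀ t : Pattern m × Fin 4 × Bool × Bool, ∃ x ∈ C, ∀ y ∈ C, pattern z f y = t.1 →
      pattern z f x = t.1 ∧
        (if t.2.2.2 then z x t.2.1 t.2.2.1 ≤ z y t.2.1 t.2.2.1
          else z y t.2.1 t.2.2.1 ≤ z x t.2.1 t.2.2.1) := by
    rintro ⟨τ, i, o, b⟩
    by_cases h : {x ∈ C | pattern z f x = τ}.Nonempty
    · cases b
      · obtain ⟨x, hx, hle⟩ := Set.exists_max_image _ (fun x => z x i o) (Set.toFinite _) h
        exact ⟨x, hx.1, fun y hy he => ⟨hx.2, by simpa using hle y ⟨hy, he⟩⟩⟩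
      · obtain ⟨x, hx, hle⟩ := Set.exists_min_image _ (fun x => z x i o) (Set.toFinite _) h
        exact ⟨x, hx.1, fun y hy he => ⟨hx.2, by simpa using hle y ⟨hy, he⟩⟩⟩
    · exact ⟨x₀, hx₀, fun y hy he => absurd ⟨y, hy, he⟩ h⟩
  choose g hg hg' using hmin
  obtain ⟨f', hf'⟩ := exists_fin_range _ (Sum.elim f g)
  refine ⟨f', ?_⟩
  rw [hf', Set.Sum.elim_range]
  refine ⟨Set.subset_union_left, Set.union_subset hf (Set.range_subset_iff.2 hg), ?_, ?_⟩
  · intro x hx i o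
    obtain ⟨h1, h2⟩ := hg' (pattern z f x, i, o, true) x hx rfl
    exact ⟨_, Or.inr ⟨_, rfl⟩, pattern_eq_iff.1 h1, by simpa using h2⟩
  · intro x hx i o
    obtain ⟨h1, h2⟩ := hg' (pattern z f x, i, o, false) x hx rfl
    exact ⟨_, Or.inr ⟨_, rfl⟩, pattern_eq_iff.1 h1, by simpa using h2⟩

/-- One new element for each direction and each pair of coordinates of the family suffices, since a
pivot is a coordinate of an element of `C`. -/
theorem exists_pivotal (m : ℕ) : ∃ m', ∀ {V : Type} [Finite V] (z : V → Corners) (C : Set V)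
    (f : Fin m → V), C.Nonempty → Set.range f ⊆ C →
      ∃ f' : Fin m' → V, Pivotal z C (Set.range f) (Set.range f') := by
  refine ⟨Nat.card (Fin m ⊕ (Bool × (Fin m × Fin 4 × Bool) × (Fin m × Fin 4 × Bool))), ?_⟩
  intro V _ z C f ⟨x₀, hx₀⟩ hf
  have hpiv : ∀ t : Bool × (Fin m × Fin 4 × Bool) × (Fin m × Fin 4 × Bool), ∃ x ∈ C, ∀ p,
      IsLeast (pivotSet z C t.1 (z (f t.2.1.1) t.2.1.2.1 t.2.1.2.2)
        (z (f t.2.2.1) t.2.2.2.1 t.2.2.2.2)) p → ∃ j, z x j t.1 = p := by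
    intro t
    by_cases h : ∃ p, IsLeast (pivotSet z C t.1 (z (f t.2.1.1) t.2.1.2.1 t.2.1.2.2)
        (z (f t.2.2.1) t.2.2.2.1 t.2.2.2.2)) p
    · obtain ⟨p, hp⟩ := h
      obtain ⟨x, hx, -, -, -, j, -, -, -, -, -, -, -, -, e, -⟩ := hp.1
      exact ⟨x, hx, fun q hq => ⟨j, e.trans (hp.unique hq)⟩⟩
    · exact ⟨x₀, hx₀, fun p hp => absurd ⟨p, hp⟩ h⟩
  choose g hg hg' using hpiv
  obtain ⟨f', hf'⟩ := exists_fin_range _ (Sum.elim f g)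
  refine ⟨f', ?_⟩
  rw [hf', Set.Sum.elim_range]
  refine ⟨Set.subset_union_left, Set.union_subset hf (Set.range_subset_iff.2 hg), ?_⟩
  rintro o a b p ⟨_, ⟨k, rfl⟩, j, o1, rfl⟩ ⟨_, ⟨k', rfl⟩, j', o2, rfl⟩ hp
  obtain ⟨i, e⟩ := hg' (o, (k, j, o1), (k', j', o2)) p hp
  exact ⟨_, Or.inr ⟨_, rfl⟩, i, o, e⟩

theorem exists_extremal_chain (T : ℕ) : ∃ m, ∀ {V : Type} [Finite V] (z : V → Corners)
    (C : Set V), C.Nonempty → ∃ K : ℕ → Set V, (∀ t < T, Extremal z C (K t) (K (t + 1))) ∧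
      ∃ f : Fin m → V, K T = Set.range f ∧ Set.range f ⊆ C := by
  induction T with
  | zero =>
    refine ⟨1, fun {V} _ z C ⟨x₀, hx₀⟩ => ⟨fun _ => {x₀}, by simp, fun _ => x₀, ?_, ?_⟩⟩
    · simp
    · simpa using hx₀
  | succ T ih =>
    obtain ⟨m, hm⟩ := ih
    obtain ⟨m', hm'⟩ := exists_extremal m
    refine ⟨m', fun {V} _ z C hC => ?_⟩
    obtain ⟨K, hK, f, hf, hfC⟩ := hm z C hC
    obtain ⟨f', hf'⟩ := hm' z C f hC hfC
    refine ⟨fun t => if t ≤ T then K t else Set.range f', ?_, f', by simp, hf'.subset_clique⟩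
    intro t ht
    rcases Nat.lt_succ_iff_lt_or_eq.1 ht with h | rfl
    · simpa [h.le, Nat.succ_le_iff.2 h] using hK t h
    · simpa [hf] using hf'

/-- Every unstable step captures at least one further coordinate of `y`, and there are eight
coordinates but nine steps. -/
theorem exists_stable {C : Set V} {K : ℕ → Set V}
    (hK : ∀ t < 9, Extremal z C (K t) (K (t + 1))) (y : V) :
    ∃ t < 9, ∀ i o, z y i o ∈ coords z (K (t + 1)) → z y i o ∈ coords z (K t) := by
  classical
  by_contra! hc
  let N : ℕ → Finset (Fin 4 × Bool) := fun t => {e | z y e.1 e.2 ∈ coords z (K t)}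
  have hN : ∀ t ≤ 9, t ≤ (N t).card := by
    intro t
    induction t with
    | zero => simp
    | succ t ih =>
      intro ht
      refine (Nat.succ_le_succ (ih (by omega))).trans (Finset.card_lt_card ?_)
      obtain ⟨i, o, h1, h2⟩ := hc t (by omega)
      refine Finset.ssubset_iff_subset_ne.2 ⟨fun e he => ?_, fun e => ?_⟩
      · simp only [N, Finset.mem_filter_univ] at he ⊢
        exact coords_mono (hK t (by omega)).subset he
      · have : (i, o) ∈ N (t + 1) := by simpa [N] using h1
        rw [← e] at this
        exact h2 (by simpa [N] using this)
  have h1 := hN 9 le_rfl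
  have h2 := Finset.card_le_univ (N 9)
  simp at h2
  omega

theorem Extremal.chain_mono {C : Set V} {K : ℕ → Set V} {T : ℕ}
    (hK : ∀ t < T, Extremal z C (K t) (K (t + 1))) {s t : ℕ} (hst : s ≤ t) (ht : t ≤ T) :
    K s ⊆ K t := by
  induction t, hst using Nat.le_induction with
  | base => exact subset_rfl
  | succ t h ih => exact (ih (by omega)).trans (hK t (by omega)).subset

/-- There is a family of bounded size such that every clique is covered by two cliques that are
unions of order types over the family. -/
theorem exists_pattern_cover : ∃ m, ∀ {V : Type} [Finite V] (z : V → Corners) (C : Set V),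
    C.Nonempty → (∀ v, Valid (z v)) → (∀ x ∈ C, ∀ y ∈ C, Share (z x) (z y)) →
      ∃ (f : Fin m → V) (S T : Set (Pattern m)),
        (∀ x ∈ C, pattern z f x ∈ S ∨ pattern z f x ∈ T) ∧
        (∀ u v, pattern z f u ∈ S → pattern z f v ∈ S → Share (z u) (z v)) ∧
        (∀ u v, pattern z f u ∈ T → pattern z f v ∈ T → Share (z u) (z v)) := by
  obtain ⟨m₁, h₁⟩ := exists_extremal_chain 9
  obtain ⟨m₂, h₂⟩ := exists_pivotal m₁
  obtain ⟨m₃, h₃⟩ := exists_extremal m₂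
  refine ⟨m₃, ?_⟩
  intro V _ z C hne hz hC
  obtain ⟨K, hK, f₁, hf₁, hfC⟩ := h₁ z C hne
  obtain ⟨f₂, hf₂⟩ := h₂ z C f₁ hne hfC
  obtain ⟨f₃, hf₃⟩ := h₃ z C f₂ hne hf₂.subset_clique
  have main : ∀ x ∈ C, ∀ y ∈ C, (ContainsPivot z C (K 9) x ↔ ContainsPivot z C (K 9) y) →
      ∀ u v, pattern z f₃ u = pattern z f₃ x → pattern z f₃ v = pattern z f₃ y →
      Share (z u) (z v) := by
    intro x hx y hy hxy u v hu hv
    rw [pattern_eq_iff] at hu hv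
    -- The stable step depends on `y`, but the final family refines all steps of the chain.
    obtain ⟨t, ht, hs⟩ := exists_stable hK y
    have hsub : K (t + 1) ⊆ Set.range f₃ :=
      ((Extremal.chain_mono hK ht le_rfl).trans (hf₁ ▸ hf₂.subset)).trans hf₃.subset
    rcases (hK t ht).share_or_parallel hz hC hx hy hs (hu.mono hsub) (hv.mono hsub) with
      h | ⟨o, a, b, hab, ha, hb, xa, xb, ya, yb⟩
    · exact h
    · have h9 := coords_mono (z := z) (Extremal.chain_mono hK ht.le le_rfl)
      exact share_of_containsPivot_iff hz hC (hf₁ ▸ hf₂) hf₃ hx hy hxy hu hv hab (h9 ha) (h9 hb)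
        xa xb ya yb
  -- Containing the pivot is the only distinction needed, which is why two sets suffice.
  refine ⟨f₃, pattern z f₃ '' {x ∈ C | ContainsPivot z C (K 9) x},
    pattern z f₃ '' {x ∈ C | ¬ ContainsPivot z C (K 9) x}, ?_, ?_, ?_⟩
  · intro x hx
    by_cases h : ContainsPivot z C (K 9) x
    · exact Or.inl ⟨x, ⟨hx, h⟩, rfl⟩
    · exact Or.inr ⟨x, ⟨hx, h⟩, rfl⟩
  · rintro u v ⟨x, ⟨hx, h⟩, e⟩ ⟨y, ⟨hy, h'⟩, e'⟩
    exact main x hx y hy (iff_of_true h h') u v e.symm e'.symm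
  · rintro u v ⟨x, ⟨hx, h⟩, e⟩ ⟨y, ⟨hy, h'⟩, e'⟩
    exact main x hx y hy (iff_of_false h h') u v e.symm e'.symm

end Bounded

open Corners

/-! ### Paths of the grid as polygons -/

section Grid

/-- The coordinate of a grid point along a direction: its column or its row. -/
def gridCoord (p : ℤ × ℤ) (o : Bool) : ℤ := if o then p.2 else p.1

/-- The grid point with the given coordinates along and across a direction. -/
def gridPoint (o : Bool) (x a : ℤ) : ℤ × ℤ := if o then (a, x) else (x, a)

/-- The grid edge along `o` from `x` to `x + 1`, on the line at `a`. -/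
def gridEdge (o : Bool) (x a : ℤ) : Sym2 (ℤ × ℤ) := s(gridPoint o x a, gridPoint o (x + 1) a)

theorem gridEdge_injective {o o' : Bool} {x a x' a' : ℤ} (h : gridEdge o x a = gridEdge o' x' a') :
    o = o' ∧ x = x' ∧ a = a' := by
  cases o <;> cases o' <;> simp [gridEdge, gridPoint, Prod.ext_iff] at h ⊢ <;> omega

theorem gridGraph_adj_iff {p q : ℤ × ℤ} : gridGraph.Adj p q ↔
    ∃ o, gridCoord p (!o) = gridCoord q (!o) ∧
      (gridCoord q o = gridCoord p o + 1 ∨ gridCoord q o + 1 = gridCoord p o) := by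
  simp only [gridGraph, Bool.exists_bool, gridCoord]
  simp
  have e1 : |p.2 - q.2| = 1 ↔ (q.2 = p.2 + 1 ∨ q.2 + 1 = p.2) := by
    rw [abs_eq (by norm_num)]; omega
  have e2 : |p.1 - q.1| = 1 ↔ (q.1 = p.1 + 1 ∨ q.1 + 1 = p.1) := by
    rw [abs_eq (by norm_num)]; omega
  rw [e1, e2]
  tauto

theorem eq_gridPoint (o : Bool) (p : ℤ × ℤ) :
    p = gridPoint o (gridCoord p o) (gridCoord p (!o)) := by
  cases o <;> simp [gridPoint, gridCoord]

theorem gridCoord_ext {p q : ℤ × ℤ} (o : Bool) (h : gridCoord p o = gridCoord q o)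
    (h' : gridCoord p (!o) = gridCoord q (!o)) : p = q := by
  rw [eq_gridPoint o p, eq_gridPoint o q, h, h']

/-- The edge is on the axis-parallel segment from `p` to `q`. -/
def OnSegment (p q : ℤ × ℤ) (e : Sym2 (ℤ × ℤ)) : Prop :=
  ∃ o x, gridCoord p (!o) = gridCoord q (!o) ∧
    ((gridCoord p o ≤ x ∧ x < gridCoord q o) ∨ (gridCoord q o ≤ x ∧ x < gridCoord p o)) ∧
    e = gridEdge o x (gridCoord p (!o))

/-- The polygon with the corners `p`, those in the list, and `t` has nondegenerate segments that are
alternately along and across `o`. -/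
def Alternating : Bool → ℤ × ℤ → List (ℤ × ℤ) → ℤ × ℤ → Prop
  | o, p, [], t => p ≠ t ∧ gridCoord p (!o) = gridCoord t (!o)
  | o, p, b :: B, t => p ≠ b ∧ gridCoord p (!o) = gridCoord b (!o) ∧ Alternating (!o) b B t

/-- The edge is on the polygon with the corners `p`, those in the list, and `t`. -/
def OnPolygon (e : Sym2 (ℤ × ℤ)) : ℤ × ℤ → List (ℤ × ℤ) → ℤ × ℤ → Prop
  | p, [], t => OnSegment p t e
  | p, b :: B, t => OnSegment p b e ∨ OnPolygon e b B t

/-- The unit step from `p` to `q` is along `o` and in the direction of `c`. -/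
def StepTowards (o : Bool) (p q c : ℤ × ℤ) : Prop :=
  gridCoord p (!o) = gridCoord q (!o) ∧ gridCoord p (!o) = gridCoord c (!o) ∧
    ((gridCoord q o = gridCoord p o + 1 ∧ gridCoord p o < gridCoord c o) ∨
      (gridCoord q o + 1 = gridCoord p o ∧ gridCoord c o < gridCoord p o))

theorem onSegment_of_adj {p q : ℤ × ℤ} {o : Bool} (h : gridCoord p (!o) = gridCoord q (!o))
    (h' : gridCoord q o = gridCoord p o + 1 ∨ gridCoord q o + 1 = gridCoord p o)
    (e : Sym2 (ℤ × ℤ)) : OnSegment p q e ↔ e = s(p, q) := by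
  have key : s(p, q) = gridEdge o (min (gridCoord p o) (gridCoord q o)) (gridCoord p (!o)) := by
    rcases h' with h' | h'
    · rw [min_eq_left (by omega), gridEdge, ← h', ← eq_gridPoint, h, ← eq_gridPoint]
    · rw [min_eq_right (by omega), gridEdge, h', ← eq_gridPoint, h, ← eq_gridPoint, Sym2.eq_swap]
  rw [key]
  constructor
  · rintro ⟨o', x, h1, h2, rfl⟩
    by_cases ho : o' = o
    · subst ho
      congr 1
      omega
    · have : o' = !o := by cases o <;> cases o' <;> simp_all
      subst this
      omega
  · rintro rfl
    exact ⟨o, _, h, by omega, rfl⟩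

theorem onSegment_extend {p q c : ℤ × ℤ} {o : Bool} (h : gridCoord p (!o) = gridCoord q (!o))
    (hc : gridCoord q (!o) = gridCoord c (!o))
    (h' : (gridCoord q o = gridCoord p o + 1 ∧ gridCoord q o < gridCoord c o) ∨
      (gridCoord q o + 1 = gridCoord p o ∧ gridCoord c o < gridCoord q o))
    (e : Sym2 (ℤ × ℤ)) : OnSegment p c e ↔ e = s(p, q) ∨ OnSegment q c e := by
  rw [← onSegment_of_adj h (by omega)]
  constructor
  · rintro ⟨o', x, h1, h2, rfl⟩
    by_cases ho : o' = o
    · subst ho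
      by_cases hx : (gridCoord p o' ≤ x ∧ x < gridCoord q o') ∨
          (gridCoord q o' ≤ x ∧ x < gridCoord p o')
      · exact Or.inl ⟨o', x, h, hx, rfl⟩
      · exact Or.inr ⟨o', x, hc, by omega, by rw [h]⟩
    · have : o' = !o := by cases o <;> cases o' <;> simp_all
      subst this
      rw [Bool.not_not] at h1
      omega
  · rintro (⟨o', x, h1, h2, rfl⟩ | ⟨o', x, h1, h2, rfl⟩)
    all_goals
      by_cases ho : o' = o
      · subst ho
        exact ⟨o', x, h.trans hc, by omega, by rw [h]⟩
      · have : o' = !o := by cases o <;> cases o' <;> simp_all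
        subst this
        omega

/-- Edges are prepended one by one. `StepTowards` remembers the direction of the first step: as a
path does not turn back, a new step along the same line lengthens the first segment, and a step
across creates a bend. -/
theorem walk_polygon {p t : ℤ × ℤ} (w : gridGraph.Walk p t) (hw : w.IsPath) :
    ∀ q l, w.support = p :: q :: l → ∃ o, Alternating o p (bendPoints w.support) t ∧
      StepTowards o p q ((bendPoints w.support).headD t) ∧
      ∀ e, e ∈ w.edges ↔ OnPolygon e p (bendPoints w.support) t := by
  induction w with
  | nil => simp
  | @cons p q t h w ih =>
    intro q' l hl
    obtain ⟨o, ho, ho'⟩ := gridGraph_adj_iff.1 h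
    rw [SimpleGraph.Walk.cons_isPath_iff] at hw
    cases w with
    | nil =>
      simp at hl
      obtain ⟨rfl, -⟩ := hl
      refine ⟨o, ?_⟩
      simp only [SimpleGraph.Walk.support_cons, SimpleGraph.Walk.support_nil, bendPoints,
        Alternating, List.headD_nil, SimpleGraph.Walk.edges_cons, SimpleGraph.Walk.edges_nil,
        List.mem_singleton, OnPolygon]
      exact ⟨⟨h.ne, ho⟩, ⟨ho, ho, by omega⟩, fun e => (onSegment_of_adj ho ho' e).symm⟩
    | @cons _ r _ h' w =>
      have hr : ∃ l', w.support = r :: l' := ⟨_, w.cons_tail_support.symm⟩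
      obtain ⟨l', hl'⟩ := hr
      have hs : (SimpleGraph.Walk.cons h' w).support = q :: r :: l' := by simp [hl']
      obtain ⟨o', hA, hS, hE⟩ := ih hw.1 r l' hs
      have hpr : p ≠ r := by
        rintro rfl
        exact hw.2 (by rw [hs]; simp)
      rw [SimpleGraph.Walk.support_cons, hs] at hl
      simp only [List.cons.injEq, true_and] at hl
      obtain ⟨rfl, rfl⟩ := hl
      rw [hs] at hA hS hE
      have hE' : ∀ e, e ∈ (SimpleGraph.Walk.cons h (SimpleGraph.Walk.cons h' w)).edges ↔
          e = s(p, q) ∨ OnPolygon e q (bendPoints (q :: r :: l')) t := by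
        intro e
        rw [SimpleGraph.Walk.edges_cons, List.mem_cons, hE]
      rw [SimpleGraph.Walk.support_cons, hs, bendPoints]
      obtain ⟨hS1, hS2, hS3⟩ := hS
      -- The test in `bendPoints` compares the directions of two consecutive steps.
      have hcol : ((p.1 = q.1 ∧ q.1 = r.1) ∨ (p.2 = q.2 ∧ q.2 = r.2)) ↔ o' = o := by
        cases o <;> cases o' <;> simp [gridCoord] at ho ho' hS1 hS3 ⊢ <;> omega
      by_cases hoo : o' = o
      · subst hoo
        rw [if_pos (hcol.2 rfl)]
        have hne : gridCoord p o' ≠ gridCoord r o' := fun e =>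
          hpr (gridCoord_ext o' e (ho.trans hS1))
        refine ⟨o', ?_, ⟨ho, ho.trans hS2, by omega⟩, fun e => ?_⟩
        · cases hB : bendPoints (q :: r :: l') with
          | nil =>
            rw [hB] at hA hS3
            refine ⟨?_, ho.trans hA.2⟩
            rintro rfl
            simp at hS3
            omega
          | cons b B =>
            rw [hB] at hA hS3
            refine ⟨?_, ho.trans hA.2.1, hA.2.2⟩
            rintro rfl
            simp at hS3
            omega
        · rw [hE']
          cases hB : bendPoints (q :: r :: l') with
          | nil =>
            rw [hB] at hS2 hS3
            simp only [List.headD_nil] at hS2 hS3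
            simp only [OnPolygon]
            rw [onSegment_extend ho hS2 (by omega)]
          | cons b B =>
            rw [hB] at hS2 hS3
            simp only [List.headD_cons] at hS2 hS3
            simp only [OnPolygon]
            rw [onSegment_extend ho hS2 (by omega), or_assoc]
      · rw [if_neg (fun hc => hoo (hcol.1 hc))]
        have : o' = !o := by cases o <;> cases o' <;> simp_all
        subst this
        refine ⟨o, ⟨h.ne, ho, hA⟩, ⟨ho, ho, ?_⟩, fun e => ?_⟩
        · simp only [List.headD_cons]
          omega
        · rw [hE', OnPolygon, onSegment_of_adj ho ho']

end Grid

/-! ### From representations to corners -/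

section Representation

variable {V : Type*} {G : SimpleGraph V} (R : EPGRep 2 G)

/-- The four corners of the path of a vertex. -/
def EPGRep.corners (v : V) : Corners := fun j o => gridCoord (R.corner v j) o

theorem onSegment_iff_gridEdge {p q : ℤ × ℤ} {o : Bool} {x a : ℤ} :
    OnSegment p q (gridEdge o x a) ↔ gridCoord p (!o) = gridCoord q (!o) ∧
      gridCoord p (!o) = a ∧
      ((gridCoord p o ≤ x ∧ x < gridCoord q o) ∨ (gridCoord q o ≤ x ∧ x < gridCoord p o)) := by
  constructor
  · rintro ⟨o', x', h1, h2, h3⟩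
    obtain ⟨rfl, rfl, rfl⟩ := gridEdge_injective h3
    exact ⟨h1, rfl, h2⟩
  · rintro ⟨h1, rfl, h2⟩
    exact ⟨o, x, h1, h2, rfl⟩

/-- `Seg` orders the ends of a segment by coordinate, whereas the polygon lists its three segments
in their order along the path. -/
theorem exists_seg_iff (p : Corners) (o : Bool) (x a : ℤ) :
    (∃ i j, Seg p o i j ∧ p i (!o) = a ∧ p i o ≤ x ∧ x < p j o) ↔
      ∃ i : Fin 3, p i.castSucc (!o) = p i.succ (!o) ∧ p i.castSucc (!o) = a ∧
        ((p i.castSucc o ≤ x ∧ x < p i.succ o) ∨ (p i.succ o ≤ x ∧ x < p i.castSucc o)) := by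
  constructor
  · rintro ⟨i, j, ⟨hij, h1, h2⟩, h3, h4, h5⟩
    rcases hij with h | h
    · refine ⟨⟨i, by omega⟩, ?_⟩
      have e1 : (⟨i, by omega⟩ : Fin 3).castSucc = i := rfl
      have e2 : (⟨i, by omega⟩ : Fin 3).succ = j := Fin.ext (by simpa using h)
      rw [e1, e2]
      exact ⟨h1, h3, Or.inl ⟨h4, h5⟩⟩
    · refine ⟨⟨j, by omega⟩, ?_⟩
      have e1 : (⟨j, by omega⟩ : Fin 3).castSucc = j := rfl
      have e2 : (⟨j, by omega⟩ : Fin 3).succ = i := Fin.ext (by simpa using h)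
      rw [e1, e2]
      exact ⟨h1.symm, h1.symm.trans h3, Or.inr ⟨h4, h5⟩⟩
  · rintro ⟨i, h1, h2, h | h⟩
    · exact ⟨i.castSucc, i.succ, ⟨Or.inl (by simp), h1, by omega⟩, h2, h⟩
    · exact ⟨i.succ, i.castSucc, ⟨Or.inr (by simp), h1.symm, by omega⟩, h1.symm.trans h2, h⟩

/-- Overlapping intervals with integer ends have a unit interval in common, for example the one that
begins at the larger left end. -/
theorem share_iff_exists_edge {p q : Corners} : Share p q ↔ ∃ o x a,
    (∃ i j, Seg p o i j ∧ p i (!o) = a ∧ p i o ≤ x ∧ x < p j o) ∧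
    (∃ i j, Seg q o i j ∧ q i (!o) = a ∧ q i o ≤ x ∧ x < q j o) := by
  constructor
  · rintro ⟨o, a, i, j, k, l, s1, s2, e1, e2, h1, h2⟩
    have := s1.2.2
    have := s2.2.2
    exact ⟨o, max (p i o) (q k o), a, ⟨i, j, s1, e1, by omega, by omega⟩,
      ⟨k, l, s2, e2, by omega, by omega⟩⟩
  · rintro ⟨o, x, a, ⟨i, j, s1, e1, h1, h2⟩, ⟨k, l, s2, e2, h3, h4⟩⟩
    exact ⟨o, a, i, j, k, l, s1, s2, e1, e2, by omega, by omega⟩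

/-- The corners of a polygon with at most two bends, padded with the last one. -/
def polygonCorners (p : ℤ × ℤ) (B : List (ℤ × ℤ)) (t : ℤ × ℤ) : Corners :=
  fun j o => gridCoord ((p :: B).getD j t) o

/-- Padding with the target makes the missing segments degenerate. With two bends the middle segment
is nondegenerate, so the last clause of `Shape` is vacuous. -/
theorem polygonCorners_valid {o : Bool} {p t : ℤ × ℤ} {B : List (ℤ × ℤ)} (hB : B.length ≤ 2)
    (h : Alternating o p B t) : (polygonCorners p B t).Valid := by
  refine ⟨o, ?_⟩
  rcases B with _ | ⟨b, _ | ⟨c, _ | ⟨d, B⟩⟩⟩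
  · exact ⟨h.2, rfl, rfl, fun _ => rfl⟩
  · obtain ⟨h1, h2, h3, h4⟩ := h
    rw [Bool.not_not] at h4
    exact ⟨h2, h4, rfl, fun _ => rfl⟩
  · obtain ⟨h1, h2, h3, h4, h5, h6⟩ := h
    rw [Bool.not_not] at h4 h6
    exact ⟨h2, h4, h6, fun h => absurd (gridCoord_ext o h4 h) h3⟩
  · simp at hB

theorem onPolygon_iff {p t : ℤ × ℤ} {B : List (ℤ × ℤ)} (hB : B.length ≤ 2) (o : Bool) (x a : ℤ) :
    OnPolygon (gridEdge o x a) p B t ↔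
      ∃ i j, (polygonCorners p B t).Seg o i j ∧ polygonCorners p B t i (!o) = a ∧
        polygonCorners p B t i o ≤ x ∧ x < polygonCorners p B t j o := by
  rw [exists_seg_iff]
  simp only [Fin.exists_fin_succ, polygonCorners]
  rcases B with _ | ⟨b, _ | ⟨c, _ | ⟨d, B⟩⟩⟩
  · simp [OnPolygon, onSegment_iff_gridEdge]
  · simp [OnPolygon, onSegment_iff_gridEdge]
    omega
  · simp [OnPolygon, onSegment_iff_gridEdge]
  · simp at hB

theorem EPGRep.corners_spec (v : V) : (R.corners v).Valid ∧
    (∀ e ∈ (R.path v).1.edges, ∃ o x a, e = gridEdge o x a) ∧ ∀ o x a,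
    (gridEdge o x a ∈ (R.path v).1.edges ↔
      ∃ i j, (R.corners v).Seg o i j ∧ R.corners v i (!o) = a ∧ R.corners v i o ≤ x ∧
        x < R.corners v j o) := by
  have edge : ∀ {p t : ℤ × ℤ} (w : gridGraph.Walk p t), ∀ e ∈ w.edges, ∃ o x a,
      e = gridEdge o x a := by
    intro p t w e he
    induction e with
    | _ p q =>
      obtain ⟨o, h, h'⟩ := gridGraph_adj_iff.1 (w.adj_of_mem_edges he)
      obtain ⟨o', x, -, -, h⟩ := (onSegment_of_adj h h' s(p, q)).2 rfl
      exact ⟨o', x, _, h⟩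
  have hb := R.bends_le v
  rw [and_left_comm]
  refine ⟨edge _, ?_⟩
  rw [show R.corners v = polygonCorners (R.source v) (bendPoints (R.path v).1.support) (R.target v)
    from rfl]
  simp only [← onPolygon_iff hb]
  generalize R.path v = w at *
  obtain ⟨w, hw⟩ := w
  generalize R.source v = s at *
  generalize R.target v = t at *
  dsimp only at hb ⊢
  cases w with
  | nil =>
    refine ⟨⟨true, rfl, rfl, rfl, fun _ => rfl⟩, fun o x a => ?_⟩
    simp [bendPoints, OnPolygon, onSegment_iff_gridEdge]
  | @cons _ q _ h w =>
    obtain ⟨o, hA, -, hE⟩ := walk_polygon _ hw q w.support.tail (by simp)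
    exact ⟨polygonCorners_valid hb hA, fun o x a => hE _⟩

theorem EPGRep.adj_iff_share {u v : V} :
    G.Adj u v ↔ u ≠ v ∧ Share (R.corners u) (R.corners v) := by
  rw [R.adj_iff, share_iff_exists_edge]
  refine and_congr_right fun _ => ?_
  have hu := R.corners_spec u
  have hv := R.corners_spec v
  constructor
  · rintro ⟨e, h1, h2⟩
    obtain ⟨o, x, a, rfl⟩ := hu.2.1 e h1
    exact ⟨o, x, a, (hu.2.2 o x a).1 h1, (hv.2.2 o x a).1 h2⟩
  · rintro ⟨o, x, a, h1, h2⟩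
    exact ⟨gridEdge o x a, (hu.2.2 o x a).2 h1, (hv.2.2 o x a).2 h2⟩

end Representation

/-! ### Polynomial-time computations on random access machines -/

namespace RAM

/-- The contents of the arrays. -/
abbrev Mem := ℕ → ℤ → ℤ

/-- The values that a program can access in registers, as functions of some environment: a size,
in which its running time is measured, and further variables. -/
structure Ctx (Γ : Type) where
  size : Γ → ℕ
  vars : List (Γ → ℤ)

/-- The context with one further variable, a natural number. -/
def Ctx.ext {Γ : Type} (c : Ctx Γ) : Ctx (Γ × ℕ) where
  size γ := c.size γ.1
  vars := (fun γ => (γ.2 : ℤ)) :: c.vars.map fun v γ => v γ.1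

variable {Γ : Type} {c : Ctx Γ}

/-- Register 0 holds the size, and the registers `ν i` hold the variables. -/
def Ctx.Holds (c : Ctx Γ) (ν : ℕ → ℕ) (γ : Γ) (s : State) : Prop :=
  s.reg 0 = c.size γ ∧ ∀ i v, c.vars[i]? = some v → s.reg (ν i) = v γ

theorem Ctx.Holds.of_eq {ν : ℕ → ℕ} {e : ℕ} (he : 0 < e) (hν : ∀ i < c.vars.length, ν i < e)
    {γ : Γ} {s s' : State} (h : c.Holds ν γ s) (hs : ∀ r < e, s'.reg r = s.reg r) :
    c.Holds ν γ s' := by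
  refine ⟨(hs 0 he).trans h.1, fun i v hv => (hs _ (hν i ?_)).trans (h.2 i v hv)⟩
  exact (List.getElem?_eq_some_iff.1 hv).1

/-- The assignment of registers to variables with register `e` for the new variable. -/
def extReg (ν : ℕ → ℕ) (e : ℕ) : ℕ → ℕ
  | 0 => e
  | i + 1 => ν i

theorem Ctx.Holds.ext {ν : ℕ → ℕ} {e : ℕ} {γ : Γ} {s : State} (h : c.Holds ν γ s) {i : ℕ}
    (hi : s.reg e = i) : c.ext.Holds (extReg ν e) (γ, i) s := by
  refine ⟨h.1, ?_⟩
  rintro (_ | j) v hv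
  · simp only [Ctx.ext, List.getElem?_cons_zero, Option.some.injEq] at hv
    subst hv
    exact hi
  · simp only [Ctx.ext, List.getElem?_cons_succ, List.getElem?_map, Option.map_eq_some_iff] at hv
    obtain ⟨w, hw, rfl⟩ := hv
    exact h.2 j w hw

theorem extReg_lt {ν : ℕ → ℕ} {e e' : ℕ} (hν : ∀ i < c.vars.length, ν i < e) (he : e < e') :
    ∀ i < c.ext.vars.length, extReg ν e i < e' := by
  rintro (_ | i) hi
  · exact he
  · exact (hν i (by simpa [Ctx.ext] using hi)).trans he

/-- The value `τ` is computable in polynomial time: wherever the variables are, and for every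
sufficiently large `e`, some program puts it into register `e` without changing lower registers and
the arrays. -/
def Computes (c : Ctx Γ) (τ : Γ → Mem → ℤ) : Prop :=
  ∀ ν e, 0 < e → (∀ i < c.vars.length, ν i < e) → ∃ (P : Prog) (q : Polynomial ℕ),
    ∀ γ s, c.Holds ν γ s → ∃ t s', Exec P s t s' ∧ t ≤ q.eval (c.size γ) ∧
      (∀ r < e, s'.reg r = s.reg r) ∧ s'.arr = s.arr ∧ s'.reg e = τ γ s.arr

/-- The transformation `F` of the arrays is computable in polynomial time. -/
def Transforms (c : Ctx Γ) (F : Γ → Mem → Mem) : Prop :=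
  ∀ ν e, 0 < e → (∀ i < c.vars.length, ν i < e) → ∃ (P : Prog) (q : Polynomial ℕ),
    ∀ γ s, c.Holds ν γ s → ∃ t s', Exec P s t s' ∧ t ≤ q.eval (c.size γ) ∧
      (∀ r < e, s'.reg r = s.reg r) ∧ s'.arr = F γ s.arr

open Classical in
/-- The predicate `φ` is decidable in polynomial time. -/
def Decides (c : Ctx Γ) (φ : Γ → Mem → Prop) : Prop :=
  Computes c fun γ A => if φ γ A then 1 else 0

theorem Computes.const (z : ℤ) : Computes c fun _ _ => z := by
  intro ν e he hν
  refine ⟨.instr (.const e z), 1, fun γ s h => ⟨_, _, .instr _ _, by simp, ?_, rfl, ?_⟩⟩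
  · intro r hr
    simp [Instr.apply, hr.ne]
  · simp [Instr.apply]

theorem Computes.size : Computes c fun γ _ => (c.size γ : ℤ) := by
  intro ν e he hν
  refine ⟨.instr (.copy e 0), 1, fun γ s h => ⟨_, _, .instr _ _, by simp, ?_, rfl, ?_⟩⟩
  · intro r hr
    simp [Instr.apply, hr.ne]
  · simp [Instr.apply, h.1]

theorem Computes.var {v : Γ → ℤ} (hv : v ∈ c.vars) : Computes c fun γ _ => v γ := by
  intro ν e he hν
  obtain ⟨i, hi⟩ := List.mem_iff_getElem?.1 hv
  refine ⟨.instr (.copy e (ν i)), 1, fun γ s h => ⟨_, _, .instr _ _, by simp, ?_, rfl, ?_⟩⟩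
  · intro r hr
    simp [Instr.apply, hr.ne]
  · simp [Instr.apply, h.2 i v hi]

/-- Two values computed into consecutive registers, followed by a bounded computation. -/
theorem Computes.then₂ {τ σ : Γ → Mem → ℤ} (hτ : Computes c τ) (hσ : Computes c σ) {ν : ℕ → ℕ}
    {e : ℕ} (he : 0 < e) (hν : ∀ i < c.vars.length, ν i < e) {Q : Prog} {k : ℕ}
    {post : Γ → State → State → Prop}
    (hQ : ∀ γ s s₀, (∀ r < e, s.reg r = s₀.reg r) → s.arr = s₀.arr → s.reg e = τ γ s₀.arr →
      s.reg (e + 1) = σ γ s₀.arr → ∃ t s', Exec Q s t s' ∧ t ≤ k ∧ post γ s₀ s') :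
    ∃ (P : Prog) (q : Polynomial ℕ), ∀ γ s, c.Holds ν γ s →
      ∃ t s', Exec P s t s' ∧ t ≤ q.eval (c.size γ) ∧ post γ s s' := by
  obtain ⟨P, p, hP⟩ := hτ ν e he hν
  obtain ⟨P', p', hP'⟩ := hσ ν (e + 1) (by omega) (fun i hi => (hν i hi).trans (by omega))
  refine ⟨.seq P (.seq P' Q), p + (p' + Polynomial.C k), fun γ s h => ?_⟩
  obtain ⟨t₁, s₁, x₁, l₁, r₁, a₁, v₁⟩ := hP γ s h
  obtain ⟨t₂, s₂, x₂, l₂, r₂, a₂, v₂⟩ := hP' γ s₁ (h.of_eq he hν r₁)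
  obtain ⟨t₃, s₃, x₃, l₃, h₃⟩ := hQ γ s₂ s
    (fun r hr => (r₂ r (by omega)).trans (r₁ r hr)) (a₂.trans a₁)
    ((r₂ e (by omega)).trans v₁) (by rw [v₂, a₁])
  refine ⟨_, s₃, x₁.seq (x₂.seq x₃), ?_, h₃⟩
  simp only [Polynomial.eval_add, Polynomial.eval_C]
  omega

theorem Computes.add {τ σ : Γ → Mem → ℤ} (hτ : Computes c τ) (hσ : Computes c σ) :
    Computes c fun γ A => τ γ A + σ γ A := by
  intro ν e he hν
  refine hτ.then₂ hσ he hν (Q := .instr (.add e e (e + 1))) (k := 1) ?_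
  intro γ s s₀ hr ha h1 h2
  refine ⟨_, _, .instr _ _, le_rfl, ?_, ha, ?_⟩
  · intro r hr'
    simp [Instr.apply, hr'.ne, hr r hr']
  · simp [Instr.apply, h1, h2]

theorem Computes.load (a : ℕ) {τ : Γ → Mem → ℤ} (hτ : Computes c τ) :
    Computes c fun γ A => A a (τ γ A) := by
  intro ν e he hν
  refine hτ.then₂ (.const 0) he hν (Q := .instr (.load e a e)) (k := 1) ?_
  intro γ s s₀ hr ha h1 h2
  refine ⟨_, _, .instr _ _, le_rfl, ?_, ha, ?_⟩
  · intro r hr'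
    simp [Instr.apply, hr'.ne, hr r hr']
  · simp [Instr.apply, h1, ha]

theorem Decides.lt {τ σ : Γ → Mem → ℤ} (hτ : Computes c τ) (hσ : Computes c σ) :
    Decides c fun γ A => τ γ A < σ γ A := by
  intro ν e he hν
  refine hτ.then₂ hσ he hν
    (Q := .branch e (e + 1) (.instr (.const e 1)) (.instr (.const e 0))) (k := 2) ?_
  intro γ s s₀ hr ha h1 h2
  by_cases h : τ γ s₀.arr < σ γ s₀.arr
  · refine ⟨_, _, .branch_true (by rw [h1, h2]; exact h) (.instr _ _), le_rfl, ?_, ha, ?_⟩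
    · intro r hr'
      simp [Instr.apply, hr'.ne, hr r hr']
    · simp [Instr.apply, h]
  · refine ⟨_, _, .branch_false (by rw [h1, h2]; exact h) (.instr _ _), le_rfl, ?_, ha, ?_⟩
    · intro r hr'
      simp [Instr.apply, hr'.ne, hr r hr']
    · simp [Instr.apply, h]

open Classical in
theorem Computes.ite {φ : Γ → Mem → Prop} {τ σ : Γ → Mem → ℤ} (hφ : Decides c φ)
    (hτ : Computes c τ) (hσ : Computes c σ) :
    Computes c fun γ A => if φ γ A then τ γ A else σ γ A := by
  intro ν e he hν
  obtain ⟨P, p, hP⟩ := hφ ν e he hν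
  obtain ⟨P₁, p₁, hP₁⟩ := hτ ν e he hν
  obtain ⟨P₂, p₂, hP₂⟩ := hσ ν e he hν
  -- Tests compare registers, so the truth value in `e` is compared with a zero in `e + 1`.
  refine ⟨.seq P (.seq (.instr (.const (e + 1) 0)) (.branch (e + 1) e P₁ P₂)), p + (p₁ + p₂ + 2),
    fun γ s h => ?_⟩
  obtain ⟨t₀, s₀, x₀, l₀, r₀, a₀, v₀⟩ := hP γ s h
  have hr : ∀ r < e, (Instr.apply (.const (e + 1) 0) s₀).reg r = s.reg r := by
    intro r hr
    rw [← r₀ r hr]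
    simp [Instr.apply, (show r ≠ e + 1 by omega)]
  have ha : (Instr.apply (.const (e + 1) 0) s₀).arr = s.arr := a₀
  have h' := h.of_eq he hν hr
  have hz : (Instr.apply (.const (e + 1) 0) s₀).reg (e + 1) = 0 := by simp [Instr.apply]
  have hv : (Instr.apply (.const (e + 1) 0) s₀).reg e = if φ γ s.arr then 1 else 0 := by
    simp [Instr.apply, v₀]
  by_cases hc : φ γ s.arr
  · obtain ⟨t₁, s₁, x₁, l₁, r₁, a₁, v₁⟩ := hP₁ γ _ h'
    refine ⟨_, s₁, x₀.seq (.seq (.instr _ _) (.branch_true ?_ x₁)), ?_,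
      fun r hr' => (r₁ r hr').trans (hr r hr'), a₁.trans ha, ?_⟩
    · rw [hz, hv, if_pos hc]
      norm_num
    · simp only [Polynomial.eval_add, Polynomial.eval_ofNat]
      omega
    · rw [v₁, ha]
      exact (if_pos hc).symm
  · obtain ⟨t₁, s₁, x₁, l₁, r₁, a₁, v₁⟩ := hP₂ γ _ h'
    refine ⟨_, s₁, x₀.seq (.seq (.instr _ _) (.branch_false ?_ x₁)), ?_,
      fun r hr' => (r₁ r hr').trans (hr r hr'), a₁.trans ha, ?_⟩
    · rw [hz, hv, if_neg hc]
      norm_num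
    · simp only [Polynomial.eval_add, Polynomial.eval_ofNat]
      omega
    · rw [v₁, ha]
      exact (if_neg hc).symm

theorem Computes.congr {τ σ : Γ → Mem → ℤ} (h : Computes c τ) (e : ∀ γ A, τ γ A = σ γ A) :
    Computes c σ := by
  have : τ = σ := funext fun γ => funext fun A => e γ A
  rwa [← this]

theorem Decides.congr {φ ψ : Γ → Mem → Prop} (h : Decides c φ) (e : ∀ γ A, φ γ A ↔ ψ γ A) :
    Decides c ψ := by
  have : φ = ψ := funext fun γ => funext fun A => propext (e γ A)
  rwa [← this]

theorem Decides.and {φ ψ : Γ → Mem → Prop} (h : Decides c φ) (h' : Decides c ψ) :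
    Decides c fun γ A => φ γ A ∧ ψ γ A := by
  refine (Computes.ite h h' (.const 0)).congr fun γ A => ?_
  split_ifs <;> tauto

theorem Decides.not {φ : Γ → Mem → Prop} (h : Decides c φ) : Decides c fun γ A => ¬ φ γ A := by
  refine (Computes.ite h (.const 0) (.const 1)).congr fun γ A => ?_
  split_ifs <;> tauto

theorem Decides.or {φ ψ : Γ → Mem → Prop} (h : Decides c φ) (h' : Decides c ψ) :
    Decides c fun γ A => φ γ A ∨ ψ γ A :=
  (h.not.and h'.not).not.congr fun γ A => by tauto

theorem Decides.imp {φ ψ : Γ → Mem → Prop} (h : Decides c φ) (h' : Decides c ψ) :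
    Decides c fun γ A => φ γ A → ψ γ A :=
  (h.and h'.not).not.congr fun γ A => by tauto

theorem Decides.le {τ σ : Γ → Mem → ℤ} (hτ : Computes c τ) (hσ : Computes c σ) :
    Decides c fun γ A => τ γ A ≤ σ γ A :=
  (Decides.lt hσ hτ).not.congr fun γ A => by simp

theorem Decides.eq {τ σ : Γ → Mem → ℤ} (hτ : Computes c τ) (hσ : Computes c σ) :
    Decides c fun γ A => τ γ A = σ γ A :=
  ((Decides.le hτ hσ).and (Decides.le hσ hτ)).congr fun γ A => by omega

/-- A proposition independent of the input has its truth value written into the program as a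
constant. -/
theorem Decides.const (p : Prop) : Decides c fun _ _ => p :=
  Computes.const _

/-- A finite disjunction. -/
theorem Decides.exists_fintype {ι : Type*} [Finite ι] {φ : ι → Γ → Mem → Prop}
    (h : ∀ i, Decides c (φ i)) : Decides c fun γ A => ∃ i, φ i γ A := by
  classical
  cases nonempty_fintype ι
  have key : ∀ s : Finset ι, Decides c fun γ A => ∃ i ∈ s, φ i γ A := by
    intro s
    induction s using Finset.induction_on with
    | empty => exact (Decides.const False).congr fun γ A => by simp
    | insert i s _ ih => exact ((h i).or ih).congr fun γ A => by simp
  exact (key Finset.univ).congr fun γ A => by simp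

/-- A finite conjunction. -/
theorem Decides.forall_fintype {ι : Type*} [Finite ι] {φ : ι → Γ → Mem → Prop}
    (h : ∀ i, Decides c (φ i)) : Decides c fun γ A => ∀ i, φ i γ A :=
  (Decides.exists_fintype fun i => (h i).not).not.congr fun γ A => by simp

/-- A change of the context. -/
theorem Computes.comap {Γ' : Type} {c' : Ctx Γ'} {τ : Γ → Mem → ℤ} (h : Computes c τ)
    (g : Γ' → Γ) (hs : ∀ γ, c.size (g γ) = c'.size γ)
    (hv : ∀ v ∈ c.vars, (fun γ => v (g γ)) ∈ c'.vars) : Computes c' fun γ A => τ (g γ) A := by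
  intro ν e he hν
  have : ∀ i : ℕ, ∃ j : ℕ, ∀ v : Γ → ℤ, c.vars[i]? = some v → c'.vars[j]? = some (fun γ => v (g γ)) := by
    intro i
    rcases hi : c.vars[i]? with _ | v
    · exact ⟨0, by simp⟩
    · obtain ⟨j, hj⟩ := List.mem_iff_getElem?.1 (hv v (List.mem_of_getElem? hi))
      exact ⟨j, by simpa using hj⟩
  choose f hf using this
  obtain ⟨P, q, hP⟩ := h (fun i => ν (f i)) e he (fun i hi => hν _ (by
    have := hf i c.vars[i] (List.getElem?_eq_getElem hi)
    exact (List.getElem?_eq_some_iff.1 this).1))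
  refine ⟨P, q, fun γ s h => ?_⟩
  rw [← hs]
  exact hP (g γ) s ⟨by rw [hs]; exact h.1, fun i v hi => h.2 _ _ (hf i v hi)⟩

theorem Computes.ext {τ : Γ → Mem → ℤ} (h : Computes c τ) :
    Computes c.ext fun γ A => τ γ.1 A :=
  h.comap Prod.fst (fun _ => rfl) fun v hv => List.mem_cons_of_mem _ (List.mem_map.2 ⟨v, hv, rfl⟩)

theorem Decides.ext {φ : Γ → Mem → Prop} (h : Decides c φ) : Decides c.ext fun γ A => φ γ.1 A :=
  Computes.ext h

theorem Computes.last : Computes c.ext fun γ _ => (γ.2 : ℤ) :=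
  .var (List.mem_cons_self ..)

/-- The execution of a loop, by means of an invariant. -/
theorem Exec.exists_loop {x y : ℕ} {P : Prog} (I : ℕ → State → Prop) (N B : ℕ)
    (hstep : ∀ i s, i < N → I i s → s.reg x < s.reg y ∧ ∃ t s', Exec P s t s' ∧ t ≤ B ∧
      I (i + 1) s')
    (hend : ∀ s, I N s → ¬ s.reg x < s.reg y) {s : State} (hs : I 0 s) :
    ∃ t s', Exec (.loop x y P) s t s' ∧ t ≤ N * (B + 1) + 1 ∧ I N s' := by
  have key : ∀ k ≤ N, ∀ s, I (N - k) s → ∃ t s', Exec (.loop x y P) s t s' ∧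
      t ≤ k * (B + 1) + 1 ∧ I N s' := by
    intro k
    induction k with
    | zero => exact fun _ s h => ⟨1, s, .loop_false (hend s h), by simp, h⟩
    | succ k ih =>
      intro hk s h
      obtain ⟨hlt, t, s', x₁, l₁, h'⟩ := hstep _ s (by omega) h
      rw [show N - (k + 1) + 1 = N - k by omega] at h'
      obtain ⟨t', s'', x₂, l₂, h''⟩ := ih (by omega) s' h'
      refine ⟨_, s'', .loop_true hlt x₁ x₂, ?_, h''⟩
      rw [add_mul]
      omega
  exact key N le_rfl s (by simpa using hs)

open Finset in
/-- The sum over the numbers less than the size. -/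
theorem Computes.sum {τ : Γ × ℕ → Mem → ℤ} (h : Computes c.ext τ) :
    Computes c fun γ A => ∑ i ∈ range (c.size γ), τ (γ, i) A := by
  intro ν e he hν
  obtain ⟨P, q, hP⟩ := h (extReg ν (e + 1)) (e + 2) (by omega)
    (extReg_lt (fun i hi => (hν i hi).trans (by omega)) (by omega))
  -- Register `e` accumulates the sum, `e + 1` is the counter, and `e + 2` receives the summand and
  -- then the increment 1.
  refine ⟨.seq (.instr (.const e 0)) (.seq (.instr (.const (e + 1) 0)) (.loop (e + 1) 0
    (.seq P (.seq (.instr (.add e e (e + 2))) (.seq (.instr (.const (e + 2) 1))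
      (.instr (.add (e + 1) (e + 1) (e + 2)))))))),
    Polynomial.X * (q + 4) + 3, fun γ s hs => ?_⟩
  let I : ℕ → State → Prop := fun i s' => (∀ r < e, s'.reg r = s.reg r) ∧ s'.arr = s.arr ∧
    s'.reg e = ∑ j ∈ range i, τ (γ, j) s.arr ∧ s'.reg (e + 1) = i
  have hloop : ∃ t s', Exec (.loop (e + 1) 0
      (.seq P (.seq (.instr (.add e e (e + 2))) (.seq (.instr (.const (e + 2) 1))
      (.instr (.add (e + 1) (e + 1) (e + 2)))))))
      (Instr.apply (.const (e + 1) 0) (Instr.apply (.const e 0) s)) t s' ∧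
      t ≤ c.size γ * ((q.eval (c.size γ) + 3) + 1) + 1 ∧ I (c.size γ) s' := by
    refine Exec.exists_loop I _ _ ?_ ?_ ?_
    · rintro i s₁ hi ⟨h1, h2, h3, h4⟩
      have hh := hs.of_eq he hν h1
      refine ⟨by rw [h4, hh.1]; exact_mod_cast hi, ?_⟩
      obtain ⟨t₂, s₂, x₂, l₂, r₂, a₂, v₂⟩ := hP (γ, i) s₁ (hh.ext h4)
      refine ⟨_, _, x₂.seq (.seq (.instr _ _) (.seq (.instr _ _) (.instr _ _))), ?_, ?_, ?_, ?_, ?_⟩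
      · change t₂ ≤ q.eval (c.size γ) at l₂
        omega
      · intro r hr
        have e1 : r ≠ e := by omega
        have e2 : r ≠ e + 1 := by omega
        have e3 : r ≠ e + 2 := by omega
        simp [Instr.apply, e1, e2, e3]
        rw [r₂ r (by omega), h1 r hr]
      · simp [Instr.apply, a₂, h2]
      · simp [Instr.apply]
        rw [r₂ e (by omega), h3, v₂, sum_range_succ, h2]
      · simp [Instr.apply]
        rw [r₂ (e + 1) (by omega), h4]
    · rintro s₁ ⟨h1, h2, h3, h4⟩
      rw [h4, (hs.of_eq he hν h1).1]
      exact lt_irrefl _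
    · refine ⟨?_, rfl, ?_, ?_⟩
      · intro r hr
        have e1 : r ≠ e := by omega
        have e2 : r ≠ e + 1 := by omega
        simp [Instr.apply, e1, e2]
      · simp [Instr.apply]
      · simp [Instr.apply]
  obtain ⟨t, s', x, l, h1, h2, h3, -⟩ := hloop
  refine ⟨_, s', .seq (.instr _ _) (.seq (.instr _ _) x), ?_, h1, h2, h3⟩
  simp only [Polynomial.eval_add, Polynomial.eval_mul, Polynomial.eval_X, Polynomial.eval_ofNat]
  change t ≤ c.size γ * (q.eval (c.size γ) + 4) + 1 at l
  omega

open Classical Finset in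
theorem Computes.count {φ : Γ × ℕ → Mem → Prop} (h : Decides c.ext φ) :
    Computes c fun γ A => (#{i ∈ range (c.size γ) | φ (γ, i) A} : ℤ) :=
  (Computes.sum h).congr fun γ A => by simp

open Finset in
theorem Decides.exists_lt {φ : Γ × ℕ → Mem → Prop} (h : Decides c.ext φ) :
    Decides c fun γ A => ∃ i < c.size γ, φ (γ, i) A := by
  classical
  refine (Decides.lt (.const 0) (Computes.count h)).congr fun γ A => ?_
  rw [Nat.cast_pos, card_pos, filter_nonempty_iff]
  simp

theorem Decides.forall_lt {φ : Γ × ℕ → Mem → Prop} (h : Decides c.ext φ) :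
    Decides c fun γ A => ∀ i < c.size γ, φ (γ, i) A :=
  (Decides.exists_lt h.not).not.congr fun γ A => by push Not; rfl

theorem Transforms.id : Transforms c fun _ A => A := by
  intro ν e he hν
  obtain ⟨P, q, h⟩ := Computes.const (c := c) 0 ν e he hν
  refine ⟨P, q, fun γ s hs => ?_⟩
  obtain ⟨t, s', h1, h2, h3, h4, -⟩ := h γ s hs
  exact ⟨t, s', h1, h2, h3, h4⟩

theorem Transforms.congr {F G : Γ → Mem → Mem} (h : Transforms c F)
    (e : ∀ γ A, F γ A = G γ A) : Transforms c G := by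
  have : F = G := funext fun γ => funext fun A => e γ A
  rwa [← this]

theorem Transforms.store (a : ℕ) {τ σ : Γ → Mem → ℤ} (hτ : Computes c τ) (hσ : Computes c σ) :
    Transforms c fun γ A => Function.update A a (Function.update (A a) (τ γ A) (σ γ A)) := by
  intro ν e he hν
  refine hτ.then₂ hσ he hν (Q := .instr (.store a e (e + 1))) (k := 1) ?_
  intro γ s s₀ hr ha h1 h2
  refine ⟨_, _, .instr _ _, le_rfl, fun r hr' => hr r hr', ?_⟩
  simp [Instr.apply, h1, h2, ha]

theorem Transforms.comp {F G : Γ → Mem → Mem} (hF : Transforms c F) (hG : Transforms c G) :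
    Transforms c fun γ A => G γ (F γ A) := by
  intro ν e he hν
  obtain ⟨P, p, hP⟩ := hF ν e he hν
  obtain ⟨Q, q, hQ⟩ := hG ν e he hν
  refine ⟨.seq P Q, p + q, fun γ s h => ?_⟩
  obtain ⟨t₁, s₁, x₁, l₁, r₁, a₁⟩ := hP γ s h
  obtain ⟨t₂, s₂, x₂, l₂, r₂, a₂⟩ := hQ γ s₁ (h.of_eq he hν r₁)
  refine ⟨_, s₂, x₁.seq x₂, ?_, fun r hr => (r₂ r hr).trans (r₁ r hr), by rw [a₂, a₁]⟩
  simp only [Polynomial.eval_add]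
  omega

open Classical in
theorem Transforms.ite {φ : Γ → Mem → Prop} {F G : Γ → Mem → Mem} (hφ : Decides c φ)
    (hF : Transforms c F) (hG : Transforms c G) :
    Transforms c fun γ A => if φ γ A then F γ A else G γ A := by
  intro ν e he hν
  obtain ⟨P, p, hP⟩ := hφ ν e he hν
  obtain ⟨P₁, p₁, hP₁⟩ := hF ν e he hν
  obtain ⟨P₂, p₂, hP₂⟩ := hG ν e he hν
  refine ⟨.seq P (.seq (.instr (.const (e + 1) 0)) (.branch (e + 1) e P₁ P₂)), p + (p₁ + p₂ + 2),
    fun γ s h => ?_⟩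
  obtain ⟨t₀, s₀, x₀, l₀, r₀, a₀, v₀⟩ := hP γ s h
  have hr : ∀ r < e, (Instr.apply (.const (e + 1) 0) s₀).reg r = s.reg r := by
    intro r hr
    rw [← r₀ r hr]
    simp [Instr.apply, (show r ≠ e + 1 by omega)]
  have ha : (Instr.apply (.const (e + 1) 0) s₀).arr = s.arr := a₀
  have h' := h.of_eq he hν hr
  have hz : (Instr.apply (.const (e + 1) 0) s₀).reg (e + 1) = 0 := by simp [Instr.apply]
  have hv : (Instr.apply (.const (e + 1) 0) s₀).reg e = if φ γ s.arr then 1 else 0 := by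
    simp [Instr.apply, v₀]
  by_cases hc : φ γ s.arr
  · obtain ⟨t₁, s₁, x₁, l₁, r₁, a₁⟩ := hP₁ γ _ h'
    refine ⟨_, s₁, x₀.seq (.seq (.instr _ _) (.branch_true ?_ x₁)), ?_,
      fun r hr' => (r₁ r hr').trans (hr r hr'), ?_⟩
    · rw [hz, hv, if_pos hc]
      norm_num
    · simp only [Polynomial.eval_add, Polynomial.eval_ofNat]
      omega
    · rw [a₁, ha]
      exact (if_pos hc).symm
  · obtain ⟨t₁, s₁, x₁, l₁, r₁, a₁⟩ := hP₂ γ _ h'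
    refine ⟨_, s₁, x₀.seq (.seq (.instr _ _) (.branch_false ?_ x₁)), ?_,
      fun r hr' => (r₁ r hr').trans (hr r hr'), ?_⟩
    · rw [hz, hv, if_neg hc]
      norm_num
    · simp only [Polynomial.eval_add, Polynomial.eval_ofNat]
      omega
    · rw [a₁, ha]
      exact (if_neg hc).symm

/-- The composition of `f 0`, …, `f (n - 1)`, in this order. -/
def iter {α : Type*} (f : ℕ → α → α) : ℕ → α → α
  | 0, A => A
  | n + 1, A => f n (iter f n A)

/-- The loop over the numbers less than the size plus a constant. -/
theorem Transforms.loop (k : ℕ) {F : Γ × ℕ → Mem → Mem} (h : Transforms c.ext F) :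
    Transforms c fun γ A => iter (fun i => F (γ, i)) (c.size γ + k) A := by
  intro ν e he hν
  obtain ⟨P, q, hP⟩ := h (extReg ν e) (e + 2) (by omega) (extReg_lt hν (by omega))
  -- Register `e` is the counter, and `e + 1` holds the bound, obtained by adding the size in
  -- register 0 to `k`.
  refine ⟨.seq (.instr (.const e 0)) (.seq (.instr (.const (e + 1) k)) (.seq
    (.instr (.add (e + 1) (e + 1) 0)) (.loop e (e + 1)
    (.seq P (.seq (.instr (.const (e + 2) 1)) (.instr (.add e e (e + 2)))))))),
    (Polynomial.X + Polynomial.C k) * (q + 3) + 4, fun γ s hs => ?_⟩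
  let I : ℕ → State → Prop := fun i s' => (∀ r < e, s'.reg r = s.reg r) ∧
    s'.arr = iter (fun i => F (γ, i)) i s.arr ∧ s'.reg e = i ∧ s'.reg (e + 1) = c.size γ + k
  have hloop : ∃ t s', Exec (.loop e (e + 1) (.seq P (.seq (.instr (.const (e + 2) 1)) (.instr (.add e e (e + 2))))))
      (Instr.apply (.add (e + 1) (e + 1) 0) (Instr.apply (.const (e + 1) k)
        (Instr.apply (.const e 0) s))) t s' ∧
      t ≤ (c.size γ + k) * ((q.eval (c.size γ) + 2) + 1) + 1 ∧ I (c.size γ + k) s' := by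
    refine Exec.exists_loop I _ _ ?_ ?_ ?_
    · rintro i s₁ hi ⟨h1, h2, h3, h4⟩
      have hh := hs.of_eq he hν h1
      refine ⟨by rw [h3, h4]; exact_mod_cast hi, ?_⟩
      obtain ⟨t₂, s₂, x₂, l₂, r₂, a₂⟩ := hP (γ, i) s₁ (hh.ext h3)
      refine ⟨_, _, x₂.seq (.seq (.instr _ _) (.instr _ _)), ?_, ?_, ?_, ?_, ?_⟩
      · change t₂ ≤ q.eval (c.size γ) at l₂
        omega
      · intro r hr
        have e1 : r ≠ e := by omega
        have e3 : r ≠ e + 2 := by omega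
        simp [Instr.apply, e1, e3]
        rw [r₂ r (by omega), h1 r hr]
      · simp [Instr.apply, a₂, h2, iter]
      · simp [Instr.apply]
        rw [r₂ e (by omega), h3]
      · simp [Instr.apply]
        rw [r₂ (e + 1) (by omega), h4]
    · rintro s₁ ⟨h1, h2, h3, h4⟩
      rw [h3, h4]
      push_cast
      exact lt_irrefl _
    · refine ⟨?_, rfl, ?_, ?_⟩
      · intro r hr
        have e1 : r ≠ e := by omega
        have e2 : r ≠ e + 1 := by omega
        simp [Instr.apply, e1, e2]
      · simp [Instr.apply]
      · have e1 : 0 ≠ e := by omega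
        simp [Instr.apply, e1, hs.1]
        ring
  obtain ⟨t, s', x, l, h1, h2, -⟩ := hloop
  refine ⟨_, s', .seq (.instr _ _) (.seq (.instr _ _) (.seq (.instr _ _) x)), ?_, h1, h2⟩
  simp only [Polynomial.eval_add, Polynomial.eval_mul, Polynomial.eval_X, Polynomial.eval_ofNat,
    Polynomial.eval_C]
  change t ≤ (c.size γ + k) * (q.eval (c.size γ) + 3) + 1 at l
  omega

theorem Transforms.comap {Γ' : Type} {c' : Ctx Γ'} {F : Γ → Mem → Mem} (h : Transforms c F)
    (g : Γ' → Γ) (hs : ∀ γ, c.size (g γ) = c'.size γ)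
    (hv : ∀ v ∈ c.vars, (fun γ => v (g γ)) ∈ c'.vars) : Transforms c' fun γ A => F (g γ) A := by
  intro ν e he hν
  have : ∀ i : ℕ, ∃ j : ℕ, ∀ v : Γ → ℤ, c.vars[i]? = some v → c'.vars[j]? = some (fun γ => v (g γ)) := by
    intro i
    rcases hi : c.vars[i]? with _ | v
    · exact ⟨0, by simp⟩
    · obtain ⟨j, hj⟩ := List.mem_iff_getElem?.1 (hv v (List.mem_of_getElem? hi))
      exact ⟨j, by simpa using hj⟩
  choose f hf using this
  obtain ⟨P, q, hP⟩ := h (fun i => ν (f i)) e he (fun i hi => hν _ (by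
    have := hf i c.vars[i] (List.getElem?_eq_getElem hi)
    exact (List.getElem?_eq_some_iff.1 this).1))
  refine ⟨P, q, fun γ s h => ?_⟩
  rw [← hs]
  exact hP (g γ) s ⟨by rw [hs]; exact h.1, fun i v hi => h.2 _ _ (hf i v hi)⟩

/-- The loop over the `m`-tuples of numbers less than `n`. -/
def iterTuple {α : Type*} (n : ℕ) : (m : ℕ) → ((Fin m → ℕ) → α → α) → α → α
  | 0, F, A => F Fin.elim0 A
  | m + 1, F, A => iter (fun i => iterTuple n m fun K => F (Fin.cons i K)) n A

/-- The context with `m` further variables. -/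
def Ctx.extTuple (c : Ctx Γ) (m : ℕ) : Ctx (Γ × (Fin m → ℕ)) where
  size γ := c.size γ.1
  vars := (List.finRange m).map (fun j γ => (γ.2 j : ℤ)) ++ c.vars.map fun v γ => v γ.1

/-- These are `m` nested loops; as the depth is fixed with the program, the running time stays
polynomial. -/
theorem Transforms.loopTuple {m : ℕ} {F : Γ × (Fin m → ℕ) → Mem → Mem}
    (h : Transforms (c.extTuple m) F) :
    Transforms c fun γ A => iterTuple (c.size γ) m (fun K => F (γ, K)) A := by
  induction m generalizing Γ with
  | zero =>
    refine h.comap (fun γ => (γ, Fin.elim0)) (fun _ => rfl) fun v hv => ?_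
    simp only [Ctx.extTuple, List.finRange_zero, List.map_nil, List.nil_append,
      List.mem_map] at hv
    obtain ⟨w, hw, rfl⟩ := hv
    exact hw
  | succ m ih =>
    have h' : Transforms (c.ext.extTuple m)
        fun γ : (Γ × ℕ) × (Fin m → ℕ) => F (γ.1.1, Fin.cons γ.1.2 γ.2) := by
      refine h.comap (fun γ : (Γ × ℕ) × (Fin m → ℕ) => (γ.1.1, Fin.cons γ.1.2 γ.2)) (fun _ => rfl) fun v hv => ?_
      simp only [Ctx.extTuple, List.mem_append, List.mem_map, List.mem_finRange, true_and] at hv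
      simp only [Ctx.extTuple, Ctx.ext, List.mem_append, List.mem_map, List.mem_finRange, true_and,
        List.mem_cons]
      rcases hv with ⟨j, rfl⟩ | ⟨w, hw, rfl⟩
      · cases j using Fin.cases with
        | zero => exact Or.inr ⟨_, Or.inl rfl, rfl⟩
        | succ j => exact Or.inl ⟨j, rfl⟩
      · exact Or.inr ⟨_, Or.inr ⟨w, hw, rfl⟩, rfl⟩
    exact Transforms.loop 0 (ih h')

theorem Transforms.foldl {ι : Type*} (l : List ι) {F : ι → Γ → Mem → Mem}
    (h : ∀ i, Transforms c (F i)) : Transforms c fun γ A => l.foldl (fun A i => F i γ A) A := by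
  induction l with
  | nil => exact Transforms.id
  | cons i l ih => exact (h i).comp ih

end RAM

namespace RAM

/-! ### Invariants and progress of loops -/

section Iter

variable {α : Type*}

theorem iter_induction {f : ℕ → α → α} {n : ℕ} {I : α → Prop}
    (h : ∀ i < n, ∀ A, I A → I (f i A)) {A : α} (hA : I A) : I (iter f n A) := by
  induction n with
  | zero => exact hA
  | succ n ih => exact h n (by omega) _ (ih fun i hi => h i (by omega))

/-- A property that is established by some step of a loop and then preserved. -/
theorem iter_establish {f : ℕ → α → α} {n : ℕ} {I Q : α → Prop}
    (hI : ∀ i < n, ∀ A, I A → I (f i A)) (hQ : ∀ i < n, ∀ A, I A → Q A → Q (f i A)) {j : ℕ}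
    (hj : j < n) (h : ∀ A, I A → Q (f j A)) {A : α} (hA : I A) : Q (iter f n A) := by
  induction n with
  | zero => omega
  | succ n ih =>
    have hIn : I (iter f n A) := iter_induction (fun i hi => hI i (by omega)) hA
    rcases Nat.lt_succ_iff_lt_or_eq.1 hj with hj | rfl
    · exact hQ n (by omega) _ hIn
        (ih (fun i hi => hI i (by omega)) (fun i hi => hQ i (by omega)) hj)
    · exact h _ hIn

theorem iterTuple_induction {n m : ℕ} {F : (Fin m → ℕ) → α → α} {I : α → Prop}
    (h : ∀ K, (∀ j, K j < n) → ∀ A, I A → I (F K A)) {A : α} (hA : I A) :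
    I (iterTuple n m F A) := by
  induction m generalizing A with
  | zero => exact h _ (fun j => j.elim0) A hA
  | succ m ih =>
    refine iter_induction (fun i hi A hA => ih (fun K hK => h _ fun j => ?_) hA) hA
    cases j using Fin.cases with
    | zero => exact hi
    | succ j => exact hK j

theorem iterTuple_establish {n m : ℕ} {F : (Fin m → ℕ) → α → α} {I Q : α → Prop}
    (hI : ∀ K, (∀ j, K j < n) → ∀ A, I A → I (F K A))
    (hQ : ∀ K, (∀ j, K j < n) → ∀ A, I A → Q A → Q (F K A)) {K : Fin m → ℕ} (hK : ∀ j, K j < n)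
    (h : ∀ A, I A → Q (F K A)) {A : α} (hA : I A) : Q (iterTuple n m F A) := by
  induction m generalizing A with
  | zero =>
    have : K = Fin.elim0 := Subsingleton.elim _ _
    subst this
    exact h A hA
  | succ m ih =>
    have hcons : ∀ i < n, ∀ K : Fin m → ℕ, (∀ j, K j < n) →
        ∀ j, (Fin.cons i K : Fin (m + 1) → ℕ) j < n := by
      intro i hi K hK j
      cases j using Fin.cases with
      | zero => exact hi
      | succ j => exact hK j
    refine iter_establish (I := I) (j := K 0) ?_ ?_ (hK 0) ?_ hA
    · exact fun i hi A hA => iterTuple_induction (fun K hK => hI _ (hcons i hi K hK)) hA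
    · intro i hi A hA hQA
      exact (iterTuple_induction (I := fun A => I A ∧ Q A)
        (fun K hK A hA => ⟨hI _ (hcons i hi K hK) A hA.1, hQ _ (hcons i hi K hK) A hA.1 hA.2⟩)
        ⟨hA, hQA⟩).2
    · intro A hA
      refine ih (fun L hL => hI _ (hcons _ (hK 0) L hL)) (fun L hL => hQ _ (hcons _ (hK 0) L hL))
        (K := fun j => K j.succ) (fun j => hK _) ?_ hA
      have : (Fin.cons (K 0) fun j => K j.succ : Fin (m + 1) → ℕ) = K := Fin.cons_self_tail K
      rw [this]
      exact h

theorem foldl_induction {ι : Type*} {F : ι → α → α} {I : α → Prop} (l : List ι)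
    (h : ∀ i A, I A → I (F i A)) {A : α} (hA : I A) : I (l.foldl (fun A i => F i A) A) := by
  induction l generalizing A with
  | nil => exact hA
  | cons i l ih => exact ih (h i A hA)

theorem foldl_establish {ι : Type*} {F : ι → α → α} {I Q : α → Prop} {l : List ι}
    (hI : ∀ i A, I A → I (F i A)) (hQ : ∀ i A, I A → Q A → Q (F i A)) {j : ι} (hj : j ∈ l)
    (h : ∀ A, I A → Q (F j A)) {A : α} (hA : I A) : Q (l.foldl (fun A i => F i A) A) := by
  induction l generalizing A with
  | nil => simp at hj
  | cons i l ih =>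
    rcases List.mem_cons.1 hj with rfl | hj
    · exact (foldl_induction (I := fun A => I A ∧ Q A) l
        (fun i A hA => ⟨hI i A hA.1, hQ i A hA.1 hA.2⟩) ⟨hI _ A hA, h A hA⟩).2
    · exact ih hj (hI i A hA)

/-- If every step of a loop that is not trivial increases a potential, then so does the loop,
unless all its steps are trivial. -/
theorem iter_progress {f : ℕ → α → α} {n : ℕ} {I : α → Prop} {Φ : α → ℤ}
    (h : ∀ i < n, ∀ A, I A → I (f i A) ∧ (f i A = A ∨ Φ A < Φ (f i A))) {A : α} (hA : I A) :
    ((∀ i < n, f i A = A) ∧ iter f n A = A) ∨ Φ A < Φ (iter f n A) := by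
  induction n with
  | zero => exact Or.inl ⟨by simp, rfl⟩
  | succ n ih =>
    have hn := h n (by omega) _ (iter_induction (I := I) (n := n)
      (fun i hi A hA => (h i (by omega) A hA).1) hA)
    rcases ih fun i hi => h i (by omega) with ⟨h1, h2⟩ | h1
    · rcases hn.2 with h3 | h3
      · left
        rw [h2] at h3
        refine ⟨fun i hi => ?_, by rw [iter, h2, h3]⟩
        rcases Nat.lt_succ_iff_lt_or_eq.1 hi with hi | rfl
        · exact h1 i hi
        · exact h3
      · right
        rw [h2] at h3
        rwa [iter, h2]
    · right
      rcases hn.2 with h3 | h3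
      · rwa [iter, h3]
      · exact h1.trans h3

/-- Repeating a step that increases a potential by `k` unless it leads to a fixed point. -/
theorem iter_fixed {g : α → α} {I Fix : α → Prop} {Φ : α → ℤ} {k : ℤ}
    (h : ∀ A, I A → I (g A) ∧ (Fix (g A) ∨ Φ A + k ≤ Φ (g A)))
    (hf : ∀ A, Fix A → Fix (g A)) (n : ℕ) {A : α} (hA : I A) :
    I (iter (fun _ => g) n A) ∧
      (Fix (iter (fun _ => g) n A) ∨ Φ A + n * k ≤ Φ (iter (fun _ => g) n A)) := by
  induction n with
  | zero => exact ⟨hA, Or.inr (by simp [iter])⟩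
  | succ n ih =>
    have h1 := h _ ih.1
    refine ⟨h1.1, ?_⟩
    rcases ih.2 with h2 | h2
    · exact Or.inl (hf _ h2)
    · rcases h1.2 with h3 | h3
      · exact Or.inl h3
      · right
        change _ ≤ Φ (g (iter (fun _ => g) n A))
        push_cast
        linarith

end Iter

/-! ### An auction for bipartite matchings -/

section Auction

/-- The vertex `u` is unmatched, and `v` is one of its neighbours of least price. The prices are in
array 9, and the owners are in array 10. -/
def CanBid (n : ℕ) (H : Mem → ℕ → ℕ → Prop) (u v : ℕ) (A : Mem) : Prop :=
  (∀ w < n, A 10 w ≠ u) ∧ H A u v ∧ A 9 v ≤ n + 1 ∧ ∀ w < n, H A u w → A 9 v ≤ A 9 w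

/-- A cell of an array is overwritten. -/
def write (A : Mem) (a : ℕ) (i x : ℤ) : Mem := Function.update A a (Function.update (A a) i x)

open Classical in
/-- If possible, `u` becomes the owner of `v`, whose price increases. -/
noncomputable def bid (n : ℕ) (H : Mem → ℕ → ℕ → Prop) (u v : ℕ) (A : Mem) : Mem :=
  if CanBid n H u v A then write (write A 10 v u) 9 v (A 9 v + 1) else A

/-- A round of the auction. -/
noncomputable def auctionRound (n : ℕ) (H : Mem → ℕ → ℕ → Prop) (A : Mem) : Mem :=
  iter (fun u => iter (fun v => bid n H u v) n) n A

/-- The auction. -/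
noncomputable def auction (n : ℕ) (H : Mem → ℕ → ℕ → Prop) (A : Mem) : Mem :=
  iter (fun _ => iter (fun _ => auctionRound n H) (n + 2)) (n + 2) A

/-- The invariant of the auction for the bipartite graph `H`. -/
structure AuctionInv (n : ℕ) (H : ℕ → ℕ → Prop) (A₀ A : Mem) : Prop where
  agree : ∀ a < 9, A a = A₀ a
  nonneg : ∀ v < n, 0 ≤ A 9 v
  le : ∀ v < n, A 9 v ≤ n + 2
  owner : ∀ v < n, (A 10 v = -1 ∧ A 9 v = 0) ∨ ∃ u < n, A 10 v = (u : ℕ) ∧ H u v ∧ 1 ≤ A 9 v ∧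
    ∀ w < n, H u w → A 9 v ≤ A 9 w + 1
  inj : ∀ v < n, ∀ w < n, v ≠ w → A 10 v = A 10 w → A 10 v = -1

variable {n : ℕ} {H : Mem → ℕ → ℕ → Prop} {A₀ : Mem}

/-- The total price. -/
def totalPrice (n : ℕ) (A : Mem) : ℤ := ∑ v ∈ Finset.range n, A 9 v

theorem write_self (A : Mem) (a : ℕ) (i x : ℤ) : write A a i x a i = x := by simp [write]

theorem write_of_ne_array (A : Mem) {a b : ℕ} (h : b ≠ a) (i x : ℤ) : write A a i x b = A b := by
  simp [write, h]

theorem write_of_ne (A : Mem) (a : ℕ) {i j : ℤ} (h : j ≠ i) (x : ℤ) :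
    write A a i x a j = A a j := by
  simp [write, h]

/-- The bid goes to a neighbour of least price and raises it by one, so the new owner pays at most
one more than the price of any neighbour. Other prices do not fall, which keeps this bound for the
other owners, and a displaced owner just becomes unmatched. -/
theorem AuctionInv.bid (hH : ∀ A B : Mem, (∀ a < 9, A a = B a) → H A = H B) {u v : ℕ} (hu : u < n)
    (hv : v < n) {A : Mem} (hA : AuctionInv n (H A₀) A₀ A) :
    AuctionInv n (H A₀) A₀ (bid n H u v A) ∧
      (RAM.bid n H u v A = A ∨ totalPrice n A < totalPrice n (RAM.bid n H u v A)) := by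
  unfold RAM.bid
  split_ifs with hc
  swap
  · exact ⟨hA, Or.inl rfl⟩
  obtain ⟨c1, c2, c3, c4⟩ := hc
  rw [hH A A₀ hA.agree] at c2 c4
  set B := write (write A 10 v u) 9 v (A 9 v + 1) with hB
  have p1 : B 9 v = A 9 v + 1 := write_self ..
  have p2 : ∀ w : ℕ, w ≠ v → B 9 w = A 9 w := by
    intro w hw
    rw [hB, write_of_ne _ _ (by exact_mod_cast hw), write_of_ne_array _ (by decide)]
  have o1 : B 10 v = u := by
    rw [hB, write_of_ne_array _ (by decide), write_self]
  have o2 : ∀ w : ℕ, w ≠ v → B 10 w = A 10 w := by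
    intro w hw
    rw [hB, write_of_ne_array _ (by decide), write_of_ne _ _ (by exact_mod_cast hw)]
  have hle : ∀ w : ℕ, A 9 w ≤ B 9 w := by
    intro w
    by_cases hw : w = v
    · subst hw; omega
    · rw [p2 w hw]
  refine ⟨⟨fun a ha => ?_, fun w hw => (hA.nonneg w hw).trans (hle w), fun w hw => ?_,
    fun w hw => ?_, fun w hw x hx hwx e => ?_⟩, Or.inr ?_⟩
  · rw [hB, write_of_ne_array _ (by omega), write_of_ne_array _ (by omega), hA.agree a ha]
  · by_cases h : w = v
    · subst h; omega
    · rw [p2 w h]; exact hA.le w hw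
  · by_cases h : w = v
    · subst h
      refine Or.inr ⟨u, hu, o1, c2, ?_, fun x hx hux => ?_⟩
      · have := hA.nonneg w hw
        omega
      · have := c4 x hx hux
        have := hle x
        omega
    · rw [p2 w h, o2 w h]
      rcases hA.owner w hw with h' | ⟨u', hu', e, e1, e2, e3⟩
      · exact Or.inl h'
      · refine Or.inr ⟨u', hu', e, e1, e2, fun x hx hux => (e3 x hx hux).trans ?_⟩
        have := hle x
        omega
  · by_cases h : w = v
    · subst h
      rw [o1, o2 x (Ne.symm hwx)] at e
      exact absurd e.symm (c1 x hx)
    · by_cases h' : x = v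
      · subst h'
        rw [o1, o2 w hwx] at e
        exact absurd e (c1 w hw)
      · rw [o2 w h, o2 x h'] at e
        rw [o2 w h]
        exact hA.inj w hw x hx hwx e
  · refine Finset.sum_lt_sum (fun w _ => hle w) ⟨v, Finset.mem_range.2 hv, ?_⟩
    rw [p1]
    omega

theorem bid_eq_self_iff {u v : ℕ} {A : Mem} : bid n H u v A = A ↔ ¬ CanBid n H u v A := by
  unfold bid
  split_ifs with hc
  · refine iff_of_false (fun h => ?_) (not_not.2 hc)
    have := congrFun (congrFun h 9) v
    rw [write_self] at this
    omega
  · exact iff_of_true rfl hc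

/-- Every bid that takes place raises the total price. If the total does not rise, all pairs were
tested in the same unchanged memory, so no bid was possible in it. -/
theorem AuctionInv.round (hH : ∀ A B : Mem, (∀ a < 9, A a = B a) → H A = H B) {A : Mem}
    (hA : AuctionInv n (H A₀) A₀ A) :
    AuctionInv n (H A₀) A₀ (auctionRound n H A) ∧
      (((∀ u < n, ∀ v < n, ¬ CanBid n H u v A) ∧ auctionRound n H A = A) ∨
        totalPrice n A < totalPrice n (auctionRound n H A)) := by
  have inner : ∀ u < n, ∀ A, AuctionInv n (H A₀) A₀ A →
      AuctionInv n (H A₀) A₀ (iter (fun v => RAM.bid n H u v) n A) ∧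
      (((∀ v < n, RAM.bid n H u v A = A) ∧ iter (fun v => RAM.bid n H u v) n A = A) ∨
        totalPrice n A < totalPrice n (iter (fun v => RAM.bid n H u v) n A)) :=
    fun u hu A hA => ⟨iter_induction (fun v hv A hA => (hA.bid hH hu hv).1) hA,
      iter_progress (fun v hv A hA => hA.bid hH hu hv) hA⟩
  have outer := iter_progress (f := fun u => iter (fun v => RAM.bid n H u v) n) (n := n)
    (I := AuctionInv n (H A₀) A₀) (Φ := totalPrice n)
    (fun u hu A hA => ⟨(inner u hu A hA).1, (inner u hu A hA).2.imp_left fun h => h.2⟩) hA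
  refine ⟨iter_induction (fun u hu A hA => (inner u hu A hA).1) hA, ?_⟩
  rcases outer with ⟨h1, h2⟩ | h
  · refine Or.inl ⟨fun u hu v hv => bid_eq_self_iff.1 ?_, h2⟩
    rcases (inner u hu A hA).2 with h | h
    · exact h.1 v hv
    · have := h1 u hu
      rw [this] at h
      exact absurd h (lt_irrefl _)
  · exact Or.inr h

/-- At the end of the auction, no further bid is possible. -/
theorem AuctionInv.auction (hH : ∀ A B : Mem, (∀ a < 9, A a = B a) → H A = H B) {A : Mem}
    (hA : AuctionInv n (H A₀) A₀ A) :
    AuctionInv n (H A₀) A₀ (auction n H A) ∧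
      ∀ u < n, ∀ v < n, ¬ CanBid n H u v (RAM.auction n H A) := by
  let Fix : Mem → Prop := fun A => auctionRound n H A = A
  have hfix : ∀ A, Fix A → ∀ m, iter (fun _ => auctionRound n H) m A = A := by
    intro A h m
    induction m with
    | zero => rfl
    | succ m ih => rw [iter, ih, h]
  -- Unless a fixed point is reached, each inner loop raises the total price by `n + 2` and the two
  -- loops by `(n + 2) ^ 2`, more than the bound `n * (n + 2)` on the total.
  have key := iter_fixed (g := iter (fun _ => auctionRound n H) (n + 2)) (Fix := Fix)
    (I := AuctionInv n (H A₀) A₀) (Φ := totalPrice n) (k := (n + 2 : ℕ) * 1)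
    (fun A hA => iter_fixed (fun A hA => ⟨(hA.round hH).1, (hA.round hH).2.imp
      (fun h => by change auctionRound n H _ = _; rw [h.2, h.2]) fun h => by omega⟩)
      (fun A h => by change auctionRound n H _ = _; rw [h, h]) _ hA)
    (fun A h => by rw [hfix A h]; exact h) (n + 2) hA
  have hfin : Fix (RAM.auction n H A) := by
    refine key.2.resolve_right fun h => ?_
    have h1 : 0 ≤ totalPrice n A := Finset.sum_nonneg fun v hv => hA.nonneg v (by simpa using hv)
    have h2 : totalPrice n (RAM.auction n H A) ≤ n * (n + 2) := by
      refine (Finset.sum_le_card_nsmul _ _ _ fun v hv => key.1.le v (by simpa using hv)).trans ?_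
      simp
    change _ ≤ totalPrice n (RAM.auction n H A) at h
    push_cast at h
    nlinarith
  refine ⟨key.1, ?_⟩
  rcases (key.1.round hH).2 with h | h
  · exact h.1
  · change totalPrice n (RAM.auction n H A) < totalPrice n (auctionRound n H (RAM.auction n H A)) at h
    rw [hfin] at h
    exact absurd h (lt_irrefl _)

/-- The vertices on the side `L` that are unmatched or matched above the level `ℓ`, and those on
the side `R` of price at most `ℓ`. -/
def AboveBelow (n : ℕ) (L R : ℕ → Prop) (A : Mem) (ℓ w : ℕ) : Prop :=
  (L w ∧ ((∀ v < n, A 10 v ≠ w) ∨ ∃ v < n, A 10 v = w ∧ (ℓ : ℤ) < A 9 v)) ∨ (R w ∧ A 9 w ≤ ℓ)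

open Classical Finset in
/-- At some level, the end of the auction yields a maximum independent set. -/
theorem AuctionInv.exists_level {H : ℕ → ℕ → Prop} {A : Mem} (hA : AuctionInv n H A₀ A)
    {L R : ℕ → Prop} (hLR : ∀ w, L w → R w → False) (hHLR : ∀ u v, H u v → L u ∧ R v)
    (hstable : ∀ u < n, ∀ v < n, ¬ CanBid n (fun _ => H) u v A) :
    ∃ ℓ < n + 2,
      (∀ u < n, ∀ v < n, AboveBelow n L R A ℓ u → AboveBelow n L R A ℓ v → ¬ H u v) ∧
      ∀ Q : Finset ℕ, (∀ w ∈ Q, w < n ∧ (L w ∨ R w)) → (∀ u ∈ Q, ∀ v ∈ Q, ¬ H u v) →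
        #Q ≤ #{w ∈ range n | AboveBelow n L R A ℓ w} := by
  -- The `n` prices cannot take all `n + 1` values from 1 to `n + 1`.
  obtain ⟨ℓ, hℓ, hgap⟩ : ∃ ℓ ∈ Icc 1 (n + 1), ∀ v < n, A 9 v ≠ (ℓ : ℕ) := by
    by_contra! hc
    choose! f hf using hc
    have := card_le_card_of_injOn (s := Icc 1 (n + 1)) (t := range n) f
      (fun ℓ hℓ => by simpa using (hf ℓ hℓ).1) (fun ℓ hℓ ℓ' hℓ' e => by
        have h1 := (hf ℓ hℓ).2
        have h2 := (hf ℓ' hℓ').2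
        rw [e, h2] at h1
        exact_mod_cast h1.symm)
    simp at this
  rw [mem_Icc] at hℓ
  have below : ∀ w, AboveBelow n L R A ℓ w → R w → A 9 w ≤ ℓ := by
    rintro w (h | h) hR
    · exact (hLR w h.1 hR).elim
    · exact h.2
  have above : ∀ w, AboveBelow n L R A ℓ w → L w →
      (∀ v < n, A 10 v ≠ w) ∨ ∃ v < n, A 10 v = w ∧ (ℓ : ℤ) < A 9 v := by
    rintro w (h | h) hL
    · exact h.2
    · exact (hLR w hL h.1).elim
  refine ⟨ℓ, by omega, ?_, ?_⟩
  · intro u hu v hv hJu hJv huv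
    have h1 := below v hJv (hHLR u v huv).2
    rcases above u hJu (hHLR u v huv).1 with h | ⟨w, hw, e, hlt⟩
    -- As no bid is possible, an unmatched vertex has only neighbours of price above `n + 1`, hence
    -- above the level.
    · obtain ⟨x, hx, hmin⟩ := exists_min_image {x ∈ range n | H u x} (fun x => A 9 x)
        ⟨v, by simpa using ⟨hv, huv⟩⟩
      simp only [mem_filter, mem_range] at hx hmin
      have h2 : ¬ A 9 x ≤ n + 1 := fun h3 =>
        hstable u hu x hx.1 ⟨h, hx.2, h3, fun w hw huw => hmin w ⟨hw, huw⟩⟩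
      have := hmin v ⟨hv, huv⟩
      omega
    -- An owner paying more than `ℓ` has only neighbours of price at least `ℓ`, and the value `ℓ`
    -- itself does not occur.
    · rcases hA.owner w hw with h2 | ⟨u', -, e', -, -, h3⟩
      · omega
      · have : u' = u := by exact_mod_cast e'.symm.trans e
        subst this
        have := h3 v hv huv
        have := hgap v hv
        omega
  · intro Q hQ hind
    -- The matching injects the part of `Q` outside the level set into the part of the level set
    -- outside `Q`: a vertex missing from the level set is matched, its partner is in it, and by
    -- independence the partner is not in `Q`.
    rw [← card_sdiff_le_card_sdiff_iff]
    have hL : ∀ x ∈ Q, ¬ AboveBelow n L R A ℓ x → L x →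
        ∃ v < n, A 10 v = x ∧ A 9 v ≤ ℓ ∧ H x v := by
      intro x hx hn hLx
      have : ¬ ((∀ v < n, A 10 v ≠ x) ∨ ∃ v < n, A 10 v = x ∧ (ℓ : ℤ) < A 9 v) :=
        fun h => hn (Or.inl ⟨hLx, h⟩)
      push Not at this
      obtain ⟨⟨v, hv, e⟩, h⟩ := this
      refine ⟨v, hv, e, h v hv e, ?_⟩
      rcases hA.owner v hv with h2 | ⟨u', -, e', h3, -⟩
      · omega
      · have : u' = x := by exact_mod_cast e'.symm.trans e
        exact this ▸ h3
    have hR : ∀ x ∈ Q, ¬ AboveBelow n L R A ℓ x → R x →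
        ∃ u < n, A 10 x = (u : ℕ) ∧ (ℓ : ℤ) < A 9 x ∧ H u x := by
      intro x hx hn hRx
      have h1 : ¬ A 9 x ≤ ℓ := fun h => hn (Or.inr ⟨hRx, h⟩)
      rcases hA.owner x (hQ x hx).1 with h2 | ⟨u, hu, e, h3, -⟩
      · omega
      · exact ⟨u, hu, e, by omega, h3⟩
    have hf : ∀ x, ∃ y, x ∈ Q → ¬ AboveBelow n L R A ℓ x → y < n ∧
        ((L x ∧ A 10 y = x ∧ A 9 y ≤ ℓ ∧ H x y) ∨ (R x ∧ A 10 x = y ∧ (ℓ : ℤ) < A 9 x ∧ H y x)) := by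
      intro x
      by_cases hx : x ∈ Q ∧ ¬ AboveBelow n L R A ℓ x
      · rcases (hQ x hx.1).2 with h | h
        · obtain ⟨v, hv, e⟩ := hL x hx.1 hx.2 h
          exact ⟨v, fun _ _ => ⟨hv, Or.inl ⟨h, e⟩⟩⟩
        · obtain ⟨v, hv, e⟩ := hR x hx.1 hx.2 h
          exact ⟨v, fun _ _ => ⟨hv, Or.inr ⟨h, e⟩⟩⟩
      · exact ⟨0, fun h h' => absurd ⟨h, h'⟩ hx⟩
    choose f hf using hf
    refine card_le_card_of_injOn f ?_ ?_
    · intro x hx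
      simp only [mem_coe, mem_sdiff, mem_filter, mem_range, not_and] at hx ⊢
      have hn := hx.2 (hQ x hx.1).1
      obtain ⟨h1, ⟨h2, h3, h4, h5⟩ | ⟨h2, h3, h4, h5⟩⟩ := hf x hx.1 hn
      · exact ⟨⟨h1, Or.inr ⟨(hHLR _ _ h5).2, h4⟩⟩, fun h => hind _ hx.1 _ h h5⟩
      · exact ⟨⟨h1, Or.inl ⟨(hHLR _ _ h5).1, Or.inr ⟨x, (hQ x hx.1).1, h3, h4⟩⟩⟩,
          fun h => hind _ h _ hx.1 h5⟩
    · intro x hx y hy e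
      simp only [mem_coe, mem_sdiff, mem_filter, mem_range, not_and] at hx hy
      have hx' := (hQ x hx.1).1
      have hy' := (hQ y hy.1).1
      obtain ⟨-, ⟨h2, h3, h4, h5⟩ | ⟨h2, h3, h4, h5⟩⟩ := hf x hx.1 (hx.2 hx') <;>
      obtain ⟨-, ⟨k2, k3, k4, k5⟩ | ⟨k2, k3, k4, k5⟩⟩ := hf y hy.1 (hy.2 hy')
      · rw [e, k3] at h3
        exact_mod_cast h3.symm
      · rw [e] at h5
        exact (hLR _ (hHLR _ _ k5).1 (hHLR _ _ h5).2).elim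
      · rw [e] at h5
        exact (hLR _ (hHLR _ _ h5).1 (hHLR _ _ k5).2).elim
      · by_contra hne
        have := hA.inj x hx' y hy' hne (by rw [h3, k3, e])
        omega

end Auction

end RAM

open Corners

namespace RAM

/-! ### Implementation on the machine -/

section Programs

variable {Γ : Type} {c : Ctx Γ}

/-- The corners of the path of vertex `w`, in the arrays from 0 to 7. -/
def memCorners (A : Mem) (w : ℕ) : Corners := fun j o => A (2 * j.val + o.toNat) w

theorem memCorners_congr {A B : Mem} (h : ∀ a < 8, A a = B a) : memCorners A = memCorners B := by
  funext w j o
  have : 2 * j.val + o.toNat < 8 := by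
    have := j.isLt
    cases o <;> simp <;> omega
  rw [memCorners, memCorners, h _ this]

theorem Computes.corner {u : Γ → ℕ} (hu : Computes c fun γ _ => (u γ : ℤ)) (j : Fin 4) (o : Bool) :
    Computes c fun γ A => memCorners A (u γ) j o :=
  hu.load _

theorem Decides.seg {u : Γ → ℕ} (hu : Computes c fun γ _ => (u γ : ℤ)) (o : Bool) (i j : Fin 4) :
    Decides c fun γ A => Seg (memCorners A (u γ)) o i j :=
  (Decides.const _).and ((Decides.eq (hu.corner _ _) (hu.corner _ _)).and
    (Decides.lt (hu.corner _ _) (hu.corner _ _)))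

/-- The quantifier over the line is eliminated, since the line is that of a segment of the first
path; the remaining quantifiers have finite ranges. -/
theorem Decides.share {u v : Γ → ℕ} (hu : Computes c fun γ _ => (u γ : ℤ))
    (hv : Computes c fun γ _ => (v γ : ℤ)) :
    Decides c fun γ A => Share (memCorners A (u γ)) (memCorners A (v γ)) := by
  have key : Decides c fun γ A => ∃ o i j k l, Seg (memCorners A (u γ)) o i j ∧
      Seg (memCorners A (v γ)) o k l ∧ memCorners A (v γ) k (!o) = memCorners A (u γ) i (!o) ∧
      memCorners A (u γ) i o < memCorners A (v γ) l o ∧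
      memCorners A (v γ) k o < memCorners A (u γ) j o :=
    .exists_fintype fun o => .exists_fintype fun i => .exists_fintype fun j =>
      .exists_fintype fun k => .exists_fintype fun l => (Decides.seg hu o i j).and
        ((Decides.seg hv o k l).and ((Decides.eq (hv.corner _ _) (hu.corner _ _)).and
          ((Decides.lt (hu.corner _ _) (hv.corner _ _)).and
            (Decides.lt (hv.corner _ _) (hu.corner _ _)))))
  refine key.congr fun γ A => ⟨?_, ?_⟩
  · rintro ⟨o, i, j, k, l, h1, h2, h3, h4⟩
    exact ⟨o, _, i, j, k, l, h1, h2, rfl, h3, h4⟩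
  · rintro ⟨o, a, i, j, k, l, h1, h2, rfl, h3, h4⟩
    exact ⟨o, i, j, k, l, h1, h2, h3, h4⟩

theorem Decides.cmp_eq {τ σ : Γ → Mem → ℤ} (hτ : Computes c τ) (hσ : Computes c σ) (r : Ordering) :
    Decides c fun γ A => cmp (τ γ A) (σ γ A) = r := by
  cases r with
  | lt => exact (Decides.lt hτ hσ).congr fun γ A => (cmp_eq_lt_iff _ _).symm
  | eq => exact (Decides.eq hτ hσ).congr fun γ A => (cmp_eq_eq_iff _ _).symm
  | gt => exact (Decides.lt hσ hτ).congr fun γ A => (cmp_eq_gt_iff _ _).symm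

/-- The set `S` belongs to the program text, so membership is a finite disjunction over its
elements. -/
theorem Decides.pattern_mem {m : ℕ} {f : Γ → Fin m → ℕ} {u : Γ → ℕ}
    (hf : ∀ k, Computes c fun γ _ => (f γ k : ℤ)) (hu : Computes c fun γ _ => (u γ : ℤ))
    (S : Set (Pattern m)) :
    Decides c fun γ A => pattern (memCorners A) (f γ) (u γ) ∈ S := by
  have key : Decides c fun γ A => ∃ τ : Pattern m, τ ∈ S ∧
      (∀ i o j o', cmp (memCorners A (u γ) i o) (memCorners A (u γ) j o') = τ.1 i o j o') ∧
      ∀ k i o j o', cmp (memCorners A (u γ) i o) (memCorners A (f γ k) j o') = τ.2 k i o j o' :=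
    .exists_fintype fun τ => (Decides.const _).and (.and
      (.forall_fintype fun i => .forall_fintype fun o => .forall_fintype fun j =>
        .forall_fintype fun o' => .cmp_eq (hu.corner _ _) (hu.corner _ _) _)
      (.forall_fintype fun k => .forall_fintype fun i => .forall_fintype fun o =>
        .forall_fintype fun j => .forall_fintype fun o' =>
          .cmp_eq (hu.corner _ _) ((hf k).corner _ _) _))
  refine key.congr fun γ A => ⟨?_, fun h => ⟨_, h, fun _ _ _ _ => rfl, fun _ _ _ _ _ => rfl⟩⟩
  rintro ⟨τ, hτ, h1, h2⟩
  have : pattern (memCorners A) (f γ) (u γ) = τ := by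
    refine Prod.ext ?_ ?_
    · funext i o j o'
      exact h1 i o j o'
    · funext k i o j o'
      exact h2 k i o j o'
  rwa [this]

theorem Transforms.auction {H : Γ → Mem → ℕ → ℕ → Prop}
    (hH : Decides c.ext.ext fun γ A => H γ.1.1 A γ.1.2 γ.2) :
    Transforms c fun γ => RAM.auction (c.size γ) (H γ) := by
  have hbid : Transforms c.ext.ext fun γ => bid (c.size γ.1.1) (H γ.1.1) γ.1.2 γ.2 := by
    have hnot : Decides c.ext.ext fun γ A => ∀ w < c.size γ.1.1, A 10 w ≠ (γ.1.2 : ℕ) :=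
      .forall_lt (c := c.ext.ext) (φ := fun γ A => A 10 γ.2 ≠ (γ.1.1.2 : ℕ))
        (Decides.eq (Computes.last.load 10) Computes.last.ext.ext).not
    have hmin : Decides c.ext.ext fun γ A =>
        ∀ w < c.size γ.1.1, H γ.1.1 A γ.1.2 w → A 9 γ.2 ≤ A 9 w := by
      refine .forall_lt (c := c.ext.ext)
        (φ := fun γ A => H γ.1.1.1 A γ.1.1.2 γ.2 → A 9 γ.1.2 ≤ A 9 γ.2) (.imp ?_
        (.le (Computes.last.ext.load 9) (Computes.last.load 9)))
      refine hH.comap (fun γ : ((Γ × ℕ) × ℕ) × ℕ => (γ.1.1, γ.2)) (fun _ => rfl) fun v hv => ?_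
      simp only [Ctx.ext, List.map_cons, List.map_map, List.mem_cons, List.mem_map,
        Function.comp_def] at hv ⊢
      rcases hv with rfl | rfl | ⟨w, hw, rfl⟩
      · exact Or.inl rfl
      · exact Or.inr (Or.inr (Or.inl rfl))
      · exact Or.inr (Or.inr (Or.inr ⟨w, hw, rfl⟩))
    refine Transforms.ite (φ := fun (γ : (Γ × ℕ) × ℕ) A => CanBid (c.size γ.1.1) (H γ.1.1) γ.1.2 γ.2 A)
      (hnot.and (hH.and (.and (.le (Computes.last.load 9)
        (Computes.size.ext.ext.add (.const 1))) hmin))) ?_ .id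
    exact ((Transforms.store 10 Computes.last Computes.last.ext).comp
      (.store 9 Computes.last ((Computes.last.load 9).add (.const 1)))).congr fun γ A => by
        simp [write]
  -- The two outer loops only count rounds; the change of context forgets their variables.
  exact .loop 2 (.loop 2 (.loop (c := c.ext.ext) 0 (.loop (c := c.ext.ext.ext) 0
    (hbid.comap (fun γ : (((Γ × ℕ) × ℕ) × ℕ) × ℕ => ((γ.1.1.1.1, γ.1.2), γ.2)) (fun _ => rfl)
    fun v hv => by
      simp only [Ctx.ext, List.map_cons, List.map_map, List.mem_cons, List.mem_map,
        Function.comp_def] at hv ⊢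
      rcases hv with rfl | rfl | ⟨w, hw, rfl⟩
      · exact Or.inl rfl
      · exact Or.inr (Or.inl rfl)
      · exact Or.inr (Or.inr (Or.inr (Or.inr ⟨w, hw, rfl⟩)))))))

theorem Decides.aboveBelow {L R : Γ → Mem → ℕ → Prop}
    (hL : Decides c.ext fun γ A => L γ.1 A γ.2) (hR : Decides c.ext fun γ A => R γ.1 A γ.2) :
    Decides c.ext.ext fun γ A =>
      AboveBelow (c.size γ.1.1) (L γ.1.1 A) (R γ.1.1 A) A γ.1.2 γ.2 := by
  have hg : ∀ {φ : Γ → Mem → ℕ → Prop}, Decides c.ext (fun γ A => φ γ.1 A γ.2) →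
      Decides c.ext.ext fun γ A => φ γ.1.1 A γ.2 := by
    intro φ h
    refine h.comap (fun γ : (Γ × ℕ) × ℕ => (γ.1.1, γ.2)) (fun _ => rfl) fun v hv => ?_
    simp only [Ctx.ext, List.map_cons, List.map_map, List.mem_cons, List.mem_map,
      Function.comp_def] at hv ⊢
    rcases hv with rfl | ⟨w, hw, rfl⟩
    · exact Or.inl rfl
    · exact Or.inr (Or.inr ⟨w, hw, rfl⟩)
  have h1 : Decides c.ext.ext fun γ A => ∀ v < c.size γ.1.1, A 10 v ≠ (γ.2 : ℕ) :=
    .forall_lt (c := c.ext.ext) (φ := fun γ A => A 10 γ.2 ≠ (γ.1.2 : ℕ))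
      (Decides.eq (Computes.last.load 10) Computes.last.ext).not
  have h2 : Decides c.ext.ext fun γ A => ∃ v < c.size γ.1.1, A 10 v = (γ.2 : ℕ) ∧
      ((γ.1.2 : ℕ) : ℤ) < A 9 v :=
    .exists_lt (c := c.ext.ext) (φ := fun γ A => A 10 γ.2 = (γ.1.2 : ℕ) ∧
      ((γ.1.1.2 : ℕ) : ℤ) < A 9 γ.2)
      ((Decides.eq (Computes.last.load 10) Computes.last.ext).and
        (.lt Computes.last.ext.ext (Computes.last.load 9)))
  exact ((hg hL).and (h1.or h2)).or
    ((hg hR).and (.le (Computes.last.load 9) Computes.last.ext))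

/-- The entries 1 of an array mark a clique. -/
def MarksClique (n : ℕ) (a : ℕ) (A : Mem) : Prop :=
  ∀ u < n, ∀ v < n, A a u = 1 ∧ A a v = 1 → u ≠ v → Share (memCorners A u) (memCorners A v)

open Classical in
/-- The number of the entries 1 of an array. -/
noncomputable def markCount (n : ℕ) (a : ℕ) (A : Mem) : ℕ :=
  ((Finset.range n).filter fun w : ℕ => A a w = 1).card

theorem Decides.marksClique (a : ℕ) : Decides c fun γ A => MarksClique (c.size γ) a A := by
  refine .forall_lt (φ := fun γ A => ∀ v < c.size γ.1, A a γ.2 = 1 ∧ A a v = 1 → γ.2 ≠ v →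
    Share (memCorners A γ.2) (memCorners A v)) (.forall_lt (c := c.ext) (φ := fun γ A =>
    A a γ.1.2 = 1 ∧ A a γ.2 = 1 → γ.1.2 ≠ γ.2 →
    Share (memCorners A γ.1.2) (memCorners A γ.2)) ?_)
  refine (((Decides.eq (Computes.last.ext.load a) (.const 1)).and
    (.eq (Computes.last.load a) (.const 1))).imp (.imp (.not ?_)
      (.share Computes.last.ext Computes.last)))
  exact (Decides.eq Computes.last.ext Computes.last).congr fun γ A => by simp

theorem Computes.markCount (a : ℕ) :
    Computes c fun γ A => (RAM.markCount (c.size γ) a A : ℤ) :=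
  (Computes.count (φ := fun γ A => A a γ.2 = 1) (.eq (Computes.last.load a) (.const 1))).congr
    fun γ A => by unfold RAM.markCount; congr!

open Classical in
/-- Array 11 marks the set of a level, and array 8 is replaced by it if it is a larger clique. -/
noncomputable def select (n : ℕ) (L R : Mem → ℕ → Prop) (ℓ : ℕ) (A : Mem) : Mem :=
  let B := iter (fun w B => write B 11 w (if AboveBelow n (L B) (R B) B ℓ w then 1 else 0)) n A
  if MarksClique n 11 B ∧ (markCount n 8 B : ℤ) < markCount n 11 B then
    iter (fun w B => write B 8 w (B 11 w)) n B
  else B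

open Classical in
theorem Transforms.select {L R : Γ → Mem → ℕ → Prop}
    (hL : Decides c.ext fun γ A => L γ.1 A γ.2) (hR : Decides c.ext fun γ A => R γ.1 A γ.2) :
    Transforms c.ext fun γ => RAM.select (c.size γ.1) (L γ.1) (R γ.1) γ.2 := by
  have h1 : Transforms c.ext fun γ => iter (fun w B => write B 11 w
      (if AboveBelow (c.size γ.1) (L γ.1 B) (R γ.1 B) B γ.2 w then 1 else 0)) (c.size γ.1) :=
    .loop (c := c.ext) 0 (F := fun γ B => write B 11 γ.2
      (if AboveBelow (c.size γ.1.1) (L γ.1.1 B) (R γ.1.1 B) B γ.1.2 γ.2 then 1 else 0))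
      (.store 11 Computes.last (Decides.aboveBelow hL hR))
  have h2 : Decides c.ext fun γ B => MarksClique (c.size γ.1) 11 B ∧
      (RAM.markCount (c.size γ.1) 8 B : ℤ) < RAM.markCount (c.size γ.1) 11 B :=
    (Decides.marksClique (c := c.ext) 11).and
      (.lt (Computes.markCount (c := c.ext) 8) (Computes.markCount (c := c.ext) 11))
  have h3 : Transforms c.ext fun γ => iter (fun w B => write B 8 w (B 11 w)) (c.size γ.1) :=
    .loop (c := c.ext) 0 (.store 8 Computes.last (Computes.last.load 11))
  exact (h1.comp (.ite h2 h3 .id)).congr fun γ A => by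
    unfold RAM.select
    dsimp only
    congr!

/-- The improvement of the best clique in array 8 by the vertices of the sides `L` and `R`. -/
noncomputable def improve (n : ℕ) (L R : Mem → ℕ → Prop) (A : Mem) : Mem :=
  iter (fun ℓ => select n L R ℓ) (n + 2)
    (auction n (fun A u v => L A u ∧ R A v ∧ ¬ Share (memCorners A u) (memCorners A v))
      (iter (fun w B => write B 10 w (-1)) n (iter (fun w B => write B 9 w 0) n A)))

theorem Transforms.improve {L R : Γ → Mem → ℕ → Prop}
    (hL : Decides c.ext fun γ A => L γ.1 A γ.2) (hR : Decides c.ext fun γ A => R γ.1 A γ.2) :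
    Transforms c fun γ => RAM.improve (c.size γ) (L γ) (R γ) := by
  have h1 : Transforms c fun γ => iter (fun w B => write B 9 w 0) (c.size γ) :=
    .loop 0 (.store 9 Computes.last (.const 0))
  have h2 : Transforms c fun γ => iter (fun w B => write B 10 w (-1)) (c.size γ) :=
    .loop 0 (.store 10 Computes.last (.const (-1)))
  have h3 : Transforms c fun γ => RAM.auction (c.size γ) fun A u v =>
      L γ A u ∧ R γ A v ∧ ¬ Share (memCorners A u) (memCorners A v) := by
    refine .auction (H := fun γ A u v => L γ A u ∧ R γ A v ∧
      ¬ Share (memCorners A u) (memCorners A v)) ?_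
    refine .and hL.ext (.and ?_ (Decides.share Computes.last.ext Computes.last).not)
    refine hR.comap (fun γ : (Γ × ℕ) × ℕ => (γ.1.1, γ.2)) (fun _ => rfl) fun v hv => ?_
    simp only [Ctx.ext, List.map_cons, List.map_map, List.mem_cons, List.mem_map,
      Function.comp_def] at hv ⊢
    rcases hv with rfl | ⟨w, hw, rfl⟩
    · exact Or.inl rfl
    · exact Or.inr (Or.inr ⟨w, hw, rfl⟩)
  have h4 : Transforms c fun γ => iter (fun ℓ => RAM.select (c.size γ) (L γ) (R γ) ℓ)
      (c.size γ + 2) := .loop 2 (.select hL hR)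
  exact ((h1.comp h2).comp h3).comp h4

/-- The vertices with a pattern in `S`. -/
def InPatterns {m : ℕ} (S : Set (Pattern m)) (K : Fin m → ℕ) (A : Mem) (w : ℕ) : Prop :=
  pattern (memCorners A) K w ∈ S

instance {m : ℕ} : Finite (Set (Pattern m)) :=
  inferInstanceAs (Finite (Pattern m → Prop))

/-- All pairs of sets of patterns. -/
noncomputable def patternPairs (m : ℕ) : List (Set (Pattern m) × Set (Pattern m)) :=
  (@Finset.univ _ (Fintype.ofFinite _)).toList

/-- The algorithm. -/
noncomputable def cliqueAlgorithm (m n : ℕ) (A : Mem) : Mem :=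
  -- The difference `p.2 \ p.1` makes the sides of the bipartite graph disjoint. Marking cell 0
  -- initially supplies a clique with one vertex when `n` is positive.
  iterTuple n m (fun K A => (patternPairs m).foldl (fun A p =>
    improve n (InPatterns p.1 K) (InPatterns (p.2 \ p.1) K) A) A) (write A 8 0 1)

theorem Transforms.cliqueAlgorithm (m : ℕ) :
    Transforms ⟨fun n : ℕ => n, []⟩ (RAM.cliqueAlgorithm m) := by
  have hp : ∀ S : Set (Pattern m), Decides (Ctx.extTuple ⟨fun n : ℕ => n, []⟩ m).ext
      fun γ A => InPatterns S γ.1.2 A γ.2 := by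
    intro S
    refine Decides.pattern_mem (f := fun γ : (ℕ × (Fin m → ℕ)) × ℕ => γ.1.2) (fun k => ?_)
      Computes.last S
    refine Computes.ext (τ := fun (γ : ℕ × (Fin m → ℕ)) _ => (γ.2 k : ℤ)) (Computes.var ?_)
    simp [Ctx.extTuple]
  have h : Transforms (Ctx.extTuple ⟨fun n : ℕ => n, []⟩ m) fun γ A =>
      (patternPairs m).foldl (fun A p =>
        RAM.improve γ.1 (InPatterns p.1 γ.2) (InPatterns (p.2 \ p.1) γ.2) A) A :=
    .foldl _ fun p => Transforms.improve (c := Ctx.extTuple ⟨fun n : ℕ => n, []⟩ m)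
      (L := fun γ => InPatterns p.1 γ.2) (R := fun γ => InPatterns (p.2 \ p.1) γ.2) (hp _) (hp _)
  exact (Transforms.store 8 (.const 0) (.const 1)).comp h.loopTuple

end Programs

end RAM

open Corners

namespace RAM

/-! ### Correctness of the algorithm -/

section Correctness

/-- The values written do not depend on the array being overwritten, so all of them can be read off
the initial memory. -/
theorem iter_write {a n : ℕ} {val : ℕ → Mem → ℤ}
    (h : ∀ w A B, (∀ b ≠ a, A b = B b) → val w A = val w B) (A : Mem) :
    (∀ b ≠ a, iter (fun w A => write A a w (val w A)) n A b = A b) ∧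
      ∀ w < n, iter (fun w A => write A a w (val w A)) n A a w = val w A := by
  induction n with
  | zero => exact ⟨fun _ _ => rfl, fun w hw => absurd hw (Nat.not_lt_zero w)⟩
  | succ n ih =>
    refine ⟨fun b hb => ?_, fun w hw => ?_⟩
    · rw [iter, write_of_ne_array _ hb, ih.1 b hb]
    · rw [iter]
      by_cases hwn : w = n
      · subst hwn
        rw [write_self, h w _ A ih.1]
      · rw [write_of_ne _ _ (by exact_mod_cast hwn), ih.2 w (by omega)]

theorem marksClique_congr {n a b : ℕ} {A B : Mem} (h : ∀ a < 8, A a = B a)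
    (hab : ∀ w < n, A a (w : ℕ) = B b (w : ℕ)) : MarksClique n a A ↔ MarksClique n b B := by
  unfold MarksClique
  rw [memCorners_congr h]
  refine forall₂_congr fun u hu => forall₂_congr fun v hv => ?_
  rw [hab u hu, hab v hv]

theorem markCount_congr {n a b : ℕ} {A B : Mem} (hab : ∀ w < n, A a (w : ℕ) = B b (w : ℕ)) :
    markCount n a A = markCount n b B := by
  unfold markCount
  congr 1
  refine Finset.filter_congr fun w hw => ?_
  rw [hab w (Finset.mem_range.1 hw)]

/-- The input is preserved, and array 8 is the indicator function of a clique. -/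
structure Good (n : ℕ) (A₀ A : Mem) : Prop where
  agree : ∀ a < 8, A a = A₀ a
  indicator : ∀ w < n, A 8 (w : ℕ) = 0 ∨ A 8 (w : ℕ) = 1
  clique : MarksClique n 8 A

theorem Good.of_eq {n : ℕ} {A₀ A B : Mem} (hA : Good n A₀ A) (h : ∀ a < 9, B a = A a) :
    Good n A₀ B where
  agree a ha := (h a (by omega)).trans (hA.agree a ha)
  indicator w hw := by rw [h 8 (by omega)]; exact hA.indicator w hw
  clique := (marksClique_congr (fun a ha => h a (by omega))
    fun w _ => by rw [h 8 (by omega)]).2 hA.clique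

variable {n : ℕ} {A₀ A : Mem} {L R : Mem → ℕ → Prop}

open Classical in
-- Prices and owners are left intact, so that the next level is tested on the result of the same
-- auction, and the best clique never gets smaller.
theorem Good.select (hA : Good n A₀ A) (hL : ∀ A B : Mem, (∀ a < 8, A a = B a) → L A = L B)
    (hR : ∀ A B : Mem, (∀ a < 8, A a = B a) → R A = R B) (ℓ : ℕ) :
    Good n A₀ (select n L R ℓ A) ∧
      (RAM.select n L R ℓ A 9 = A 9 ∧ RAM.select n L R ℓ A 10 = A 10) ∧
      markCount n 8 A ≤ markCount n 8 (RAM.select n L R ℓ A) ∧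
      ((∀ u < n, ∀ v < n, AboveBelow n (L A) (R A) A ℓ u → AboveBelow n (L A) (R A) A ℓ v →
        Share (memCorners A u) (memCorners A v)) →
        ((Finset.range n).filter fun w => AboveBelow n (L A) (R A) A ℓ w).card ≤
          markCount n 8 (RAM.select n L R ℓ A)) := by
  unfold RAM.select
  obtain ⟨h1, h2⟩ := iter_write (n := n) (a := 11)
    (val := fun w B => if AboveBelow n (L B) (R B) B ℓ w then 1 else 0) (by
      intro w A B h
      unfold AboveBelow
      rw [hL A B fun a ha => h a (by omega), hR A B fun a ha => h a (by omega), h 9 (by decide),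
        h 10 (by decide)]) A
  dsimp only at h2 ⊢
  generalize hB : iter (fun w B => write B 11 (w : ℕ)
    (if AboveBelow n (L B) (R B) B ℓ w then 1 else 0)) n A = B at *
  have hBgood : Good n A₀ B := hA.of_eq fun a ha => h1 a (by omega)
  have hcount : markCount n 8 B = markCount n 8 A := markCount_congr fun w _ => by
    rw [h1 8 (by decide)]
  have hcard : ((Finset.range n).filter fun w => AboveBelow n (L A) (R A) A ℓ w).card =
      markCount n 11 B := by
    unfold markCount
    congr 1
    refine Finset.filter_congr fun w hw => ?_
    rw [h2 w (Finset.mem_range.1 hw)]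
    split_ifs with h <;> simp [h]
  have hmarks : (∀ u < n, ∀ v < n, AboveBelow n (L A) (R A) A ℓ u →
      AboveBelow n (L A) (R A) A ℓ v → Share (memCorners A u) (memCorners A v)) →
      MarksClique n 11 B := by
    intro h u hu v hv huv _
    rw [h2 u hu, h2 v hv] at huv
    rw [memCorners_congr fun a ha => h1 a (by omega)]
    exact h u hu v hv (by simpa using huv.1) (by simpa using huv.2)
  split_ifs with hc
  · obtain ⟨k1, k2⟩ := iter_write (n := n) (a := 8) (val := fun w B => B 11 (w : ℕ))
      (fun w A B h => by rw [h 11 (by decide)]) B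
    generalize iter (fun w B => write B 8 (w : ℕ) (B 11 (w : ℕ))) n B = D at *
    have hD : markCount n 8 D = markCount n 11 B := markCount_congr k2
    refine ⟨⟨fun a ha => (k1 a (by omega)).trans (hBgood.agree a ha), fun w hw => ?_, ?_⟩,
      ⟨?_, ?_⟩, ?_, fun _ => ?_⟩
    · rw [k2 w hw, h2 w hw]
      split_ifs <;> simp
    · exact (marksClique_congr (fun a ha => k1 a (by omega)) k2).2 hc.1
    · rw [k1 9 (by decide), h1 9 (by decide)]
    · rw [k1 10 (by decide), h1 10 (by decide)]
    · have := hc.2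
      omega
    · rw [hcard, hD]
  · refine ⟨hBgood, ⟨h1 9 (by decide), h1 10 (by decide)⟩, hcount.ge, fun h => ?_⟩
    rw [hcard]
    by_contra hlt
    exact hc ⟨hmarks h, by omega⟩

open Classical in
-- The first two clauses hold for arbitrary sides. If both sides are cliques, then cliques and
-- independent sets of the auction graph agree, and the level of `AuctionInv.exists_level` gives the
-- bound.
theorem Good.improve (hA : Good n A₀ A) (hL : ∀ A B : Mem, (∀ a < 8, A a = B a) → L A = L B)
    (hR : ∀ A B : Mem, (∀ a < 8, A a = B a) → R A = R B) :
    Good n A₀ (improve n L R A) ∧ markCount n 8 A ≤ markCount n 8 (RAM.improve n L R A) ∧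
      ((∀ w, L A₀ w → R A₀ w → False) →
        (∀ u < n, ∀ v < n, L A₀ u → L A₀ v → Share (memCorners A₀ u) (memCorners A₀ v)) →
        (∀ u < n, ∀ v < n, R A₀ u → R A₀ v → Share (memCorners A₀ u) (memCorners A₀ v)) →
        ∀ Q : Finset ℕ, (∀ w ∈ Q, w < n ∧ (L A₀ w ∨ R A₀ w)) →
          (∀ u ∈ Q, ∀ v ∈ Q, Share (memCorners A₀ u) (memCorners A₀ v)) →
          Q.card ≤ markCount n 8 (RAM.improve n L R A)) := by
  unfold RAM.improve
  obtain ⟨h1, h2⟩ := iter_write (n := n) (a := 9) (val := fun _ _ => 0) (fun _ _ _ _ => rfl) A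
  generalize iter (fun w B => write B 9 (w : ℕ) 0) n A = A₁ at *
  obtain ⟨k1, k2⟩ := iter_write (n := n) (a := 10) (val := fun _ _ => -1) (fun _ _ _ _ => rfl) A₁
  generalize iter (fun w B => write B 10 (w : ℕ) (-1)) n A₁ = A₂ at *
  have p2 : ∀ w < n, A₂ 9 (w : ℕ) = 0 := fun w hw => by rw [k1 9 (by decide), h2 w hw]
  have hA₂ : ∀ a < 9, A₂ a = A a := fun a ha => by rw [k1 a (by omega), h1 a (by omega)]
  set H : Mem → ℕ → ℕ → Prop :=
    fun A u v => L A u ∧ R A v ∧ ¬ Share (memCorners A u) (memCorners A v) with hHdef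
  have hH : ∀ A B : Mem, (∀ a < 9, A a = B a) → H A = H B := by
    intro A B h
    have h' : ∀ a < 8, A a = B a := fun a ha => h a (by omega)
    rw [hHdef]
    dsimp only
    rw [hL A B h', hR A B h', memCorners_congr h']
  have inv : AuctionInv n (H A₂) A₂ A₂ := by
    refine ⟨fun _ _ => rfl, fun v hv => (p2 v hv).ge, fun v hv => ?_,
      fun v hv => Or.inl ⟨k2 v hv, p2 v hv⟩, fun v hv _ _ _ _ => k2 v hv⟩
    rw [p2 v hv]
    positivity
  obtain ⟨inv', stable⟩ := inv.auction hH
  generalize auction n H A₂ = A₃ at *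
  have hA₃ : ∀ a < 9, A₃ a = A a := fun a ha => (inv'.agree a ha).trans (hA₂ a ha)
  have hgood : Good n A₀ A₃ := hA.of_eq hA₃
  have hcount : markCount n 8 A₃ = markCount n 8 A := markCount_congr fun w _ => by
    rw [hA₃ 8 (by decide)]
  refine ⟨iter_induction (I := Good n A₀) (fun ℓ _ B hB => (hB.select hL hR ℓ).1) hgood, ?_, ?_⟩
  · rw [← hcount]
    exact (iter_induction (I := fun B => Good n A₀ B ∧ markCount n 8 A₃ ≤ markCount n 8 B)
      (fun ℓ _ B hB => ⟨(hB.1.select hL hR ℓ).1, hB.2.trans (hB.1.select hL hR ℓ).2.2.1⟩)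
      ⟨hgood, le_rfl⟩).2
  · intro hLR hLL hRR Q hQ hQQ
    have e₂ : ∀ a < 8, A₂ a = A₀ a := fun a ha => (hA₂ a (by omega)).trans (hA.agree a ha)
    have eH : H A₂ = fun u v =>
        L A₀ u ∧ R A₀ v ∧ ¬ Share (memCorners A₀ u) (memCorners A₀ v) := by
      rw [hHdef]
      dsimp only
      rw [hL A₂ A₀ e₂, hR A₂ A₀ e₂, memCorners_congr e₂]
    have stable' : ∀ u < n, ∀ v < n, ¬ CanBid n (fun _ => H A₂) u v A₃ := by
      intro u hu v hv hc
      refine stable u hu v hv ?_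
      unfold CanBid at hc ⊢
      rwa [hH A₃ A₂ inv'.agree]
    obtain ⟨ℓ, hℓ, q1, q2⟩ := inv'.exists_level hLR
      (fun u v h => by rw [eH] at h; exact ⟨h.1, h.2.1⟩) stable'
    refine (q2 Q hQ fun u hu v hv h => ?_).trans ?_
    · rw [eH] at h
      exact h.2.2 (hQQ u hu v hv)
    -- When level `ℓ` is tested, prices and owners are still those at the end of the auction; later
    -- levels do not decrease the count.
    refine iter_establish (I := fun B => Good n A₀ B ∧ B 9 = A₃ 9 ∧ B 10 = A₃ 10)
      (Q := fun B => ((Finset.range n).filter fun w =>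
        AboveBelow n (L A₀) (R A₀) A₃ ℓ w).card ≤ markCount n 8 B) ?_ ?_ hℓ ?_
      ⟨hgood, rfl, rfl⟩
    · intro i _ B hB
      have := hB.1.select hL hR i
      exact ⟨this.1, this.2.1.1.trans hB.2.1, this.2.1.2.trans hB.2.2⟩
    · exact fun i _ B hB hc => hc.trans (hB.1.select hL hR i).2.2.1
    · intro B hB
      have hs := (hB.1.select hL hR ℓ).2.2.2
      have eA : ∀ w, AboveBelow n (L B) (R B) B ℓ w ↔ AboveBelow n (L A₀) (R A₀) A₃ ℓ w := by
        intro w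
        unfold AboveBelow
        rw [hL B A₀ hB.1.agree, hR B A₀ hB.1.agree, hB.2.1, hB.2.2]
      simp only [eA, memCorners_congr hB.1.agree] at hs
      refine hs fun u hu v hv a b => ?_
      have hn := q1 u hu v hv a b
      have hn' := q1 v hv u hu b a
      rw [eH] at hn hn'
      have side : ∀ {w}, AboveBelow n (L A₀) (R A₀) A₃ ℓ w → L A₀ w ∨ R A₀ w :=
        fun h => h.imp (fun h => h.1) fun h => h.1
      rcases side a with a | a <;> rcases side b with b | b
      · exact hLL u hu v hv a b
      · exact not_not.1 fun h => hn ⟨a, b, h⟩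
      · exact not_not.1 fun h => hn' ⟨b, a, fun h' => h h'.symm⟩
      · exact hRR u hu v hv a b

theorem inPatterns_congr {m : ℕ} (S : Set (Pattern m)) (K : Fin m → ℕ) (A B : Mem)
    (h : ∀ a < 8, A a = B a) : InPatterns S K A = InPatterns S K B := by
  funext w
  rw [InPatterns, InPatterns, memCorners_congr h]

theorem good_write {n : ℕ} (A : Mem) (hA : ∀ w < n, A 8 (w : ℕ) = 0) :
    Good n A (write A 8 0 1) := by
  have h0 : ∀ w : ℕ, w < n → write A 8 0 1 8 w = if w = 0 then 1 else 0 := by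
    intro w hw
    split_ifs with h
    · subst h
      exact write_self ..
    · rw [write_of_ne _ _ (by exact_mod_cast h), hA w hw]
  refine ⟨fun a ha => write_of_ne_array _ (by omega) _ _, fun w hw => ?_, ?_⟩
  · rw [h0 w hw]
    split_ifs <;> simp
  · intro u hu v hv huv hne
    rw [h0 u hu, h0 v hv] at huv
    simp at huv
    omega

/-- The iteration with the guess `K`, `S`, `T` establishes the bound, and all iterations, whatever
their guess, preserve it. -/
theorem cliqueAlgorithm_spec {m n : ℕ} {A : Mem} (hA : ∀ w < n, A 8 (w : ℕ) = 0) :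
    Good n A (cliqueAlgorithm m n A) ∧ (0 < n → 1 ≤ markCount n 8 (cliqueAlgorithm m n A)) ∧
      ∀ (K : Fin m → ℕ) (S T : Set (Pattern m)) (Q : Finset ℕ), (∀ k, K k < n) →
        (∀ u < n, ∀ v < n, InPatterns S K A u → InPatterns S K A v →
          Share (memCorners A u) (memCorners A v)) →
        (∀ u < n, ∀ v < n, InPatterns T K A u → InPatterns T K A v →
          Share (memCorners A u) (memCorners A v)) →
        (∀ w ∈ Q, w < n ∧ (InPatterns S K A w ∨ InPatterns T K A w)) →
        (∀ u ∈ Q, ∀ v ∈ Q, Share (memCorners A u) (memCorners A v)) →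
        Q.card ≤ markCount n 8 (cliqueAlgorithm m n A) := by
  have step : ∀ (K : Fin m → ℕ) (p : Set (Pattern m) × Set (Pattern m)) (B : Mem),
      Good n A B → Good n A (improve n (InPatterns p.1 K) (InPatterns (p.2 \ p.1) K) B) ∧ _ ∧ _ :=
    fun K p B hB => hB.improve (inPatterns_congr p.1 K) (inPatterns_congr (p.2 \ p.1) K)
  have good := good_write A hA
  have hgood : ∀ (K : Fin m → ℕ) (B : Mem), Good n A B → Good n A ((patternPairs m).foldl
      (fun A p => improve n (InPatterns p.1 K) (InPatterns (p.2 \ p.1) K) A) B) :=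
    fun K B hB => foldl_induction (I := Good n A) _ (fun p B hB => (step K p B hB).1) hB
  have hmono : ∀ (k : ℕ) (K : Fin m → ℕ) (B : Mem), Good n A B → k ≤ markCount n 8 B →
      k ≤ markCount n 8 ((patternPairs m).foldl
        (fun A p => improve n (InPatterns p.1 K) (InPatterns (p.2 \ p.1) K) A) B) :=
    fun k K B hB hk => (foldl_induction (I := fun B => Good n A B ∧ k ≤ markCount n 8 B) _
      (fun p B hB => ⟨(step K p B hB.1).1, hB.2.trans (step K p B hB.1).2.1⟩) ⟨hB, hk⟩).2
  refine ⟨iterTuple_induction (I := Good n A) (fun K _ B hB => hgood K B hB) good, fun hn => ?_,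
    fun K S T Q hK hS hT hQ hQQ => ?_⟩
  · refine (iterTuple_induction (I := fun B => Good n A B ∧ 1 ≤ markCount n 8 B)
      (fun K _ B hB => ⟨hgood K B hB.1, hmono 1 K B hB.1 hB.2⟩) ⟨good, ?_⟩).2
    refine Finset.card_pos.2 ⟨0, ?_⟩
    simp [hn, write]
  · refine iterTuple_establish (I := Good n A) (Q := fun B => Q.card ≤ markCount n 8 B)
      (fun K _ B hB => hgood K B hB) (fun K _ B hB h => hmono _ K B hB h) hK (fun B hB => ?_) good
    refine foldl_establish (I := Good n A) (Q := fun B => Q.card ≤ markCount n 8 B)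
      (fun p B hB => (step K p B hB).1) (fun p B hB h => h.trans (step K p B hB).2.1)
      (j := (S, T)) (by simp [patternPairs]) (fun B hB => ?_) hB
    refine (step K (S, T) B hB).2.2 (fun w h h' => h'.2 h) hS
      (fun u hu v hv h h' => hT u hu v hv h.1 h'.1) Q (fun w hw => ⟨(hQ w hw).1, ?_⟩) hQQ
    by_cases h : InPatterns S K A w
    · exact Or.inl h
    · exact Or.inr ⟨(hQ w hw).2.resolve_left h, h⟩

end Correctness

end RAM

/-! ### The input and the main theorem -/

open Corners RAM in
theorem EPGRep.memCorners_input {n : ℕ} {G : SimpleGraph (Fin n)} (R : EPGRep 2 G) (w : Fin n) :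
    memCorners R.input.arr (w : ℕ) = R.corners w := by
  funext j o
  have hj := j.isLt
  have hw := w.isLt
  have h : 2 * j.val + o.toNat < 8 ∧ (0 : ℤ) ≤ (w : ℕ) ∧ ((w : ℕ) : ℤ) < n := by
    refine ⟨?_, by omega, by omega⟩
    cases o <;> simp <;> omega
  simp only [memCorners, EPGRep.input, dif_pos h, EPGRep.corners, gridCoord, Int.toNat_natCast,
    Fin.eta]
  cases o
  · simp
  · have h1 : (2 * j.val + 1) / 2 = j.val := by omega
    simp [h1]

open Corners RAM in
theorem mainTheorem1 :
    ∃ (P : RAM.Prog) (q : Polynomial ℕ),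
      ∀ (n : ℕ) (G : SimpleGraph (Fin n)) (R : EPGRep 2 G),
        ∃ (t : ℕ) (s : RAM.State), RAM.Exec P R.input t s ∧ t ≤ q.eval n ∧
          ∃ C : Finset (Fin n), G.IsMaximumClique C ∧
            ∀ i : Fin n, s.arr 8 ((i : ℕ) : ℤ) = if i ∈ C then 1 else 0 := by
  classical
  obtain ⟨m, hm⟩ := exists_pattern_cover
  -- There are no variables, and register 0 holds the size, so the free registers begin at 1.
  obtain ⟨P, q, hP⟩ := Transforms.cliqueAlgorithm m (fun _ => 0) 1 one_pos (fun _ _ => one_pos)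
  refine ⟨P, q, fun n G R => ?_⟩
  obtain ⟨t, s, hexec, ht, -, hs⟩ := hP n R.input ⟨rfl, by simp⟩
  refine ⟨t, s, hexec, ht, ?_⟩
  have hA : ∀ w < n, R.input.arr 8 (w : ℕ) = 0 := fun w _ => by simp [EPGRep.input]
  obtain ⟨good, hpos, hmax⟩ := cliqueAlgorithm_spec (m := m) hA
  rw [← hs] at good hpos hmax
  have hcorners : ∀ w : Fin n, memCorners s.arr (w : ℕ) = R.corners w := fun w => by
    rw [memCorners_congr good.agree, R.memCorners_input]
  have hcount : markCount n 8 s.arr =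
      (Finset.univ.filter fun i : Fin n => s.arr 8 ((i : ℕ) : ℤ) = 1).card := by
    unfold markCount
    rw [← Finset.card_map Fin.valEmbedding]
    congr 1
    ext w
    simp only [Finset.mem_filter, Finset.mem_range, Finset.mem_map, Finset.mem_univ, true_and,
      Fin.valEmbedding_apply]
    exact ⟨fun h => ⟨⟨w, h.1⟩, h.2, rfl⟩, by rintro ⟨i, hi, rfl⟩; exact ⟨i.isLt, hi⟩⟩
  refine ⟨Finset.univ.filter fun i : Fin n => s.arr 8 ((i : ℕ) : ℤ) = 1, ⟨?_, fun C hC => ?_⟩,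
    fun i => ?_⟩
  · intro u hu v hv huv
    simp only [Finset.coe_filter, Finset.mem_univ, true_and, Set.mem_ofPred_eq] at hu hv
    refine R.adj_iff_share.2 ⟨huv, ?_⟩
    rw [← hcorners, ← hcorners]
    exact good.clique u u.isLt v v.isLt ⟨hu, hv⟩ fun h => huv (Fin.ext h)
  · rw [← hcount]
    -- A path without edges does not share an edge with itself. In a clique with at least two
    -- vertices every path has an edge; smaller cliques are covered by the initial mark.
    rcases Nat.lt_or_ge 1 C.card with h1 | h1
    · have hshare : ∀ x ∈ C, ∀ y ∈ C, Share (R.corners x) (R.corners y) := by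
        intro x hx y hy
        by_cases hxy : x = y
        · subst hxy
          obtain ⟨y, hy, hne⟩ := Finset.exists_mem_ne h1 x
          obtain ⟨o, a, i, j, k, l, s1, -⟩ := (R.adj_iff_share.1 (hC hx hy hne.symm)).2
          exact ⟨o, _, i, j, i, j, s1, s1, rfl, rfl, s1.2.2, s1.2.2⟩
        · exact (R.adj_iff_share.1 (hC hx hy hxy)).2
      obtain ⟨f, S, T, hST, hS, hT⟩ := hm R.corners (C : Set (Fin n))
        (Finset.coe_nonempty.2 (Finset.card_pos.1 (by omega))) (fun v => (R.corners_spec v).1)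
        hshare
      have hpat : ∀ (U : Set (Pattern m)) (w : Fin n),
          InPatterns U (fun k => (f k : ℕ)) R.input.arr w ↔ pattern R.corners f w ∈ U := by
        intro U w
        simp only [InPatterns, pattern, R.memCorners_input]
      have hside : ∀ U : Set (Pattern m),
          (∀ u v, pattern R.corners f u ∈ U → pattern R.corners f v ∈ U →
            Share (R.corners u) (R.corners v)) →
          ∀ u < n, ∀ v < n, InPatterns U (fun k => (f k : ℕ)) R.input.arr u →
            InPatterns U (fun k => (f k : ℕ)) R.input.arr v →
            Share (memCorners R.input.arr u) (memCorners R.input.arr v) := by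
        intro U hU u hu v hv h h'
        rw [R.memCorners_input ⟨u, hu⟩, R.memCorners_input ⟨v, hv⟩]
        exact hU _ _ ((hpat U ⟨u, hu⟩).1 h) ((hpat U ⟨v, hv⟩).1 h')
      rw [← Finset.card_map Fin.valEmbedding]
      refine hmax (fun k => f k) S T _ (fun k => (f k).isLt) (hside S hS) (hside T hT) ?_ ?_
      · simp only [Finset.mem_map, Fin.valEmbedding_apply, forall_exists_index, and_imp]
        rintro _ x hx rfl
        exact ⟨x.isLt, (hST x hx).imp (hpat S x).2 (hpat T x).2⟩
      · simp only [Finset.mem_map, Fin.valEmbedding_apply, forall_exists_index, and_imp]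
        rintro _ x hx rfl _ y hy rfl
        rw [R.memCorners_input, R.memCorners_input]
        exact hshare x hx y hy
    · rcases Nat.eq_zero_or_pos n with rfl | hn
      · have := Finset.card_le_univ C
        simp at this
        simp [this]
      · exact h1.trans (hpos hn)
  · rcases good.indicator i i.isLt with h | h <;> simp [h]
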